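/- Let $n\ge 3$ and fix real parameters $\kappa_1<\dots<\kappa_n$ that are generic, i.e. the sums $\kappa_i+\kappa_j$ $(i<j)$ are pairwise distinct. **Soliton graphs.** Let $A$ be a real $2\times n$ matrix all of whose $2\times 2$ minors $\Delta_{ij}(A)$ $(i<j)$ are positive, i.e. a representative of a point of $(Gr_{2,n})_{>0}$, and let $t\in\mathbb R$. Put $$f_A(x,y,t)=\max_{i<j}\Bigl\{\ln\bigl(\Delta_{ij}(A)(\kappa_j-\kappa_i)\bigr)+(\kappa_i+\kappa_j)x+(\kappa_i^2+\kappa_j^2)y+(\kappa_i^3+\kappa_j^3)t\Bigr\}.$$ The contour plot of $A$ at time $t$ is the set of points of the $xy$-plane near which $f_A(\cdot,\cdot,t)$ is not affine-linear. Each region of its complement is labelled by the pair $\{i,j\}$ whose term is the maximum there. A segment, ray or line of the plot that separates two regions whose labels share exactly one index, say $\{i,m\}$ and $\{j,m\}$, is a line-soliton of type $[i,j]$; a segment that separates regions with disjoint labels is the phase shift of an $X$-crossing. The contour plot is called generic without $X$-crossings if all interactions of line-solitons are at trivalent vertices, i.e. all its segments, rays and lines are line-solitons and no point of the plane lies in the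 closure of more than three regions. In that case its soliton graph is the plot considered up to isotopy as a graph embedded in a disk, each unbounded line-soliton being made to end at a boundary vertex of the disk; its regions are labelled by their pairs, its edges by their types, and a trivalent vertex is black (respectively white) if a unique edge extends downwards (respectively upwards) from it. **The graphs $\Psi(T)$.** Let $T$ be a triangulation of a convex $n$-gon $P$ with vertices labelled $1,\dots,n$ counterclockwise. (1) Put a black vertex inside each triangle of $T$. (2) Put a white vertex at each vertex of $P$ that is incident to a diagonal of $T$, and a black vertex at each other vertex of $P$. (3) Connect the vertex inside each triangle to the three vertices of the triangle. (4) Erase the edges of $T$ and contract every edge joining two vertices of the same colour. (5) Attach one unbounded ray, directed out of $P$, for each vertex of $P$, at the vertex of the graph that this vertex of $P$ has become; the free end of each ray is a boundary vertex. The bounded regions now correspond to the diagonals of $T$ and the unbounded ones to the sides of $P$, and each region is labelled by the pair of end points of its diagonal or side. (6) Resolve each non-trivalent vertex, of degree $m\ge 4$ and necessarily white, into trivalent white vertices, i.e. replace it by a plane tree with $m$ leaves and trivalent inner vertices; any such tree may be chosen. An edge that separates the regions $\{a,b\}$ and $\{a,c\}$ is labelled $[b,c]$. Each labelled graph obtained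 in this way is called a graph $\Psi(T)$. **Theorem.** For every triangulation $T$ of the $n$-gon, every graph $\Psi(T)$ (with any choice of the resolutions in step (6)) is a soliton graph for $(Gr_{2,n})_{>0}$: there are a point $A\in(Gr_{2,n})_{>0}$ and a time $t$ such that the contour plot of $A$ at time $t$ is generic without $X$-crossings and its soliton graph is $\Psi(T)$. Conversely, for all $A\in(Gr_{2,n})_{>0}$ and $t\in\mathbb R$ for which the contour plot is generic without $X$-crossings, its soliton graph is a graph $\Psi(T)$ for some triangulation $T$ of the $n$-gon and some choice of the resolutions. Here graphs embedded in a disk are identified if they agree up to an orientation-preserving homeomorphism that respects the colours and all labels. -/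

import Mathlib

/-! ## Bicoloured labelled graphs embedded in a disk -/

/-- A bicoloured graph embedded in a disk, with labelled regions and edges, up to isotopy: a
combinatorial map.  A dart is an edge together with one of its two orientations, `rev` reverses the
orientation, and `next d d'` says that `d'` follows `d` in the counterclockwise order of the darts
which leave the source of `d`; so the vertices are the cycles of `next`, and a boundary vertex of
the disk, which is incident to a single edge, is a cycle of length one.  `black`, `white` and
`boundary` describe the source of a dart, `left d` is the label of the region on the left-hand side
of `d`, and `edgeLabel d = {i, j}` is the type `[i, j]` of the edge that carries `d`. -/
structure DiskGraph (n : ℕ) where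
  Dart : Type
  rev : Dart → Dart
  next : Dart → Dart → Prop
  black : Dart → Prop
  white : Dart → Prop
  boundary : Dart → Prop
  left : Dart → Finset (Fin n)
  edgeLabel : Dart → Finset (Fin n)

/-- An identification of two labelled embedded graphs: it preserves the incidences, the cyclic order
of the edges at each vertex (hence the embedding), the colours and all labels. -/
structure DiskGraph.Iso {n : ℕ} (G H : DiskGraph n) where
  toEquiv : G.Dart ≃ H.Dart
  map_rev : ∀ d, toEquiv (G.rev d) = H.rev (toEquiv d)
  map_next : ∀ d d', H.next (toEquiv d) (toEquiv d') ↔ G.next d d'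
  map_black : ∀ d, H.black (toEquiv d) ↔ G.black d
  map_white : ∀ d, H.white (toEquiv d) ↔ G.white d
  map_boundary : ∀ d, H.boundary (toEquiv d) ↔ G.boundary d
  map_left : ∀ d, H.left (toEquiv d) = G.left d
  map_edgeLabel : ∀ d, H.edgeLabel (toEquiv d) = G.edgeLabel d

/-! ## Contour plots and soliton graphs -/

/-- The `k`-element subsets of `[n]`. -/
abbrev KSubset (k n : ℕ) : Type := {I : Finset (Fin n) // I.card = k}

/-- The maximal minor `Δ_I(A)` in the column set `I`. -/
noncomputable def minor {k n : ℕ} (A : Matrix (Fin k) (Fin n) ℝ) (I : KSubset k n) : ℝ :=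
  (A.submatrix id (I.1.orderEmbOfFin I.2)).det

/-- `A` represents a point of the totally positive Grassmannian `(Gr_{k,n})_{>0}`. -/
def IsTotallyPositive {k n : ℕ} (A : Matrix (Fin k) (Fin n) ℝ) : Prop :=
  ∀ I : KSubset k n, 0 < minor A I

/-- Generic parameters `κ_1 < ⋯ < κ_n`: for `2 ≤ d ≤ k` the sums of `d` of them are distinct. -/
def IsGenericParameter (k : ℕ) {n : ℕ} (κ : Fin n → ℝ) : Prop :=
  StrictMono κ ∧ ∀ d, 2 ≤ d → d ≤ k → ∀ I J : Finset (Fin n), I.card = d → J.card = d →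
    ∑ i ∈ I, κ i = ∑ j ∈ J, κ j → I = J

/-- `K_I = ∏_{l < m} (κ_{j_m} - κ_{j_l})` for `I = {j_1 < ⋯ < j_k}`. -/
def vandermonde {k n : ℕ} (κ : Fin n → ℝ) (I : KSubset k n) : ℝ :=
  ∏ i ∈ I.1, ∏ j ∈ I.1 with i < j, (κ j - κ i)

/-- The logarithm of the exponential term `Δ_I(A) E_I(x, y, t)` of the `τ`-function. -/
noncomputable def phase {k n : ℕ} (κ : Fin n → ℝ) (A : Matrix (Fin k) (Fin n) ℝ) (t : ℝ)
    (I : KSubset k n) (p : ℝ × ℝ) : ℝ :=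
  Real.log (minor A I * vandermonde κ I) +
    ∑ i ∈ I.1, (κ i * p.1 + κ i ^ 2 * p.2 + κ i ^ 3 * t)

/-- The function `f_A(x, y, t)` of a totally positive `A`: the maximum runs over all `k`-subsets,
because all the minors of `A` are positive. -/
noncomputable def tropicalTau {k n : ℕ} (κ : Fin n → ℝ) (A : Matrix (Fin k) (Fin n) ℝ) (t : ℝ)
    (p : ℝ × ℝ) : ℝ :=
  ⨆ I : KSubset k n, phase κ A t I p

/-- The contour plot at time `t`: the locus where `f_A` is not (locally affine-)linear. -/
def contourPlot {k n : ℕ} (κ : Fin n → ℝ) (A : Matrix (Fin k) (Fin n) ℝ) (t : ℝ) :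
    Set (ℝ × ℝ) :=
  {p | ¬ ∃ g : (ℝ × ℝ) →ᵃ[ℝ] ℝ, tropicalTau κ A t =ᶠ[nhds p] g}

/-- The region of the complement of the contour plot in which `E_I` is the dominant exponential
(empty if there is no such region). -/
def solitonRegion {k n : ℕ} (κ : Fin n → ℝ) (A : Matrix (Fin k) (Fin n) ℝ) (t : ℝ)
    (I : KSubset k n) : Set (ℝ × ℝ) :=
  {p | p ∉ contourPlot κ A t ∧ tropicalTau κ A t p = phase κ A t I p}

/-- The common boundary of the regions of `I` and `J`. -/
def solitonWall {k n : ℕ} (κ : Fin n → ℝ) (A : Matrix (Fin k) (Fin n) ℝ) (t : ℝ)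
    (I J : KSubset k n) : Set (ℝ × ℝ) :=
  closure (solitonRegion κ A t I) ∩ closure (solitonRegion κ A t J)

/-- The regions of `I` and `J` are adjacent: they are separated by a line segment, ray or line of
the contour plot (and do not merely touch at a point). -/
def AreAdjacent {k n : ℕ} (κ : Fin n → ℝ) (A : Matrix (Fin k) (Fin n) ℝ) (t : ℝ)
    (I J : KSubset k n) : Prop :=
  I ≠ J ∧ (solitonWall κ A t I J).Nontrivial

/-- The contour plot is generic and has no `X`-crossings: all its interactions of line-solitons are
at trivalent vertices.  First, every segment of the plot is a line-soliton `[i, j]`, that is, it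
separates regions whose labels share `k - 1` indices: any other segment is the phase shift of an
`X`-crossing.  Secondly, no point is adherent to more than three regions. -/
def IsGenericWithoutXCrossings {k n : ℕ} (κ : Fin n → ℝ) (A : Matrix (Fin k) (Fin n) ℝ) (t : ℝ) :
    Prop :=
  (∀ I J, AreAdjacent κ A t I J → (I.1 ∩ J.1).card + 1 = k) ∧
    ∀ p, {I : KSubset k n | p ∈ closure (solitonRegion κ A t I)}.ncard ≤ 3

/-- A line-soliton with an orientation.  It is given by the pair `(I, J)` of the regions on its
left-hand side and on its right-hand side. -/
abbrev SolitonDart {k n : ℕ} (κ : Fin n → ℝ) (A : Matrix (Fin k) (Fin n) ℝ) (t : ℝ) : Type :=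
  {d : KSubset k n × KSubset k n // AreAdjacent κ A t d.1 d.2}

/-- The opposite orientation. -/
def SolitonDart.rev {k n : ℕ} {κ : Fin n → ℝ} {A : Matrix (Fin k) (Fin n) ℝ} {t : ℝ}
    (d : SolitonDart κ A t) : SolitonDart κ A t :=
  ⟨(d.1.2, d.1.1), d.2.1.symm, by
    have h := d.2.2
    unfold solitonWall at h ⊢
    rwa [Set.inter_comm]⟩

/-- The direction of an oriented line-soliton.  The gradient `g` of `phase I - phase J` is a normal
vector that points to the side of `I`, and `g` rotated clockwise by a right angle is the direction
that has `I` on its left. -/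
def SolitonDart.direction {k n : ℕ} {κ : Fin n → ℝ} {A : Matrix (Fin k) (Fin n) ℝ} {t : ℝ}
    (d : SolitonDart κ A t) : ℝ × ℝ :=
  (∑ i ∈ d.1.1.1, κ i ^ 2 - ∑ j ∈ d.1.2.1, κ j ^ 2, -(∑ i ∈ d.1.1.1, κ i - ∑ j ∈ d.1.2.1, κ j))

/-- The point `p` is the starting point of the oriented line-soliton `d`. -/
def SolitonDart.StartsAt {k n : ℕ} {κ : Fin n → ℝ} {A : Matrix (Fin k) (Fin n) ℝ} {t : ℝ}
    (d : SolitonDart κ A t) (p : ℝ × ℝ) : Prop :=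
  p ∈ solitonWall κ A t d.1.1 d.1.2 ∧
    ∀ q ∈ solitonWall κ A t d.1.1 d.1.2,
      0 ≤ (q.1 - p.1) * d.direction.1 + (q.2 - p.2) * d.direction.2

/-- The soliton graph of a contour plot that is generic and has no `X`-crossings.  An oriented
line-soliton without a starting point comes from infinity; after the embedding into a disk it starts
at a boundary vertex.  At a vertex `p` the dart that follows `d` counterclockwise is the one that
has on its right the region on the left of `d`.  A vertex is black (white) if it has a unique edge
that extends downwards (upwards) from it.  Regions are labelled by their dominant exponentials, and
an edge between the regions `I` and `J` by its type, the symmetric difference of `I` and `J`. -/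
def solitonGraph {k n : ℕ} (κ : Fin n → ℝ) (A : Matrix (Fin k) (Fin n) ℝ) (t : ℝ) :
    DiskGraph n where
  Dart := SolitonDart κ A t
  rev := SolitonDart.rev
  next d d' := (∃ p, d.StartsAt p ∧ d'.StartsAt p ∧ d'.1.2 = d.1.1) ∨
    ((¬ ∃ p, d.StartsAt p) ∧ d' = d)
  black d := ∃ p, d.StartsAt p ∧
    ∃! e : SolitonDart κ A t, e.StartsAt p ∧ e.direction.2 < 0
  white d := ∃ p, d.StartsAt p ∧
    ∃! e : SolitonDart κ A t, e.StartsAt p ∧ 0 < e.direction.2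
  boundary d := ¬ ∃ p, d.StartsAt p
  left d := d.1.1.1
  edgeLabel d := symmDiff d.1.1.1 d.1.2.1

/-! ## Triangulations of a polygon and the graphs `Ψ(T)` -/

/-- Two chords of the convex polygon with vertices `0, …, n - 1` (in this cyclic order) cross. -/
def Crosses {n : ℕ} (e f : Finset (Fin n)) : Prop :=
  ∃ a b c d : Fin n, a < b ∧ b < c ∧ c < d ∧
    ((e = {a, c} ∧ f = {b, d}) ∨ (e = {b, d} ∧ f = {a, c}))

/-- `T` is (the set of all edges, that is, sides and diagonals, of) a triangulation of the convex
polygon with vertex set `S`, where `S` is a set of vertices of the `n`-gon: a maximal set of pairwise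
noncrossing chords of `S`.  Sides cross no chord, so that they belong to `T`.  If `S` has only two
elements, `T` consists of the single segment between them. -/
def IsTriangulation {n : ℕ} (S : Set (Fin n)) (T : Set (Finset (Fin n))) : Prop :=
  (∀ e ∈ T, e.card = 2 ∧ ∀ i ∈ e, i ∈ S) ∧
  (∀ e ∈ T, ∀ f ∈ T, ¬ Crosses e f) ∧
  ∀ e : Finset (Fin n), e.card = 2 → (∀ i ∈ e, i ∈ S) → (∀ f ∈ T, ¬ Crosses e f) → e ∈ T

/-- The corners of the `n`-gon that are joined to the corner `a` by an edge of `T`. -/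
def link {n : ℕ} (T : Set (Finset (Fin n))) (a : Fin n) : Set (Fin n) :=
  {b | {a, b} ∈ T ∧ a ≠ b}

/-- The choices made when the non-trivalent vertices are resolved.

Put a centre into each triangle of `T`, join it to the three corners of the triangle, and attach an
outward ray to each corner `a`.  The edges at `a`, that is, its spokes (to the centres of the
triangles at `a`) and its ray, separate regions `{a, b}`, one for each `b ∈ link T a`; so there are
`m` edges and `m` regions around `a`, where `m` is the cardinality of `link T a`.

If `m ≥ 3`, then `a` is white, and resolving it means to replace it by a plane tree with trivalent
white vertices whose `m` leaves are these edges.  Such trees are the dual trees of the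
triangulations `τ a` of the `m`-gon whose corners are the `m` regions around `a`: the sides of this
`m`-gon are dual to the spokes and the ray, its triangles are the new trivalent vertices, and its
diagonals are dual to the new edges between them.  For `m = 3` there is nothing to choose.

If `m = 2`, then `a` is incident to no diagonal and black.  It is contracted with the centre of
the only triangle at `a`, which makes one edge of its spoke and its ray; then `τ a` consists of the
single segment between the two elements of `link T a`, dual to this edge. -/
def IsResolution {n : ℕ} (T : Set (Finset (Fin n))) (τ : Fin n → Set (Finset (Fin n))) : Prop :=
  ∀ a, IsTriangulation (link T a) (τ a)

/-- An oriented edge of the resolved graph `Ψ(T)`.  It belongs to what has become of the corner `a`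
of the polygon, has the region `{a, b}` on its left and the region `{a, c}` on its right. -/
@[ext]
structure PsiDart {n : ℕ} (τ : Fin n → Set (Finset (Fin n))) where
  a : Fin n
  b : Fin n
  c : Fin n
  ne : b ≠ c
  mem : {b, c} ∈ τ a

/-- The opposite orientation. -/
def PsiDart.rev {n : ℕ} {τ : Fin n → Set (Finset (Fin n))} (d : PsiDart τ) : PsiDart τ :=
  ⟨d.a, d.c, d.b, d.ne.symm, by rw [Finset.pair_comm]; exact d.mem⟩

/-- The vertices of the resolved graph `Ψ(T)`: the (black) centres of the triangles `Δ` of `T`, the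
white vertices dual to the triangles `δ` of `τ a`, and the boundary vertices at the ends of the
rays, one for each corner `a` of the polygon. -/
inductive PsiVertex (n : ℕ) : Type
  | centre (Δ : Finset (Fin n))
  | node (a : Fin n) (δ : Finset (Fin n))
  | rayEnd (a : Fin n)

/-- The source of an oriented edge.  If `a, b, c` are the corners, in counterclockwise order, of a
triangle of `T`, then the edge comes from the centre of this triangle.  If `b, c, x` are the corners
of a triangle of `τ a`, in clockwise order, then it comes from the white vertex dual to it.  If `a`
is preceded by `b` and followed by `c` on the polygon, then it comes in along the ray at `a`. -/
def PsiDart.StartsAt {n : ℕ} (T : Set (Finset (Fin n))) {τ : Fin n → Set (Finset (Fin n))}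
    (d : PsiDart τ) : PsiVertex n → Prop
  | .centre Δ => sbtw d.a d.b d.c ∧ {d.b, d.c} ∈ T ∧ Δ = {d.a, d.b, d.c}
  | .node a δ => a = d.a ∧
      ∃ x, sbtw d.c d.b x ∧ {d.b, x} ∈ τ a ∧ {d.c, x} ∈ τ a ∧ δ = {d.b, d.c, x}
  | .rayEnd a => a = d.a ∧ finRotate n d.b = d.a ∧ finRotate n d.a = d.c

/-- The labelled graph `Ψ(T)` with its non-trivalent vertices resolved by `τ`, the corners of the
polygon being in counterclockwise order.  Around an inner vertex, the dart that follows `d`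
counterclockwise is the one that has on its right the region on the left of `d`.  The regions are
labelled by the edges `{i, j}` of `T`, the bounded ones by diagonals and the unbounded ones by
sides; an edge between the regions `{a, b}` and `{a, c}` is of type `{b, c}`. -/
def psiGraph {n : ℕ} (T : Set (Finset (Fin n))) (τ : Fin n → Set (Finset (Fin n))) :
    DiskGraph n where
  Dart := PsiDart τ
  rev := PsiDart.rev
  next d d' :=
    (∃ v, (∀ a, v ≠ .rayEnd a) ∧ d.StartsAt T v ∧ d'.StartsAt T v ∧
      ({d'.a, d'.c} : Finset (Fin n)) = {d.a, d.b}) ∨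
    ((∃ a, d.StartsAt T (.rayEnd a)) ∧ d' = d)
  black d := ∃ Δ, d.StartsAt T (.centre Δ)
  white d := ∃ a δ, d.StartsAt T (.node a δ)
  boundary d := ∃ a, d.StartsAt T (.rayEnd a)
  left d := {d.a, d.b}
  edgeLabel d := {d.b, d.c}

/-! The phases are affine functions of (x, y), and an index i contributes the value of a linear form
at (κ_i, κ_i²). These points lie on a parabola, hence in convex position and in the cyclic order of
the polygon. Along the wall between {m,a} and {m,b} the contribution of x exceeds that of a by (κ_b
- κ_a)(κ_x - κ_a)(κ_x - κ_b), so that cyclic betweenness decides which phases rise or fall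
(`vertexSlope_wallDir`, `prod_neg_iff_sbtw`).

From plots to triangulations. Follow a wall backwards until another phase takes over. Regions that
meet at a point share labels, so the newcomer is {m,x} with x between a and b (a white vertex) or
{a,b} (a black vertex), or there is none and a, m, b are consecutive (`GenericPlot.trichotomy`).
Crossing walls around m would bring four regions to one point (`GenericPlot.not_crosses_wallPairs`),
and a black vertex screens off the regions behind it (`GenericPlot.not_mem_of_black`). Hence the
walls around m triangulate the link of m. The black vertices supply the triangles of a triangulation
formed by the labels (`GenericPlot.exists_black`, `GenericPlot.isTriangulation_regionLabels`).
Reading off the starting points of walls gives `GenericPlot.iso`.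

From triangulations to plots. Take t = 0 and prescribe the minors on the edges of T so that the
constant term of {a,b} is M w(a,b) + g(a,b), with M large. The other minors follow from the Plücker
relations.

The coarse part w makes all edges at m meet in one point, while the opposite sides of the triangles
at m stay strictly below (`IsTriangulation.exists_acute`). A point p together with a height F is
encoded by the "level" F/2 - vertexSlope(x, p), a quadratic polynomial in κ_x; the pair {i,j} lies
below it by the amount `gap`. The growth rates of the minors satisfy tropical Plücker relations,
which propagate positivity of the gap from the triangles to all non-edges at the levels of corners
and of triangles (`CoarsePlot.belowLevel`, `CoarsePlot.gap_black_pos`). Every cell of the coarse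
plot is controlled by these special levels, so non-edges stay uniformly below the maximum
(`CoarsePlot.exists_gap`) and disappear for large M (`CoarsePlot.regionLabels_subset`).

The fine part g is concave around each corner m and folded exactly along the chords of τ m; it
splits the multiple point of m into the prescribed tree (`FoldedPlot.mem_of_adherent`). Quadratic
corrections make g symmetric. Phase shifts are excluded by the Plücker relation itself
(`sharesLabel_columnMatrix`). Since triangulations are maximal, containment of the labels in T and
of the walls in τ already identifies the graph (`nonempty_iso_of_subset`). -/

section CyclicOrder

/-! ### Cyclic order and triangulations of the polygon. -/

variable {n : ℕ}

theorem Finset.pair_eq_iff {α : Type*} [DecidableEq α] {a b c d : α} :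
    ({a, b} : Finset α) = {c, d} ↔ (a = c ∧ b = d) ∨ (a = d ∧ b = c) := by
  rw [← Finset.coe_inj]
  push_cast
  exact Set.pair_eq_pair_iff

/-- Two chords cross if and only if each separates the end points of the other. -/
theorem crosses_iff {a b c d : Fin n} :
    Crosses ({a, c} : Finset (Fin n)) {b, d} ↔
      (sbtw a b c ∧ sbtw c d a) ∨ (sbtw a d c ∧ sbtw c b a) := by
  simp only [Fin.sbtw_iff]
  constructor
  · rintro ⟨x, y, z, w, h1, h2, h3, ⟨h4, h5⟩ | ⟨h4, h5⟩⟩ <;>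
      rw [Finset.pair_eq_iff] at h4 h5 <;>
      rcases h4 with ⟨rfl, rfl⟩ | ⟨rfl, rfl⟩ <;> rcases h5 with ⟨rfl, rfl⟩ | ⟨rfl, rfl⟩ <;> omega
  · intro h
    have key : ∀ x y z w : Fin n, x < y → y < z → z < w →
        ((a = x ∧ c = z) ∨ (a = z ∧ c = x)) ∧ ((b = y ∧ d = w) ∨ (b = w ∧ d = y)) ∨
        ((a = y ∧ c = w) ∨ (a = w ∧ c = y)) ∧ ((b = x ∧ d = z) ∨ (b = z ∧ d = x)) →
        Crosses ({a, c} : Finset (Fin n)) {b, d} := by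
      intro x y z w h1 h2 h3 h4
      refine ⟨x, y, z, w, h1, h2, h3, ?_⟩
      simpa only [Finset.pair_eq_iff] using h4
    rcases lt_trichotomy a c with hac | hac | hac <;> rcases lt_trichotomy b d with hbd | hbd | hbd
    · rcases lt_or_ge a b with hab | hab
      · exact key a b c d (by omega) (by omega) (by omega) (by simp)
      · exact key b a d c (by omega) (by omega) (by omega) (by simp)
    · omega
    · rcases lt_or_ge a d with hab | hab
      · exact key a d c b (by omega) (by omega) (by omega) (by simp)
      · exact key d a b c (by omega) (by omega) (by omega) (by simp)
    · omega
    · omega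
    · omega
    · rcases lt_or_ge c b with hab | hab
      · exact key c b a d (by omega) (by omega) (by omega) (by simp)
      · exact key b c d a (by omega) (by omega) (by omega) (by simp)
    · omega
    · rcases lt_or_ge c d with hab | hab
      · exact key c d a b (by omega) (by omega) (by omega) (by simp)
      · exact key d c b a (by omega) (by omega) (by omega) (by simp)

theorem Crosses.symm {e f : Finset (Fin n)} (h : Crosses e f) : Crosses f e := by
  obtain ⟨a, b, c, d, h1, h2, h3, h⟩ := h
  exact ⟨a, b, c, d, h1, h2, h3, h.symm.imp And.symm And.symm⟩

/-- The position of `x` in the counterclockwise order which starts at `a`. -/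
def cycPos (a x : Fin n) : ℕ := if a ≤ x then x - a else n + x - a

/-- The position of `a` itself is 0, although `a` is not strictly between; hence the condition `a ≠
x`. -/
theorem sbtw_iff_cycPos {a x y : Fin n} : sbtw a x y ↔ a ≠ x ∧ cycPos a x < cycPos a y := by
  unfold cycPos
  simp only [Fin.sbtw_iff]
  split_ifs <;> omega

theorem exists_maximal_sbtw (a b : Fin n) (p : Fin n → Prop) (h : ∃ x, sbtw a x b ∧ p x) :
    ∃ x, sbtw a x b ∧ p x ∧ ∀ y, sbtw x y b → ¬ p y := by
  classical
  obtain ⟨x, hx, hmax⟩ := Finset.exists_max_image (Finset.univ.filter fun x => sbtw a x b ∧ p x)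
    (cycPos a) (by obtain ⟨x, hx⟩ := h; exact ⟨x, by simpa using hx⟩)
  simp only [Finset.mem_filter, Finset.mem_univ, true_and] at hx hmax
  refine ⟨x, hx.1, hx.2, fun y hy hp => ?_⟩
  have h1 : sbtw a y b := by simp only [Fin.sbtw_iff] at hy hx ⊢; omega
  have h2 := hmax y ⟨h1, hp⟩
  have h3 : sbtw a x y := by simp only [Fin.sbtw_iff] at hy hx ⊢; omega
  exact absurd (sbtw_iff_cycPos.1 h3).2 (by omega)

theorem exists_minimal_sbtw (a b : Fin n) (p : Fin n → Prop) (h : ∃ x, sbtw a x b ∧ p x) :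
    ∃ x, sbtw a x b ∧ p x ∧ ∀ y, sbtw a y x → ¬ p y := by
  classical
  obtain ⟨x, hx, hmin⟩ := Finset.exists_min_image (Finset.univ.filter fun x => sbtw a x b ∧ p x)
    (cycPos a) (by obtain ⟨x, hx⟩ := h; exact ⟨x, by simpa using hx⟩)
  simp only [Finset.mem_filter, Finset.mem_univ, true_and] at hx hmin
  refine ⟨x, hx.1, hx.2, fun y hy hp => ?_⟩
  have h1 : sbtw a y b := by
    have := hx.1; simp only [Fin.sbtw_iff] at hy this ⊢; omega
  have h2 := hmin y ⟨h1, hp⟩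
  exact absurd (sbtw_iff_cycPos.1 hy).2 (by omega)

/-- A side of the polygon crosses no chord. -/
theorem not_crosses_of_side {a b : Fin n} (h : ∀ x, ¬ sbtw a x b) (f : Finset (Fin n)) :
    ¬ Crosses {a, b} f := by
  rintro ⟨x, y, z, w, h1, h2, h3, ⟨h4, -⟩ | ⟨h4, -⟩⟩ <;> rw [eq_comm, Finset.pair_eq_iff] at h4 <;>
    have hx := h x <;> have hy := h y <;> have hz := h z <;> have hw := h w <;>
    simp only [Fin.sbtw_iff] at hx hy hz hw <;> omega

theorem sbtw_of_sbtw_left {a b c w : Fin n} (hc : sbtw a c b) (hw : sbtw a w c) : sbtw a w b := by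
  simp only [Fin.sbtw_iff] at *
  omega

theorem sbtw_of_sbtw_right {a b c w : Fin n} (hc : sbtw a c b) (hw : sbtw c w b) : sbtw a w b := by
  simp only [Fin.sbtw_iff] at *
  omega

/-- A chord that crosses neither `{a, c}` nor `{c, b}` and ends in the closed arc from `a` to `b`
is `{a, b}` or ends in the closed arc from `a` to `c` or in that from `c` to `b`. -/
theorem arc_split {a b c x y : Fin n} (hc : sbtw a c b) (hxa : x = a ∨ x = b ∨ sbtw a x b)
    (hya : y = a ∨ y = b ∨ sbtw a y b) (h2 : ¬ Crosses {x, y} {a, c})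
    (h3 : ¬ Crosses {x, y} {c, b}) (hxy : ¬ ((x = a ∨ x = b) ∧ (y = a ∨ y = b))) :
    ((x = a ∨ x = c ∨ sbtw a x c) ∧ (y = a ∨ y = c ∨ sbtw a y c)) ∨
      ((x = c ∨ x = b ∨ sbtw c x b) ∧ (y = c ∨ y = b ∨ sbtw c y b)) := by
  rw [crosses_iff] at h2 h3
  simp only [Fin.sbtw_iff] at *
  grind

variable {T : Set (Finset (Fin n))}

theorem IsTriangulation.side_mem (hT : IsTriangulation Set.univ T) {a b : Fin n} (hab : a ≠ b)
    (h : ∀ x, ¬ sbtw a x b) : {a, b} ∈ T :=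
  hT.2.2 _ (Finset.card_pair hab) (by simp) fun f _ => not_crosses_of_side h f

theorem Finset.exists_pair_of_card_two {α : Type*} [DecidableEq α] {s : Finset α} (h : s.card = 2) :
    ∃ a b, a ≠ b ∧ s = {a, b} := Finset.card_eq_two.1 h

/-- Each edge of a triangulation is a side of a triangle on each side which contains vertices. -/
theorem IsTriangulation.exists_apex (hT : IsTriangulation Set.univ T) {a b : Fin n}
    (hab : {a, b} ∈ T) (h : ∃ x, sbtw a x b) :
    ∃ c, sbtw a c b ∧ {a, c} ∈ T ∧ {c, b} ∈ T := by
  have h1 : ∃ x, sbtw a x b ∧ ({a, x} : Finset (Fin n)) ∈ T := by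
    obtain ⟨x, hx, -, hmin⟩ := exists_minimal_sbtw a b (fun _ => True) (by simpa using h)
    exact ⟨x, hx, hT.side_mem (by simp only [Fin.sbtw_iff] at hx; omega)
      fun y hy => hmin y hy trivial⟩
  -- The apex is the last neighbour c of a before b. An edge of T across {c,b} ends strictly between
  -- c and b; since it crosses neither {a,b} nor {a,c}, its other end is a, against the choice of c.
  obtain ⟨c, hc, hac, hmax⟩ := exists_maximal_sbtw a b (fun x => {a, x} ∈ T) h1
  refine ⟨c, hc, hac, hT.2.2 _ (Finset.card_pair ?_) (by simp) fun f hf hcr => ?_⟩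
  · simp only [Fin.sbtw_iff] at hc; omega
  · obtain ⟨x, y, hxy, rfl⟩ := Finset.exists_pair_of_card_two (hT.1 f hf).1
    have key : ∀ x y : Fin n, {x, y} ∈ T → sbtw c x b → sbtw b y c → False := by
      intro x y hf hx hy
      by_cases hya : y = a
      · subst hya
        exact hmax x hx (by rwa [Finset.pair_comm])
      have h2 := hT.2.1 _ hab _ hf
      have h3 := hT.2.1 _ hac _ hf
      rw [crosses_iff] at h2 h3
      simp only [Fin.sbtw_iff] at *
      clear hmax h1 h hT
      grind
    rw [crosses_iff] at hcr
    rcases hcr with ⟨h1, h2⟩ | ⟨h1, h2⟩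
    · exact key x y hf h1 h2
    · exact key y x (by rwa [Finset.pair_comm]) h1 h2

/-- A criterion for maximality: noncrossing chords of `S` of which one bounds all of `S`, such that
each chord is a side of a triangle on each side which contains elements of `S`. -/
theorem isTriangulation_of_exists_apex {S : Set (Fin n)}
    (h1 : ∀ e ∈ T, e.card = 2 ∧ ∀ i ∈ e, i ∈ S) (h2 : ∀ e ∈ T, ∀ f ∈ T, ¬ Crosses e f)
    {a₀ b₀ : Fin n} (h0 : {a₀, b₀} ∈ T) (hS : ∀ x ∈ S, x = a₀ ∨ x = b₀ ∨ sbtw a₀ x b₀)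
    (h3 : ∀ a b, {a, b} ∈ T → ∀ x ∈ S, sbtw a x b → (∀ y, sbtw a y b → y = a₀ ∨ y = b₀ ∨ sbtw a₀ y b₀) →
      ∃ c, sbtw a c b ∧ {a, c} ∈ T ∧ {c, b} ∈ T) :
    IsTriangulation S T := by
  refine ⟨h1, h2, fun e he heS hcr => ?_⟩
  obtain ⟨x, y, hxy, rfl⟩ := Finset.exists_pair_of_card_two he
  have hx := heS x (by simp)
  have hy := heS y (by simp)
  -- Induction on the length of the arc from a to b containing x and y: the triangle on it pushes
  -- both ends into one of two shorter arcs, until {x,y} is itself an edge. The condition on inner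
  -- points keeps the arc inside the initial one from a₀ to b₀.
  have key : ∀ N : ℕ, ∀ a b, {a, b} ∈ T → cycPos a b ≤ N →
      (∀ y, sbtw a y b → y = a₀ ∨ y = b₀ ∨ sbtw a₀ y b₀) →
      (x = a ∨ x = b ∨ sbtw a x b) → (y = a ∨ y = b ∨ sbtw a y b) → {x, y} ∈ T := by
    intro N
    induction N with
    | zero =>
      intro a b hab hN hin hxa hya
      have hne : a ≠ b := fun h => by subst h; simpa using (h1 _ hab).1
      clear h1 h2 h3 hS hin hxa hya
      unfold cycPos at hN
      split_ifs at hN <;> omega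
    | succ N ih =>
      intro a b hab hN hin hxa hya
      by_cases hx' : (x = a ∨ x = b) ∧ (y = a ∨ y = b)
      · rcases hx' with ⟨rfl | rfl, rfl | rfl⟩
        · exact absurd rfl hxy
        · exact hab
        · rwa [Finset.pair_comm]
        · exact absurd rfl hxy
      have hex : ∃ z ∈ S, sbtw a z b := by
        by_contra hno
        push Not at hno
        have e1 := hno x hx
        have e2 := hno y hy
        exact hx' ⟨by simpa [e1] using hxa, by simpa [e2] using hya⟩
      obtain ⟨z, hz, hzab⟩ := hex
      obtain ⟨c, hc, hac, hcb⟩ := h3 a b hab z hz hzab hin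
      have h6 : cycPos a c < cycPos a b := (sbtw_iff_cycPos.1 hc).2
      have h7 : cycPos c b < cycPos a b := by
        unfold cycPos
        simp only [Fin.sbtw_iff] at hc
        split_ifs <;> omega
      rcases arc_split hc hxa hya (hcr _ hac) (hcr _ hcb) hx' with hcase | hcase
      · exact ih a c hac (by omega) (fun w hw => hin w (sbtw_of_sbtw_left hc hw)) hcase.1 hcase.2
      · exact ih c b hcb (by omega) (fun w hw => hin w (sbtw_of_sbtw_right hc hw)) hcase.1 hcase.2
  exact key _ a₀ b₀ h0 le_rfl (fun _ h => Or.inr (Or.inr h)) (hS x hx) (hS y hy)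

end CyclicOrder

open Filter Topology

/-! ### Maxima of phases: domination and adherence. -/

section MaxPlus

variable {n : ℕ} (κ : Fin n → ℝ) (c : Finset (Fin n) → ℝ)

/-- The linear part of the phase of `s`. -/
def slope₂ (s : Finset (Fin n)) (δ : ℝ × ℝ) : ℝ := ∑ i ∈ s, (κ i * δ.1 + κ i ^ 2 * δ.2)

/-- The phase of `s` with constant term `c s`. -/
def height (s : Finset (Fin n)) (p : ℝ × ℝ) : ℝ := c s + slope₂ κ s p

/-- The phase of the pair `s` is maximal at `p`. -/
def Dominates (p : ℝ × ℝ) (s : Finset (Fin n)) : Prop :=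
  s.card = 2 ∧ ∀ s' : Finset (Fin n), s'.card = 2 → height κ c s' p ≤ height κ c s p

/-- The phase of the pair `s` is the only maximal one at `p`. -/
def StrictlyDominates (p : ℝ × ℝ) (s : Finset (Fin n)) : Prop :=
  s.card = 2 ∧ ∀ s' : Finset (Fin n), s'.card = 2 → s' ≠ s → height κ c s' p < height κ c s p

/-- The labels of the nonempty regions. -/
def regionLabels : Set (Finset (Fin n)) := {s | ∃ p, StrictlyDominates κ c p s}

/-- The point `p` is adherent to the nonempty region of `s`. -/
def Adherent (p : ℝ × ℝ) (s : Finset (Fin n)) : Prop := s ∈ regionLabels κ c ∧ Dominates κ c p s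

variable {κ c}

theorem slope₂_add_smul (s : Finset (Fin n)) (p δ : ℝ × ℝ) (r : ℝ) :
    slope₂ κ s (p + r • δ) = slope₂ κ s p + r * slope₂ κ s δ := by
  unfold slope₂
  rw [Finset.mul_sum, ← Finset.sum_add_distrib]
  refine Finset.sum_congr rfl fun i _ => ?_
  simp
  ring

theorem height_add_smul (s : Finset (Fin n)) (p δ : ℝ × ℝ) (r : ℝ) :
    height κ c s (p + r • δ) = height κ c s p + r * slope₂ κ s δ := by
  unfold height
  rw [slope₂_add_smul]
  ring

theorem height_eq_add_slope (s : Finset (Fin n)) (p q : ℝ × ℝ) :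
    height κ c s q = height κ c s p + slope₂ κ s (q - p) := by
  have := height_add_smul (κ := κ) (c := c) s p (q - p) 1
  simpa using this

theorem slope₂_pair {a b : Fin n} (h : a ≠ b) (δ : ℝ × ℝ) :
    slope₂ κ {a, b} δ = (κ a * δ.1 + κ a ^ 2 * δ.2) + (κ b * δ.1 + κ b ^ 2 * δ.2) := by
  unfold slope₂
  rw [Finset.sum_pair h]

theorem eventually_pos_add_mul {A B : ℝ} (h : 0 < A) : ∀ᶠ r in 𝓝[>] (0 : ℝ), 0 < A + r * B := by
  have h1 : Tendsto (fun r : ℝ => A + r * B) (𝓝 0) (𝓝 (A + 0 * B)) := by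
    apply Continuous.tendsto
    fun_prop
  rw [zero_mul, add_zero] at h1
  exact (h1.mono_left nhdsWithin_le_nhds).eventually (lt_mem_nhds h)

/-- Near p only the phases that are maximal at p compete, and among these the slope decides. -/
theorem eventually_strictlyDominates {p δ : ℝ × ℝ} {s : Finset (Fin n)} (hs : Dominates κ c p s)
    (h : ∀ s', s' ≠ s → Dominates κ c p s' → slope₂ κ s' δ < slope₂ κ s δ) :
    ∀ᶠ r in 𝓝[>] (0 : ℝ), StrictlyDominates κ c (p + r • δ) s := by
  have key : ∀ s' : Finset (Fin n), ∀ᶠ r in 𝓝[>] (0 : ℝ), s'.card = 2 → s' ≠ s →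
      height κ c s' (p + r • δ) < height κ c s (p + r • δ) := by
    intro s'
    by_cases hc : s'.card = 2 ∧ s' ≠ s
    · rcases (hs.2 s' hc.1).lt_or_eq with hlt | heq
      · filter_upwards [eventually_pos_add_mul (B := slope₂ κ s δ - slope₂ κ s' δ)
          (sub_pos.2 hlt)] with r hr _ _
        rw [height_add_smul, height_add_smul]
        linarith
      · have h1 := h s' hc.2 ⟨hc.1, fun t ht => heq ▸ hs.2 t ht⟩
        filter_upwards [self_mem_nhdsWithin] with r hr _ _
        rw [height_add_smul, height_add_smul, heq]
        have := mul_lt_mul_of_pos_left h1 (Set.mem_Ioi.1 hr)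
        linarith
    · exact Eventually.of_forall fun r h1 h2 => absurd ⟨h1, h2⟩ hc
  filter_upwards [eventually_all.2 key] with r hr
  exact ⟨hs.1, fun s' h1 h2 => hr s' h1 h2⟩

/-- Genericity of the parameters for pairs. -/
def DistinctSums (κ : Fin n → ℝ) : Prop :=
  ∀ I J : Finset (Fin n), I.card = 2 → J.card = 2 → ∑ i ∈ I, κ i = ∑ j ∈ J, κ j → I = J

theorem exists_pair_of_two_le (hn : 2 ≤ n) : ∃ s : Finset (Fin n), s.card = 2 := by
  refine ⟨{⟨0, by omega⟩, ⟨1, by omega⟩}, Finset.card_pair ?_⟩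
  simp

theorem exists_dominates (hn : 2 ≤ n) (p : ℝ × ℝ) : ∃ s, Dominates κ c p s := by
  classical
  obtain ⟨s0, hs0⟩ := exists_pair_of_two_le hn
  obtain ⟨s, hs, hmax⟩ := Finset.exists_max_image
    (Finset.univ.filter fun s : Finset (Fin n) => s.card = 2) (fun s => height κ c s p)
    ⟨s0, by simpa using hs0⟩
  simp only [Finset.mem_filter, Finset.mem_univ, true_and] at hs hmax
  exact ⟨s, hs, hmax⟩

/-- Ties are broken by moving in the x-direction: the phase with the largest sum of parameters wins,
and this sum determines the pair. -/
theorem exists_adherent (hn : 2 ≤ n) (hκ : DistinctSums κ) (p : ℝ × ℝ) : ∃ s, Adherent κ c p s := by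
  classical
  obtain ⟨s0, hs0⟩ := exists_dominates (κ := κ) (c := c) hn p
  obtain ⟨s, hs, hmax⟩ := Finset.exists_max_image
    (Finset.univ.filter fun s : Finset (Fin n) => Dominates κ c p s) (fun s => ∑ i ∈ s, κ i)
    ⟨s0, by simpa using hs0⟩
  simp only [Finset.mem_filter, Finset.mem_univ, true_and] at hs hmax
  have hsl : ∀ s, slope₂ κ s (1, 0) = ∑ i ∈ s, κ i := fun s => by simp [slope₂]
  have h := eventually_strictlyDominates (δ := (1, 0)) hs (fun s' hne hs' => by
    rw [hsl, hsl]
    exact lt_of_le_of_ne (hmax s' hs') fun h => hne (hκ _ _ hs'.1 hs.1 h))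
  obtain ⟨r, hr⟩ := h.exists
  exact ⟨s, ⟨_, hr⟩, hs⟩

theorem card_of_mem_regionLabels {s : Finset (Fin n)} (h : s ∈ regionLabels κ c) : s.card = 2 := by
  obtain ⟨p, hp⟩ := h
  exact hp.1

theorem Adherent.height_eq {p : ℝ × ℝ} {s s' : Finset (Fin n)} (h : Adherent κ c p s)
    (h' : Adherent κ c p s') : height κ c s p = height κ c s' p :=
  le_antisymm (h'.2.2 s h.2.1) (h.2.2 s' h'.2.1)

/-- Every point is adherent to a nonempty region, so that pairs without a region do not influence
the maximum. -/
theorem dominates_of_forall_label (hn : 2 ≤ n) (hκ : DistinctSums κ) {p : ℝ × ℝ}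
    {s : Finset (Fin n)} (hs : s.card = 2)
    (h : ∀ s' ∈ regionLabels κ c, height κ c s' p ≤ height κ c s p) : Dominates κ c p s := by
  obtain ⟨s0, hs0⟩ := exists_adherent (c := c) hn hκ p
  exact ⟨hs, fun s' hs' => (hs0.2.2 s' hs').trans (h s0 hs0.1)⟩

theorem Adherent.of_height_le {p : ℝ × ℝ} {s s' : Finset (Fin n)} (h : Adherent κ c p s)
    (hs' : s' ∈ regionLabels κ c) (hle : height κ c s p ≤ height κ c s' p) : Adherent κ c p s' :=
  ⟨hs', card_of_mem_regionLabels hs', fun t ht => (h.2.2 t ht).trans hle⟩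

theorem eventually_adherent (hn : 2 ≤ n) (hκ : DistinctSums κ) {p δ : ℝ × ℝ} {s : Finset (Fin n)}
    (hs : Adherent κ c p s) (h : ∀ s', Adherent κ c p s' → slope₂ κ s' δ ≤ slope₂ κ s δ) :
    ∀ᶠ r in 𝓝[>] (0 : ℝ), Adherent κ c (p + r • δ) s := by
  have key : ∀ s' : Finset (Fin n), ∀ᶠ r in 𝓝[>] (0 : ℝ), s' ∈ regionLabels κ c →
      height κ c s' (p + r • δ) ≤ height κ c s (p + r • δ) := by
    intro s'
    by_cases hc : s' ∈ regionLabels κ c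
    · rcases (hs.2.2 s' (card_of_mem_regionLabels hc)).lt_or_eq with hlt | heq
      · filter_upwards [eventually_pos_add_mul (B := slope₂ κ s δ - slope₂ κ s' δ)
          (sub_pos.2 hlt)] with r hr _
        rw [height_add_smul, height_add_smul]
        linarith
      · have h1 := h s' (hs.of_height_le hc heq.ge)
        filter_upwards [self_mem_nhdsWithin] with r hr _
        rw [height_add_smul, height_add_smul, heq]
        have := mul_le_mul_of_nonneg_left h1 (Set.mem_Ioi.1 hr).le
        linarith
    · exact Eventually.of_forall fun r h1 => absurd h1 hc
  filter_upwards [eventually_all.2 key] with r hr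
  exact ⟨hs.1, dominates_of_forall_label hn hκ hs.2.1 hr⟩

end MaxPlus

/-! ### Contour plots in terms of adherent pairs. -/

section Regions

variable {n : ℕ} {κ : Fin n → ℝ}

open Classical in
/-- The constant terms of the phases at time `t`. -/
noncomputable def constTerm (κ : Fin n → ℝ) (A : Matrix (Fin 2) (Fin n) ℝ) (t : ℝ)
    (s : Finset (Fin n)) : ℝ :=
  if h : s.card = 2 then
    Real.log (minor A ⟨s, h⟩ * vandermonde κ (⟨s, h⟩ : KSubset 2 n)) + ∑ i ∈ s, κ i ^ 3 * t
  else 0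

variable {A : Matrix (Fin 2) (Fin n) ℝ} {t : ℝ}

theorem phase_eq_height (I : KSubset 2 n) (p : ℝ × ℝ) :
    phase κ A t I p = height κ (constTerm κ A t) I.1 p := by
  unfold phase height constTerm slope₂
  rw [dif_pos I.2, add_assoc, ← Finset.sum_add_distrib]
  congr 1
  exact Finset.sum_congr rfl fun i _ => by ring

theorem phase_le_tropicalTau (I : KSubset 2 n) (p : ℝ × ℝ) :
    phase κ A t I p ≤ tropicalTau κ A t p :=
  le_ciSup (f := fun I : KSubset 2 n => phase κ A t I p) (Set.finite_range _).bddAbove I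

theorem tropicalTau_eq_iff (I : KSubset 2 n) (p : ℝ × ℝ) :
    tropicalTau κ A t p = phase κ A t I p ↔ Dominates κ (constTerm κ A t) p I.1 := by
  constructor
  · intro h
    refine ⟨I.2, fun s hs => ?_⟩
    have := phase_le_tropicalTau (κ := κ) (A := A) (t := t) ⟨s, hs⟩ p
    rwa [h, phase_eq_height, phase_eq_height] at this
  · intro h
    have : Nonempty (KSubset 2 n) := ⟨I⟩
    refine le_antisymm (ciSup_le fun J => ?_) (phase_le_tropicalTau I p)
    rw [phase_eq_height, phase_eq_height]
    exact h.2 J.1 J.2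

/-- The difference has one sign near p and vanishes at p; moving both ways along `δ` makes the
slopes equal. -/
theorem slope₂_eq_of_le_affine {c : Finset (Fin n) → ℝ} {s : Finset (Fin n)} {p : ℝ × ℝ}
    {g : (ℝ × ℝ) →ᵃ[ℝ] ℝ} (h : ∀ᶠ q in 𝓝 p, height κ c s q ≤ g q) (hp : height κ c s p = g p)
    (δ : ℝ × ℝ) : slope₂ κ s δ = g.linear δ := by
  have hg : ∀ r : ℝ, g (p + r • δ) = g p + r * g.linear δ := by
    intro r
    have := g.map_vadd p (r • δ)
    simp only [vadd_eq_add, map_smul, smul_eq_mul] at this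
    rw [add_comm p, this]
    ring
  have hev : ∀ᶠ r in 𝓝 (0 : ℝ), r * slope₂ κ s δ ≤ r * g.linear δ := by
    have ht : Tendsto (fun r : ℝ => p + r • δ) (𝓝 0) (𝓝 p) := by
      have : Continuous (fun r : ℝ => p + r • δ) := by fun_prop
      simpa using this.tendsto 0
    filter_upwards [ht.eventually h] with r hr
    rw [height_add_smul, hg, hp] at hr
    linarith
  obtain ⟨r1, hr1, h1⟩ := ((hev.filter_mono nhdsWithin_le_nhds).and
    (self_mem_nhdsWithin : Set.Ioi (0 : ℝ) ∈ 𝓝[>] (0 : ℝ))).exists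
  obtain ⟨r2, hr2, h2⟩ := ((hev.filter_mono nhdsWithin_le_nhds).and
    (self_mem_nhdsWithin : Set.Iio (0 : ℝ) ∈ 𝓝[<] (0 : ℝ))).exists
  have h1' : (0 : ℝ) < r1 := h1
  have h2' : r2 < (0 : ℝ) := h2
  exact le_antisymm (le_of_mul_le_mul_left hr1 h1') ((mul_le_mul_left_of_neg h2').1 hr2)

theorem continuous_height (c : Finset (Fin n) → ℝ) (s : Finset (Fin n)) :
    Continuous (height κ c s) := by
  unfold height slope₂
  fun_prop

theorem exists_affine_eq_height (c : Finset (Fin n) → ℝ) (s : Finset (Fin n)) :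
    ∃ g : (ℝ × ℝ) →ᵃ[ℝ] ℝ, ∀ q, height κ c s q = g q := by
  refine ⟨((∑ i ∈ s, κ i) • LinearMap.fst ℝ ℝ ℝ +
    (∑ i ∈ s, κ i ^ 2) • LinearMap.snd ℝ ℝ ℝ).toAffineMap + AffineMap.const ℝ _ (c s), fun q => ?_⟩
  simp [height, slope₂, Finset.sum_add_distrib, Finset.sum_mul]
  ring

/-- Where the maximum is affine, all phases that attain it have the same gradient. Its first
component is the sum of the parameters, which determines the pair. Conversely, a strict maximum
stays strict nearby. -/
theorem mem_solitonRegion_iff (hκ : DistinctSums κ) (I : KSubset 2 n) (p : ℝ × ℝ) :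
    p ∈ solitonRegion κ A t I ↔ StrictlyDominates κ (constTerm κ A t) p I.1 := by
  constructor
  · rintro ⟨h1, h2⟩
    have h3 := (tropicalTau_eq_iff I p).1 h2
    simp only [contourPlot, Set.mem_ofPred_eq, not_not] at h1
    obtain ⟨g, hg⟩ := h1
    refine ⟨I.2, fun s hs hne => lt_of_le_of_ne (h3.2 s hs) fun heq => hne ?_⟩
    have hle : ∀ J : KSubset 2 n, ∀ᶠ q in 𝓝 p, height κ (constTerm κ A t) J.1 q ≤ g q := by
      intro J
      filter_upwards [hg] with q hq
      rw [← hq, ← phase_eq_height]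
      exact phase_le_tropicalTau J q
    have hI : height κ (constTerm κ A t) I.1 p = g p := by
      rw [← hg.self_of_nhds, h2, phase_eq_height]
    have e1 := slope₂_eq_of_le_affine (hle I) hI (1, 0)
    have e2 := slope₂_eq_of_le_affine (hle ⟨s, hs⟩) (heq.trans hI) (1, 0)
    refine hκ _ _ hs I.2 ?_
    have := e2.trans e1.symm
    simpa [slope₂] using this
  · intro h
    have hdom : Dominates κ (constTerm κ A t) p I.1 :=
      ⟨h.1, fun s hs => by
        by_cases hne : s = I.1
        · rw [hne]
        · exact (h.2 s hs hne).le⟩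
    refine ⟨?_, (tropicalTau_eq_iff I p).2 hdom⟩
    simp only [contourPlot, Set.mem_ofPred_eq, not_not]
    obtain ⟨g, hg⟩ := exists_affine_eq_height (κ := κ) (constTerm κ A t) I.1
    refine ⟨g, ?_⟩
    have key : ∀ s : Finset (Fin n), ∀ᶠ q in 𝓝 p, s.card = 2 →
        height κ (constTerm κ A t) s q ≤ height κ (constTerm κ A t) I.1 q := by
      intro s
      by_cases hs : s.card = 2 ∧ s ≠ I.1
      · filter_upwards [(continuous_height _ s).continuousAt.eventually_lt
          (continuous_height _ I.1).continuousAt (h.2 s hs.1 hs.2)] with q hq _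
        exact hq.le
      · refine Eventually.of_forall fun q hc => ?_
        have : s = I.1 := by by_contra hne; exact hs ⟨hc, hne⟩
        rw [this]
    filter_upwards [eventually_all.2 key] with q hq
    rw [(tropicalTau_eq_iff I q).2 ⟨I.2, hq⟩, phase_eq_height, hg]

theorem StrictlyDominates.adherent {c : Finset (Fin n) → ℝ} {p : ℝ × ℝ} {s : Finset (Fin n)}
    (h : StrictlyDominates κ c p s) : Adherent κ c p s :=
  ⟨⟨p, h⟩, h.1, fun s' hs' => by
    by_cases hne : s' = s
    · rw [hne]
    · exact (h.2 s' hs' hne).le⟩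

/-- On the segment from a point where the phase is maximal to one where it is strictly maximal,
strictness holds as soon as the first point is left. If the region is empty, both sides are. -/
theorem closure_solitonRegion (hκ : DistinctSums κ) (I : KSubset 2 n) :
    closure (solitonRegion κ A t I) = {p | Adherent κ (constTerm κ A t) p I.1} := by
  apply Set.Subset.antisymm
  · intro p hp
    have hne : (solitonRegion κ A t I).Nonempty := closure_nonempty_iff.1 ⟨p, hp⟩
    obtain ⟨q, hq⟩ := hne
    rw [mem_solitonRegion_iff hκ] at hq
    refine ⟨⟨q, hq⟩, I.2, fun s hs => ?_⟩
    have hcl : IsClosed {p | height κ (constTerm κ A t) s p ≤ height κ (constTerm κ A t) I.1 p} :=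
      isClosed_le (continuous_height _ s) (continuous_height _ I.1)
    refine hcl.closure_subset_iff.2 (fun x hx => ?_) hp
    rw [mem_solitonRegion_iff hκ] at hx
    exact hx.adherent.2.2 s hs
  · rintro p ⟨⟨q, hq⟩, hp⟩
    have hev : ∀ᶠ r in 𝓝[>] (0 : ℝ), r < 1 :=
      nhdsWithin_le_nhds (Iio_mem_nhds one_pos)
    have ht : Tendsto (fun r : ℝ => p + r • (q - p)) (𝓝[>] 0) (𝓝 p) := by
      have : Continuous (fun r : ℝ => p + r • (q - p)) := by fun_prop
      simpa using (this.tendsto 0).mono_left nhdsWithin_le_nhds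
    refine mem_closure_of_tendsto ht ?_
    filter_upwards [hev, self_mem_nhdsWithin] with r hr1 hr0
    rw [mem_solitonRegion_iff hκ]
    refine ⟨hq.1, fun s hs hne => ?_⟩
    have h1 := hp.2 s hs
    have h2 := hq.2 s hs hne
    rw [height_eq_add_slope s p, height_eq_add_slope I.1 p] at h2
    rw [height_add_smul, height_add_smul]
    have hr0' : (0 : ℝ) < r := hr0
    nlinarith [mul_lt_mul_of_pos_left h2 hr0', mul_le_mul_of_nonneg_left h1 (sub_nonneg.2 hr1.le)]

/-- At most three regions are adherent to any point. -/
def AtMostThree (κ : Fin n → ℝ) (c : Finset (Fin n) → ℝ) : Prop :=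
  ∀ p s₁ s₂ s₃ s₄, Adherent κ c p s₁ → Adherent κ c p s₂ → Adherent κ c p s₃ → Adherent κ c p s₄ →
    s₁ ≠ s₂ → s₁ ≠ s₃ → s₂ ≠ s₃ → s₄ = s₁ ∨ s₄ = s₂ ∨ s₄ = s₃

/-- Two regions that are adherent to the same point have a label in common. -/
def SharesLabel (κ : Fin n → ℝ) (c : Finset (Fin n) → ℝ) : Prop :=
  ∀ p s s', Adherent κ c p s → Adherent κ c p s' → ∃ i, i ∈ s ∧ i ∈ s'

/-- The direction of the boundary between the regions of `s` and `s'`. -/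
def wallDir (κ : Fin n → ℝ) (s s' : Finset (Fin n)) : ℝ × ℝ :=
  (∑ i ∈ s, κ i ^ 2 - ∑ j ∈ s', κ j ^ 2, -(∑ i ∈ s, κ i - ∑ j ∈ s', κ j))

theorem slope₂_wallDir (s s' : Finset (Fin n)) :
    slope₂ κ s (wallDir κ s s') = slope₂ κ s' (wallDir κ s s') := by
  simp only [slope₂, wallDir, Finset.sum_add_distrib, ← Finset.sum_mul]
  ring

theorem slope₂_neg (s : Finset (Fin n)) (δ : ℝ × ℝ) : slope₂ κ s (-δ) = - slope₂ κ s δ := by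
  unfold slope₂
  rw [← Finset.sum_neg_distrib]
  exact Finset.sum_congr rfl fun i _ => by simp; ring

theorem wallDir_ne_zero (hκ : DistinctSums κ) {s s' : Finset (Fin n)} (hs : s.card = 2)
    (hs' : s'.card = 2) (hne : s ≠ s') : wallDir κ s s' ≠ 0 := by
  intro h
  have := congrArg Prod.snd h
  simp only [wallDir, Prod.snd_zero, neg_eq_zero] at this
  exact hne (hκ _ _ hs hs' (sub_eq_zero.1 this))

/-- Two regions adherent to a common point share a nontrivial wall. -/
theorem exists_second_adherent (hn : 2 ≤ n) (hκ : DistinctSums κ) {c : Finset (Fin n) → ℝ}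
    (h3 : AtMostThree κ c) {p : ℝ × ℝ} {s s' : Finset (Fin n)} (hs : Adherent κ c p s)
    (hs' : Adherent κ c p s') (hne : s ≠ s') :
    ∃ q, q ≠ p ∧ Adherent κ c q s ∧ Adherent κ c q s' := by
  have key : ∀ δ : ℝ × ℝ, δ ≠ 0 → slope₂ κ s δ = slope₂ κ s' δ →
      (∀ u, Adherent κ c p u → slope₂ κ u δ ≤ slope₂ κ s δ) →
      ∃ q, q ≠ p ∧ Adherent κ c q s ∧ Adherent κ c q s' := by
    intro δ hδ heq hle
    obtain ⟨r, ⟨h1, h2⟩, hr⟩ := (((eventually_adherent hn hκ hs hle).and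
      (eventually_adherent hn hκ hs' (heq ▸ hle))).and
      (self_mem_nhdsWithin : Set.Ioi (0 : ℝ) ∈ 𝓝[>] (0 : ℝ))).exists
    refine ⟨p + r • δ, fun h => ?_, h1, h2⟩
    rw [add_eq_left, smul_eq_zero] at h
    exact h.elim (ne_of_gt hr) hδ
  have hd := wallDir_ne_zero hκ hs.2.1 hs'.2.1 hne
  by_cases h : ∃ u, Adherent κ c p u ∧ u ≠ s ∧ u ≠ s'
  · obtain ⟨u, hu, hus, hus'⟩ := h
    have hall : ∀ v, Adherent κ c p v → v = s ∨ v = s' ∨ v = u := fun v hv =>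
      h3 p s s' u v hs hs' hu hv hne hus.symm hus'.symm
    -- At most one further region u is present, and in one of the two directions of the wall its
    -- phase does not rise above the common value.
    rcases le_total (slope₂ κ u (wallDir κ s s')) (slope₂ κ s (wallDir κ s s')) with hle | hle
    · refine key _ hd (slope₂_wallDir s s') fun v hv => ?_
      rcases hall v hv with rfl | rfl | rfl
      · exact le_rfl
      · exact (slope₂_wallDir _ _).ge
      · exact hle
    · refine key (-wallDir κ s s') (neg_ne_zero.2 hd) (by rw [slope₂_neg, slope₂_neg,
        slope₂_wallDir]) fun v hv => ?_
      rw [slope₂_neg, slope₂_neg, neg_le_neg_iff]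
      rcases hall v hv with rfl | rfl | rfl
      · exact le_rfl
      · exact (slope₂_wallDir _ _).le
      · exact hle
  · push Not at h
    refine key _ hd (slope₂_wallDir s s') fun v hv => ?_
    by_cases hvs : v = s
    · rw [hvs]
    · rw [h v hv hvs, slope₂_wallDir]

theorem solitonWall_eq (hκ : DistinctSums κ) (I J : KSubset 2 n) :
    solitonWall κ A t I J =
      {p | Adherent κ (constTerm κ A t) p I.1 ∧ Adherent κ (constTerm κ A t) p J.1} := by
  unfold solitonWall
  rw [closure_solitonRegion hκ, closure_solitonRegion hκ]
  rfl

theorem areAdjacent_iff (hn : 2 ≤ n) (hκ : DistinctSums κ) (h3 : AtMostThree κ (constTerm κ A t))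
    (I J : KSubset 2 n) : AreAdjacent κ A t I J ↔
      I.1 ≠ J.1 ∧ ∃ p, Adherent κ (constTerm κ A t) p I.1 ∧ Adherent κ (constTerm κ A t) p J.1 := by
  unfold AreAdjacent
  rw [solitonWall_eq hκ, Ne, Subtype.ext_iff]
  refine and_congr_right fun hne => ⟨fun ⟨p, hp, _⟩ => ⟨p, hp⟩, fun ⟨p, hp⟩ => ?_⟩
  obtain ⟨q, hq, h1, h2⟩ := exists_second_adherent hn hκ h3 hp.1 hp.2 hne
  exact ⟨q, ⟨h1, h2⟩, p, hp, hq⟩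

theorem setOf_closure_ncard_le_three_iff (hκ : DistinctSums κ) :
    (∀ p, {I : KSubset 2 n | p ∈ closure (solitonRegion κ A t I)}.ncard ≤ 3) ↔
      AtMostThree κ (constTerm κ A t) := by
  simp only [closure_solitonRegion hκ, Set.mem_ofPred_eq]
  constructor
  · intro h p s₁ s₂ s₃ s₄ h1 h2 h3 h4 h12 h13 h23
    by_contra hcon
    push Not at hcon
    have hsub : ({⟨s₁, h1.2.1⟩, ⟨s₂, h2.2.1⟩, ⟨s₃, h3.2.1⟩, ⟨s₄, h4.2.1⟩} : Finset (KSubset 2 n)).card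
        ≤ {I : KSubset 2 n | Adherent κ (constTerm κ A t) p I.1}.ncard := by
      rw [← Set.ncard_coe_finset]
      refine Set.ncard_le_ncard ?_ (Set.toFinite _)
      intro I hI
      simp only [Finset.coe_insert, Finset.coe_singleton, Set.mem_insert_iff,
        Set.mem_singleton_iff] at hI
      rcases hI with rfl | rfl | rfl | rfl <;> assumption
    have hcard : ({⟨s₁, h1.2.1⟩, ⟨s₂, h2.2.1⟩, ⟨s₃, h3.2.1⟩, ⟨s₄, h4.2.1⟩} :
        Finset (KSubset 2 n)).card = 4 := by
      rw [Finset.card_insert_of_notMem, Finset.card_insert_of_notMem, Finset.card_pair] <;>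
        simp [hcon.2.2.symm, hcon.1.symm, hcon.2.1.symm, h12, h13, h23]
    have := h p
    omega
  · intro h p
    by_contra hcon
    push Not at hcon
    obtain ⟨a, b, d, ha, hb, hd, hab, had, hbd⟩ :=
      (Set.two_lt_ncard_iff (Set.toFinite _)).1 (lt_trans (by norm_num) hcon)
    have hsub : {I : KSubset 2 n | Adherent κ (constTerm κ A t) p I.1} ⊆
        (({a, b, d} : Finset (KSubset 2 n)) : Set (KSubset 2 n)) := by
      intro I hI
      have := h p a.1 b.1 d.1 I.1 ha hb hd hI (by simpa [Subtype.ext_iff] using hab)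
        (by simpa [Subtype.ext_iff] using had) (by simpa [Subtype.ext_iff] using hbd)
      simpa [Subtype.ext_iff] using this
    have h1 := Set.ncard_le_ncard hsub
    rw [Set.ncard_coe_finset] at h1
    have h2 : ({a, b, d} : Finset (KSubset 2 n)).card ≤ 3 := Finset.card_le_three
    omega

/-- The hypotheses on the contour plot in terms of adherent regions. -/
theorem isGenericWithoutXCrossings_iff (hn : 2 ≤ n) (hκ : DistinctSums κ) :
    IsGenericWithoutXCrossings κ A t ↔
      AtMostThree κ (constTerm κ A t) ∧ SharesLabel κ (constTerm κ A t) := by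
  unfold IsGenericWithoutXCrossings
  rw [setOf_closure_ncard_le_three_iff hκ, and_comm]
  refine and_congr_right fun h3 => ?_
  constructor
  · intro h p s s' hs hs'
    by_cases hne : s = s'
    · subst hne
      obtain ⟨i, hi⟩ := Finset.card_pos.1 (by rw [hs.2.1]; norm_num)
      exact ⟨i, hi, hi⟩
    · have := h ⟨s, hs.2.1⟩ ⟨s', hs'.2.1⟩ ((areAdjacent_iff hn hκ h3 _ _).2 ⟨hne, p, hs, hs'⟩)
      simp only at this
      have hpos : 0 < (s ∩ s').card := by omega
      obtain ⟨i, hi⟩ := Finset.card_pos.1 hpos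
      exact ⟨i, Finset.mem_inter.1 hi⟩
  · intro h I J hIJ
    obtain ⟨hne, p, hI, hJ⟩ := (areAdjacent_iff hn hκ h3 _ _).1 hIJ
    obtain ⟨i, hi, hj⟩ := h p _ _ hI hJ
    have h1 : 0 < (I.1 ∩ J.1).card := Finset.card_pos.2 ⟨i, Finset.mem_inter.2 ⟨hi, hj⟩⟩
    have h2 : (I.1 ∩ J.1).card < 2 := by
      by_contra hge
      push Not at hge
      have e1 : I.1 ∩ J.1 = I.1 :=
        Finset.eq_of_subset_of_card_le Finset.inter_subset_left (by rw [I.2]; exact hge)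
      have e2 : I.1 ∩ J.1 = J.1 :=
        Finset.eq_of_subset_of_card_le Finset.inter_subset_right (by rw [J.2]; exact hge)
      exact hne (e1.symm.trans e2)
    omega

end Regions

/-! ### Walls and the slopes along them. -/

section Walls

variable {n : ℕ} {κ : Fin n → ℝ} {c : Finset (Fin n) → ℝ}

/-- The slope of the phase contribution of the index `x` in the direction `δ`. -/
def vertexSlope (κ : Fin n → ℝ) (x : Fin n) (δ : ℝ × ℝ) : ℝ := κ x * δ.1 + κ x ^ 2 * δ.2

theorem slope₂_eq_vertexSlope {a b : Fin n} (h : a ≠ b) (δ : ℝ × ℝ) :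
    slope₂ κ {a, b} δ = vertexSlope κ a δ + vertexSlope κ b δ := slope₂_pair h δ

theorem wallDir_pair {m a b : Fin n} (ha : m ≠ a) (hb : m ≠ b) :
    wallDir κ {m, a} {m, b} = (κ a ^ 2 - κ b ^ 2, κ b - κ a) := by
  unfold wallDir
  rw [Finset.sum_pair ha, Finset.sum_pair hb, Finset.sum_pair ha, Finset.sum_pair hb]
  ext <;> simp

/-- The contribution is a quadratic polynomial in `κ x`. It takes equal values at a and b because
both phases agree along the wall, so the difference factors; the leading coefficient is the
y-component of the direction. -/
theorem vertexSlope_wallDir {m a b : Fin n} (ha : m ≠ a) (hb : m ≠ b) (x : Fin n) :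
    vertexSlope κ x (wallDir κ {m, a} {m, b}) =
      vertexSlope κ a (wallDir κ {m, a} {m, b}) + (κ b - κ a) * (κ x - κ a) * (κ x - κ b) := by
  rw [wallDir_pair ha hb]
  unfold vertexSlope
  simp only
  ring

/-- If `κ a < κ b`, the product is negative between the roots, and if `κ b < κ a`, outside them; in
both cases this is the cyclic arc from a to b. -/
theorem prod_neg_iff_sbtw (hm : StrictMono κ) {a b x : Fin n} :
    (κ b - κ a) * (κ x - κ a) * (κ x - κ b) < 0 ↔ sbtw a x b := by
  have key : ∀ i j : Fin n, (i < j ∧ 0 < κ j - κ i) ∨ (i = j ∧ κ j - κ i = 0) ∨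
      (j < i ∧ κ j - κ i < 0) := by
    intro i j
    rcases lt_trichotomy i j with h | h | h
    · exact Or.inl ⟨h, sub_pos.2 (hm h)⟩
    · exact Or.inr (Or.inl ⟨h, by rw [h, sub_self]⟩)
    · exact Or.inr (Or.inr ⟨h, sub_neg.2 (hm h)⟩)
  rw [Fin.sbtw_iff]
  rcases key a b with ⟨h1, h2⟩ | ⟨h1, h2⟩ | ⟨h1, h2⟩ <;>
  rcases key a x with ⟨h3, h4⟩ | ⟨h3, h4⟩ | ⟨h3, h4⟩ <;>
  rcases key b x with ⟨h5, h6⟩ | ⟨h5, h6⟩ | ⟨h5, h6⟩ <;>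
  first
  | exact iff_of_true (by first
      | exact mul_neg_of_pos_of_neg (mul_pos h2 h4) h6
      | exact mul_neg_of_pos_of_neg (mul_pos_of_neg_of_neg h2 h4) h6
      | exact mul_neg_of_neg_of_pos (mul_neg_of_pos_of_neg h2 h4) h6
      | exact mul_neg_of_neg_of_pos (mul_neg_of_neg_of_pos h2 h4) h6) (by omega)
  | exact iff_of_false (not_lt.2 (by first
      | rw [h2, zero_mul, zero_mul]
      | rw [h4, mul_zero, zero_mul]
      | rw [h6, mul_zero]
      | exact (mul_pos (mul_pos h2 h4) h6).le
      | exact (mul_pos (mul_pos_of_neg_of_neg h2 h4) h6).le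
      | exact (mul_pos_of_neg_of_neg (mul_neg_of_pos_of_neg h2 h4) h6).le
      | exact (mul_pos_of_neg_of_neg (mul_neg_of_neg_of_pos h2 h4) h6).le)) (by omega)

theorem vertexSlope_wallDir_lt (hm : StrictMono κ) {m a b : Fin n} (ha : m ≠ a) (hb : m ≠ b)
    (x : Fin n) : vertexSlope κ x (wallDir κ {m, a} {m, b}) <
      vertexSlope κ a (wallDir κ {m, a} {m, b}) ↔ sbtw a x b := by
  rw [vertexSlope_wallDir ha hb x, add_lt_iff_neg_left, prod_neg_iff_sbtw hm]

theorem lt_vertexSlope_wallDir (hm : StrictMono κ) {m a b : Fin n} (ha : m ≠ a) (hb : m ≠ b)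
    (x : Fin n) : vertexSlope κ a (wallDir κ {m, a} {m, b}) <
      vertexSlope κ x (wallDir κ {m, a} {m, b}) ↔ sbtw b x a := by
  rw [vertexSlope_wallDir ha hb x, lt_add_iff_pos_right, ← prod_neg_iff_sbtw hm,
    ← neg_pos]
  ring_nf

theorem vertexSlope_wallDir_right {m a b : Fin n} (ha : m ≠ a) (hb : m ≠ b) :
    vertexSlope κ b (wallDir κ {m, a} {m, b}) = vertexSlope κ a (wallDir κ {m, a} {m, b}) := by
  rw [vertexSlope_wallDir ha hb b]; ring

theorem Finset.ne_of_card_pair {α : Type*} [DecidableEq α] {a b : α}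
    (h : ({a, b} : Finset α).card = 2) : a ≠ b := by
  rintro rfl
  simp at h

theorem Adherent.ne {p : ℝ × ℝ} {a b : Fin n} (h : Adherent κ c p {a, b}) : a ≠ b :=
  Finset.ne_of_card_pair h.2.1

/-- The hypotheses on a generic plot without `X`-crossings. -/
structure GenericPlot (κ : Fin n → ℝ) (c : Finset (Fin n) → ℝ) : Prop where
  three_le : 3 ≤ n
  mono : StrictMono κ
  sums : DistinctSums κ
  three : AtMostThree κ c
  shares : SharesLabel κ c

/-- Two regions are adjacent along a wall; the wall is a line segment in its direction. -/
theorem exists_eq_add_smul_wallDir (hm : StrictMono κ) {p q : ℝ × ℝ} {m a b : Fin n} (hab : a ≠ b)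
    (h1 : Adherent κ c p {m, a}) (h2 : Adherent κ c p {m, b}) (h3 : Adherent κ c q {m, a})
    (h4 : Adherent κ c q {m, b}) : ∃ r : ℝ, q = p + r • wallDir κ {m, a} {m, b} := by
  have e1 := h1.height_eq h2
  have e2 := h3.height_eq h4
  rw [height_eq_add_slope {m, a} p q, height_eq_add_slope {m, b} p q, e1, add_right_inj,
    slope₂_eq_vertexSlope h1.ne, slope₂_eq_vertexSlope h2.ne, add_right_inj] at e2
  have hne : κ b - κ a ≠ 0 := sub_ne_zero.2 fun h => hab (hm.injective h).symm
  have e3 : (q - p).1 = - (κ a + κ b) * (q - p).2 := by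
    unfold vertexSlope at e2
    have : (κ b - κ a) * ((q - p).1 + (κ a + κ b) * (q - p).2) = 0 := by linear_combination -e2
    rcases mul_eq_zero.1 this with h | h
    · exact absurd h hne
    · linear_combination h
  refine ⟨(q - p).2 / (κ b - κ a), ?_⟩
  rw [wallDir_pair h1.ne h2.ne]
  simp only [Prod.fst_sub, Prod.snd_sub] at e3
  ext
  · simp only [Prod.fst_add, Prod.smul_fst, Prod.snd_sub, smul_eq_mul]
    field_simp
    linear_combination (κ b - κ a) * e3
  · simp only [Prod.snd_add, Prod.smul_snd, Prod.snd_sub, smul_eq_mul]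
    field_simp
    ring

theorem isClosed_adherent (s : Finset (Fin n)) : IsClosed {p | Adherent κ c p s} := by
  by_cases hs : s ∈ regionLabels κ c
  · have : {p | Adherent κ c p s} = ⋂ s' : Finset (Fin n), ⋂ _ : s'.card = 2,
        {p | height κ c s' p ≤ height κ c s p} := by
      ext p
      simp only [Adherent, Dominates, hs, card_of_mem_regionLabels hs, true_and, Set.mem_iInter,
        Set.mem_ofPred_eq]
    rw [this]
    exact isClosed_iInter fun s' => isClosed_iInter fun _ =>
      isClosed_le (continuous_height c s') (continuous_height c s)
  · have : {p | Adherent κ c p s} = ∅ := by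
      ext p
      simp [Adherent, hs]
    rw [this]
    exact isClosed_empty

/-- Moving from `p` against the direction `δ` as long as `s` and `s'` remain adherent, one arrives at
a point where the phase of another region takes over. -/
theorem exists_adherent_slope_lt (hn : 2 ≤ n) (hκ : DistinctSums κ) {p δ : ℝ × ℝ}
    {s s' : Finset (Fin n)} (hs : Adherent κ c p s) (hs' : Adherent κ c p s')
    (hδ : slope₂ κ s δ = slope₂ κ s' δ) {L : Finset (Fin n)} (hL : L.card = 2)
    (hlt : slope₂ κ L δ < slope₂ κ s δ) :
    ∃ q K, Adherent κ c q s ∧ Adherent κ c q s' ∧ Adherent κ c q K ∧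
      slope₂ κ K δ < slope₂ κ s δ := by
  set R : Set ℝ := {r | Adherent κ c (p + r • δ) s ∧ Adherent κ c (p + r • δ) s'} with hR
  have hcont : Continuous fun r : ℝ => p + r • δ := by fun_prop
  have hclosed : IsClosed R :=
    ((isClosed_adherent s).preimage hcont).inter ((isClosed_adherent s').preimage hcont)
  have hne : R.Nonempty := ⟨0, by simpa [hR] using ⟨hs, hs'⟩⟩
  -- Against `δ` the phase of `L` gains on that of `s` and finally overtakes it, so the wall cannot
  -- go on forever.
  have hbdd : BddBelow R := by
    refine ⟨(height κ c L p - height κ c s p) / (slope₂ κ s δ - slope₂ κ L δ), fun r hr => ?_⟩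
    have h1 := hr.1.2.2 L hL
    rw [height_add_smul, height_add_smul] at h1
    rw [div_le_iff₀ (sub_pos.2 hlt)]
    linarith
  have hmem := hclosed.csInf_mem hne hbdd
  set r₀ := sInf R
  obtain ⟨h1, h2⟩ := hmem
  -- If no adherent phase gained on `s` at this end point, both regions would remain adherent a
  -- little beyond it.
  by_contra hcon
  push Not at hcon
  have hall : ∀ K, Adherent κ c (p + r₀ • δ) K → slope₂ κ K (-δ) ≤ slope₂ κ s (-δ) := by
    intro K hK
    rw [slope₂_neg, slope₂_neg, neg_le_neg_iff]
    exact hcon _ K h1 h2 hK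
  obtain ⟨r, ⟨h5, h6⟩, hr⟩ := (((eventually_adherent hn hκ h1 hall).and
    (eventually_adherent hn hκ h2 (fun K hK => by
      rw [slope₂_neg s', ← hδ, ← slope₂_neg]; exact hall K hK))).and
    (self_mem_nhdsWithin : Set.Ioi (0 : ℝ) ∈ 𝓝[>] (0 : ℝ))).exists
  have hr' : (0 : ℝ) < r := hr
  have e : p + r₀ • δ + r • -δ = p + (r₀ - r) • δ := by
    rw [sub_smul, smul_neg]; abel
  rw [e] at h5 h6
  have := csInf_le hbdd (show r₀ - r ∈ R from ⟨h5, h6⟩)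
  linarith

/-- The regions `{m, a}` and `{m, b}` bound a line-soliton of type `[a, b]`. -/
def IsWall (κ : Fin n → ℝ) (c : Finset (Fin n) → ℝ) (m a b : Fin n) : Prop :=
  a ≠ b ∧ ∃ p, Adherent κ c p {m, a} ∧ Adherent κ c p {m, b}

end Walls

/-! ### Starting points of walls, and noncrossing walls around a corner. -/

section GenericWalls

variable {n : ℕ} {κ : Fin n → ℝ} {c : Finset (Fin n) → ℝ}

/-- The wall between `{m, a}` and `{m, b}`, with `{m, a}` on the left, starts at `p`: the third
region at `p` is `{m, x}` with `x` between `a` and `b`, or `{a, b}`, where `m` is between `b` and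
`a`. -/
def WallStarts (κ : Fin n → ℝ) (c : Finset (Fin n) → ℝ) (m a b : Fin n) (p : ℝ × ℝ) : Prop :=
  Adherent κ c p {m, a} ∧ Adherent κ c p {m, b} ∧
    ((∃ x, Adherent κ c p {m, x} ∧ sbtw a x b) ∨ (Adherent κ c p {a, b} ∧ sbtw b m a))

theorem Finset.eq_pair_of_mem {α : Type*} [DecidableEq α] {s : Finset α} (hs : s.card = 2) {a : α}
    (ha : a ∈ s) : ∃ b, s = {a, b} := by
  obtain ⟨x, y, -, rfl⟩ := Finset.card_eq_two.1 hs
  simp only [Finset.mem_insert, Finset.mem_singleton] at ha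
  rcases ha with rfl | rfl
  · exact ⟨y, rfl⟩
  · exact ⟨x, Finset.pair_comm _ _⟩

/-- A wall starts where some adherent phase takes over behind it. Such a phase shares a label with
both sides, so it contains m or is {a,b}; the sign of the product gives the cyclic position. -/
theorem GenericPlot.wallStarts_iff (h : GenericPlot κ c) {m a b : Fin n} {p : ℝ × ℝ}
    (ha : Adherent κ c p {m, a}) (hb : Adherent κ c p {m, b}) : WallStarts κ c m a b p ↔
    ∃ K, Adherent κ c p K ∧ slope₂ κ K (wallDir κ {m, a} {m, b}) <
      slope₂ κ {m, a} (wallDir κ {m, a} {m, b}) := by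
  constructor
  · rintro ⟨-, -, ⟨x, hx, hs⟩ | ⟨hab, hs⟩⟩
    · refine ⟨_, hx, ?_⟩
      rw [slope₂_eq_vertexSlope hx.ne, slope₂_eq_vertexSlope ha.ne, add_lt_add_iff_left]
      exact (vertexSlope_wallDir_lt h.mono ha.ne hb.ne x).2 hs
    · refine ⟨_, hab, ?_⟩
      rw [slope₂_eq_vertexSlope hab.ne, slope₂_eq_vertexSlope ha.ne,
        vertexSlope_wallDir_right ha.ne hb.ne, add_lt_add_iff_right]
      exact (lt_vertexSlope_wallDir h.mono ha.ne hb.ne m).2 hs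
  · rintro ⟨K, hK, hlt⟩
    refine ⟨ha, hb, ?_⟩
    by_cases hmK : m ∈ K
    · obtain ⟨x, rfl⟩ := Finset.eq_pair_of_mem hK.2.1 hmK
      rw [slope₂_eq_vertexSlope hK.ne, slope₂_eq_vertexSlope ha.ne, add_lt_add_iff_left,
        vertexSlope_wallDir_lt h.mono ha.ne hb.ne x] at hlt
      exact Or.inl ⟨x, hK, hlt⟩
    · obtain ⟨i, hi, hi'⟩ := h.shares p _ _ ha hK
      obtain ⟨j, hj, hj'⟩ := h.shares p _ _ hb hK
      simp only [Finset.mem_insert, Finset.mem_singleton] at hi hj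
      obtain rfl : i = a := hi.resolve_left fun e => hmK (e ▸ hi')
      obtain rfl : j = b := hj.resolve_left fun e => hmK (e ▸ hj')
      obtain ⟨y, rfl⟩ := Finset.eq_pair_of_mem hK.2.1 hi'
      simp only [Finset.mem_insert, Finset.mem_singleton] at hj'
      rcases hj' with rfl | rfl
      · rw [← slope₂_wallDir] at hlt
        exfalso
        rw [slope₂_eq_vertexSlope hK.ne, slope₂_eq_vertexSlope ha.ne] at hlt
        have e0 : wallDir κ {m, j} {m, j} = 0 := by simp [wallDir]
        rw [e0] at hlt
        simp [vertexSlope] at hlt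
      · rw [slope₂_eq_vertexSlope hK.ne, slope₂_eq_vertexSlope ha.ne,
          vertexSlope_wallDir_right ha.ne hb.ne, add_lt_add_iff_right,
          lt_vertexSlope_wallDir h.mono ha.ne hb.ne] at hlt
        exact Or.inr ⟨hK, hlt⟩

/-- The three kinds of oriented walls: those that start at a white vertex, at a black vertex, or
come from infinity. -/
theorem GenericPlot.trichotomy (h : GenericPlot κ c) {m a b : Fin n} (hw : IsWall κ c m a b) :
    (∃ p x, Adherent κ c p {m, a} ∧ Adherent κ c p {m, b} ∧ Adherent κ c p {m, x} ∧ sbtw a x b) ∨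
    (∃ p, Adherent κ c p {m, a} ∧ Adherent κ c p {m, b} ∧ Adherent κ c p {a, b} ∧ sbtw b m a) ∨
    (sbtw a m b ∧ ∀ x, sbtw a x b → x = m) := by
  obtain ⟨hab, p, ha, hb⟩ := hw
  -- Any pair of smaller slope makes the wall end. If there is none, comparison with the pairs {m,x}
  -- and {a,b} leaves m as the only index between a and b.
  by_cases hL : ∃ L : Finset (Fin n), L.card = 2 ∧ slope₂ κ L (wallDir κ {m, a} {m, b}) <
      slope₂ κ {m, a} (wallDir κ {m, a} {m, b})
  · obtain ⟨L, hL, hlt⟩ := hL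
    obtain ⟨q, K, h1, h2, h3, h4⟩ := exists_adherent_slope_lt (le_of_lt h.three_le) h.sums ha hb
      (slope₂_wallDir _ _) hL hlt
    obtain ⟨-, -, ⟨x, hx, hs⟩ | ⟨hK, hs⟩⟩ := (h.wallStarts_iff h1 h2).2 ⟨K, h3, h4⟩
    · exact Or.inl ⟨q, x, h1, h2, hx, hs⟩
    · exact Or.inr (Or.inl ⟨q, h1, h2, hK, hs⟩)
  · push Not at hL
    have h1 : ∀ x, sbtw a x b → x = m := by
      intro x hx
      by_contra hne
      have := hL {m, x} (Finset.card_pair (Ne.symm hne))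
      rw [slope₂_eq_vertexSlope (Ne.symm hne), slope₂_eq_vertexSlope ha.ne,
        add_le_add_iff_left] at this
      exact absurd ((vertexSlope_wallDir_lt h.mono ha.ne hb.ne x).2 hx) (not_lt.2 this)
    have h2 : ¬ sbtw b m a := by
      intro hs
      have := hL {a, b} (Finset.card_pair hab)
      rw [slope₂_eq_vertexSlope hab, slope₂_eq_vertexSlope ha.ne,
        vertexSlope_wallDir_right ha.ne hb.ne, add_le_add_iff_right] at this
      exact absurd ((lt_vertexSlope_wallDir h.mono ha.ne hb.ne m).2 hs) (not_lt.2 this)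
    refine Or.inr (Or.inr ⟨?_, h1⟩)
    have n1 := ha.ne
    have n2 := hb.ne
    simp only [Fin.sbtw_iff] at h2 ⊢
    omega

/-- Both points lie on one line in the direction of the wall. The phase that takes over behind each
of them must not exceed the wall at the other, which bounds the displacement by 0 from both sides.
-/
theorem GenericPlot.wallStarts_unique (h : GenericPlot κ c) {m a b : Fin n} (hab : a ≠ b)
    {p q : ℝ × ℝ} (hp : WallStarts κ c m a b p) (hq : WallStarts κ c m a b q) : p = q := by
  obtain ⟨K, hK, hlt⟩ := (h.wallStarts_iff hp.1 hp.2.1).1 hp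
  obtain ⟨L, hL, hlt'⟩ := (h.wallStarts_iff hq.1 hq.2.1).1 hq
  obtain ⟨r, rfl⟩ := exists_eq_add_smul_wallDir h.mono hab hp.1 hp.2.1 hq.1 hq.2.1
  have e1 := hq.1.2.2 K hK.2.1
  have e2 := hp.1.2.2 L hL.2.1
  have e3 := hp.1.height_eq hK
  have e4 := hq.1.height_eq hL
  rw [height_add_smul, height_add_smul] at e1 e4
  have r1 : 0 ≤ r := by
    by_contra hr
    push Not at hr
    nlinarith
  have r2 : r ≤ 0 := by
    by_contra hr
    push Not at hr
    nlinarith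
  have : r = 0 := le_antisymm r2 r1
  simp [this]

theorem IsWall.symm {m a b : Fin n} (hw : IsWall κ c m a b) : IsWall κ c m b a :=
  ⟨hw.1.symm, hw.2.imp fun _ hp => hp.symm⟩

/-- The edges of the polygon of the neighbours of `m`. -/
def wallPairs (κ : Fin n → ℝ) (c : Finset (Fin n) → ℝ) (m : Fin n) : Set (Finset (Fin n)) :=
  {e | ∃ a b, e = {a, b} ∧ IsWall κ c m a b}

theorem mem_wallPairs {m a b : Fin n} : {a, b} ∈ wallPairs κ c m ↔ IsWall κ c m a b := by
  refine ⟨?_, fun hw => ⟨a, b, rfl, hw⟩⟩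
  rintro ⟨x, y, e, hw⟩
  rcases Finset.pair_eq_iff.1 e with ⟨rfl, rfl⟩ | ⟨rfl, rfl⟩
  · exact hw
  · exact hw.symm

/-- The diagonals of the convex quadrangle formed by four points of the parabola meet. Each weight
is the Vandermonde determinant of the other three parameters. -/
theorem exists_crossing_weights (hm : StrictMono κ) {x y z w : Fin n} (h1 : x < y) (h2 : y < z)
    (h3 : z < w) : ∃ α β γ δ : ℝ, 0 < α ∧ 0 < β ∧ 0 < γ ∧ 0 < δ ∧ α + γ = β + δ ∧
      ∀ v, α * vertexSlope κ x v + γ * vertexSlope κ z v =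
        β * vertexSlope κ y v + δ * vertexSlope κ w v := by
  have e1 := sub_pos.2 (hm h1)
  have e2 := sub_pos.2 (hm h2)
  have e3 := sub_pos.2 (hm h3)
  have e4 := sub_pos.2 (hm (h1.trans h2))
  have e5 := sub_pos.2 (hm (h2.trans h3))
  have e6 := sub_pos.2 (hm ((h1.trans h2).trans h3))
  refine ⟨(κ z - κ y) * (κ w - κ y) * (κ w - κ z), (κ z - κ x) * (κ w - κ x) * (κ w - κ z),
    (κ y - κ x) * (κ w - κ x) * (κ w - κ y), (κ y - κ x) * (κ z - κ x) * (κ z - κ y),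
    by positivity, by positivity, by positivity, by positivity, by ring, fun v => ?_⟩
  unfold vertexSlope
  ring

/-- `X` and `Y` stand for the maxima at points p and q, `x, z` for the values at q of two phases
attaining `X`, and `y, w` for the values at p of two phases attaining `Y`. The affine relation
leaves no slack. -/
theorem le_of_crossing_weights {α β γ δ X Y x y z w : ℝ} (hα : 0 < α) (hβ : 0 < β) (hγ : 0 < γ)
    (hδ : 0 < δ) (hs : α + γ = β + δ) (hy : y ≤ X) (hw : w ≤ X) (hx : x ≤ Y) (hz : z ≤ Y)
    (sum : α * (x - X) + γ * (z - X) = β * (Y - y) + δ * (Y - w)) : X ≤ y ∧ X ≤ w := by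
  have i1 := mul_le_mul_of_nonneg_left hx hα.le
  have i2 := mul_le_mul_of_nonneg_left hz hγ.le
  have i3 := mul_le_mul_of_nonneg_left hy hβ.le
  have i4 := mul_le_mul_of_nonneg_left hw hδ.le
  have e1 : (α + γ) * Y = (β + δ) * Y := by rw [hs]
  have e2 : (α + γ) * X = (β + δ) * X := by rw [hs]
  constructor
  · exact le_of_mul_le_mul_left (a := β) (by linarith) hβ
  · exact le_of_mul_le_mul_left (a := δ) (by linarith) hδ

/-- The two pairs of regions around `m` which bound walls do not cross. -/
theorem GenericPlot.not_crosses_wallPairs (h : GenericPlot κ c) {m : Fin n}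
    {e f : Finset (Fin n)} (he : e ∈ wallPairs κ c m) (hf : f ∈ wallPairs κ c m) :
    ¬ Crosses e f := by
  have key : ∀ x y z w : Fin n, x < y → y < z → z < w → IsWall κ c m x z → IsWall κ c m y w →
      False := by
    rintro x y z w h1 h2 h3 ⟨-, p, px, pz⟩ ⟨-, q, qy, qw⟩
    obtain ⟨α, β, γ, δ, hα, hβ, hγ, hδ, hs, hv⟩ := exists_crossing_weights h.mono h1 h2 h3
    have hgt : ∀ x, {m, x} ∈ regionLabels κ c → height κ c {m, x} q =
        height κ c {m, x} p + vertexSlope κ m (q - p) + vertexSlope κ x (q - p) := by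
      intro x hx
      rw [height_eq_add_slope {m, x} p q,
        slope₂_eq_vertexSlope (Finset.ne_of_card_pair (card_of_mem_regionLabels hx))]
      ring
    have hdiff := hv (q - p)
    have ex := hgt x px.1
    have ey := hgt y qy.1
    have ez := hgt z pz.1
    have ew := hgt w qw.1
    have a1 := px.height_eq pz
    have a2 := px.2.2 _ qy.2.1
    have a3 := px.2.2 _ qw.2.1
    have b1 := qy.height_eq qw
    have b2 := qy.2.2 _ px.2.1
    have b3 := qy.2.2 _ pz.2.1
    have sum : α * (height κ c {m, x} q - height κ c {m, x} p) +
        γ * (height κ c {m, z} q - height κ c {m, z} p) =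
        β * (height κ c {m, y} q - height κ c {m, y} p) +
        δ * (height κ c {m, w} q - height κ c {m, w} p) := by
      rw [ex, ey, ez, ew]
      linear_combination hdiff + (vertexSlope κ m (q - p)) * hs
    rw [← a1, ← b1] at sum
    obtain ⟨c1, c2⟩ := le_of_crossing_weights hα hβ hγ hδ hs a2 a3 b2 b3 sum
    have inj : ∀ u v : Fin n, u < v → ({m, u} : Finset (Fin n)) ≠ {m, v} := by
      intro u v huv e
      rcases Finset.pair_eq_iff.1 e with ⟨-, e⟩ | ⟨e, e'⟩ <;> omega
    -- All four regions around m are adherent to p, one too many.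
    rcases h.three p _ _ _ _ px (px.of_height_le qy.1 c1) pz (px.of_height_le qw.1 c2) (inj _ _ h1)
      (inj _ _ (h1.trans h2)) (inj _ _ h2) with e | e | e
    · exact inj _ _ ((h1.trans h2).trans h3) e.symm
    · exact inj _ _ (h2.trans h3) e.symm
    · exact inj _ _ h3 e.symm
  rintro ⟨x, y, z, w, h1, h2, h3, ⟨rfl, rfl⟩ | ⟨rfl, rfl⟩⟩
  · exact key x y z w h1 h2 h3 (mem_wallPairs.1 he) (mem_wallPairs.1 hf)
  · exact key x y z w h1 h2 h3 (mem_wallPairs.1 hf) (mem_wallPairs.1 he)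

/-- The cyclic neighbours of a vertex. -/
theorem exists_cyclic_neighbours (hn : 3 ≤ n) (m : Fin n) :
    ∃ a b, sbtw a m b ∧ ∀ x, sbtw a x b → x = m := by
  have key : ∀ a b : Fin n, (a.1 = if m.1 = 0 then n - 1 else m.1 - 1) →
      (b.1 = if m.1 = n - 1 then 0 else m.1 + 1) →
      sbtw a m b ∧ ∀ x, sbtw a x b → x = m := by
    intro a b ha hb
    have := m.2
    refine ⟨?_, fun x => ?_⟩
    · simp only [Fin.sbtw_iff, Fin.lt_def]
      split_ifs at ha hb <;> omega
    · have := x.2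
      simp only [Fin.sbtw_iff, Fin.lt_def, Fin.ext_iff]
      split_ifs at ha hb <;> omega
  have := m.2
  exact ⟨⟨if m.1 = 0 then n - 1 else m.1 - 1, by split_ifs <;> omega⟩,
    ⟨if m.1 = n - 1 then 0 else m.1 + 1, by split_ifs <;> omega⟩, key _ _ rfl rfl⟩

/-- Each region `{m, b}` is separated from some region `{m, d}` by a wall. -/
theorem GenericPlot.exists_isWall (h : GenericPlot κ c) {m b : Fin n}
    (hb : {m, b} ∈ regionLabels κ c) : ∃ d, IsWall κ c m b d := by
  obtain ⟨a, d, had, huniq⟩ := exists_cyclic_neighbours h.three_le m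
  have hmb : m ≠ b := Finset.ne_of_card_pair (card_of_mem_regionLabels hb)
  obtain ⟨p, hp⟩ := hb
  have hpa := hp.adherent
  -- Leave the region against `δ`. The phase that takes over shares a label with {m,b}; it cannot be
  -- {b,y} with y ≠ m, since m has the least slope, so it contains m.
  have key : ∀ δ : ℝ × ℝ, (∀ x, vertexSlope κ m δ ≤ vertexSlope κ x δ) →
      ∀ x, x ≠ m → vertexSlope κ x δ < vertexSlope κ b δ → ∃ d, IsWall κ c m b d := by
    intro δ hmin x hxm hx
    obtain ⟨q, K, h1, -, h3, h4⟩ := exists_adherent_slope_lt (le_of_lt h.three_le) h.sums hpa hpa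
      rfl (L := {m, x}) (Finset.card_pair hxm.symm) (δ := δ) (by
        rw [slope₂_eq_vertexSlope hxm.symm, slope₂_eq_vertexSlope hmb]; linarith)
    obtain ⟨i, hi, hi'⟩ := h.shares q _ _ h1 h3
    obtain ⟨y, rfl⟩ := Finset.eq_pair_of_mem h3.2.1 hi'
    simp only [Finset.mem_insert, Finset.mem_singleton] at hi
    rw [slope₂_eq_vertexSlope h3.ne, slope₂_eq_vertexSlope h1.ne] at h4
    rcases hi with rfl | rfl
    · refine ⟨y, ?_, q, h1, h3⟩
      rintro rfl
      exact lt_irrefl _ h4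
    · have := hmin y
      linarith
  have ha : a ≠ m := by simp only [Fin.sbtw_iff] at had; omega
  have hd : d ≠ m := by simp only [Fin.sbtw_iff] at had; omega
  have hadne : a ≠ d := by simp only [Fin.sbtw_iff] at had; omega
  -- The direction belongs to the side {u,v} of the polygon: no index lies between u and v, so the
  -- slope is least at these two and larger elsewhere. One of them is m, the other a neighbour of m
  -- different from b; the second version treats the other orientation.
  have hself : ∀ u v : Fin n, u ≠ v → v ≠ m → v ≠ b → (∀ y, ¬ sbtw u y v) → u = m →
      ∃ d, IsWall κ c m b d := by
    rintro u v huv hv hvb hno rfl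
    have hdif : ∀ y, vertexSlope κ y (κ u ^ 2 - κ v ^ 2, κ v - κ u) =
        vertexSlope κ u (κ u ^ 2 - κ v ^ 2, κ v - κ u) +
          (κ v - κ u) * (κ y - κ u) * (κ y - κ v) := by
      intro y; unfold vertexSlope; ring
    refine key (κ u ^ 2 - κ v ^ 2, κ v - κ u) (fun y => ?_) v hv ?_
    · rw [hdif y]
      have := hno y
      rw [← prod_neg_iff_sbtw h.mono] at this
      linarith
    · rw [hdif b, hdif v]
      have := hno b
      rw [← prod_neg_iff_sbtw h.mono] at this
      have hne : (κ v - κ u) * (κ b - κ u) * (κ b - κ v) ≠ 0 :=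
        mul_ne_zero (mul_ne_zero (sub_ne_zero.2 fun e => huv (h.mono.injective e).symm)
          (sub_ne_zero.2 fun e => hmb (h.mono.injective e).symm))
          (sub_ne_zero.2 fun e => hvb (h.mono.injective e).symm)
      have := lt_of_le_of_ne (not_lt.1 this) hne.symm
      rw [sub_self, mul_zero]
      linarith
  have hself' : ∀ u v : Fin n, u ≠ v → u ≠ m → u ≠ b → (∀ y, ¬ sbtw u y v) → v = m →
      ∃ d, IsWall κ c m b d := by
    rintro u v huv hu hub hno rfl
    have hdif : ∀ y, vertexSlope κ y (κ u ^ 2 - κ v ^ 2, κ v - κ u) =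
        vertexSlope κ v (κ u ^ 2 - κ v ^ 2, κ v - κ u) +
          (κ v - κ u) * (κ y - κ u) * (κ y - κ v) := by
      intro y; unfold vertexSlope; ring
    refine key (κ u ^ 2 - κ v ^ 2, κ v - κ u) (fun y => ?_) u hu ?_
    · rw [hdif y]
      have := hno y
      rw [← prod_neg_iff_sbtw h.mono] at this
      linarith
    · rw [hdif b, hdif u]
      have := hno b
      rw [← prod_neg_iff_sbtw h.mono] at this
      have hne : (κ v - κ u) * (κ b - κ u) * (κ b - κ v) ≠ 0 :=
        mul_ne_zero (mul_ne_zero (sub_ne_zero.2 fun e => huv (h.mono.injective e).symm)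
          (sub_ne_zero.2 fun e => hub (h.mono.injective e).symm))
          (sub_ne_zero.2 fun e => hmb (h.mono.injective e).symm)
      have := lt_of_le_of_ne (not_lt.1 this) hne.symm
      rw [sub_self, mul_zero, zero_mul]
      linarith
  by_cases hdb : d = b
  · refine hself' a m ha ha (hdb ▸ hadne) (fun y hy => ?_) rfl
    have := huniq y (sbtw_of_sbtw_left had hy)
    simp only [Fin.sbtw_iff] at hy
    omega
  · refine hself m d hd.symm hd hdb (fun y hy => ?_) rfl
    have := huniq y (sbtw_of_sbtw_right had hy)
    simp only [Fin.sbtw_iff] at hy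
    omega

end GenericWalls

/-! ### The triangulations formed by the regions and by the walls. -/

section PlotTriangulation

variable {n : ℕ} {κ : Fin n → ℝ} {c : Finset (Fin n) → ℝ}

theorem pair_injective_right {m u v : Fin n} (e : ({m, u} : Finset (Fin n)) = {m, v}) : u = v := by
  rcases Finset.pair_eq_iff.1 e with ⟨-, e⟩ | ⟨e, e'⟩
  · exact e
  · exact e'.trans e

/-- The regions of the two neighbours of `m` are separated by an unbounded wall. -/
theorem GenericPlot.isWall_neighbours (h : GenericPlot κ c) {m a b : Fin n} (hs : sbtw a m b)
    (huniq : ∀ x, sbtw a x b → x = m) : IsWall κ c m a b := by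
  have ha : m ≠ a := by simp only [Fin.sbtw_iff] at hs; omega
  have hb : m ≠ b := by simp only [Fin.sbtw_iff] at hs; omega
  have hab : a ≠ b := by simp only [Fin.sbtw_iff] at hs; omega
  have hne : ({m, a} : Finset (Fin n)) ≠ {m, b} := fun e => hab (pair_injective_right e)
  have hκne : κ a - κ b ≠ 0 := sub_ne_zero.2 fun e => hab (h.mono.injective e)
  set δ := wallDir κ {m, a} {m, b} with hδ
  -- The index m alone has a smaller slope than a and b, so far out against `δ` the two phases beat
  -- all others.
  have hlow : ∀ s : Finset (Fin n), s.card = 2 → s ≠ {m, a} → s ≠ {m, b} →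
      slope₂ κ {m, a} δ < slope₂ κ s δ := by
    have hva := vertexSlope_wallDir_right (κ := κ) ha hb
    have hle : ∀ x, x ≠ m → x ≠ a → x ≠ b → vertexSlope κ a δ < vertexSlope κ x δ := by
      intro x h1 h2 h3
      rw [hδ, lt_vertexSlope_wallDir h.mono ha hb]
      have : ¬ sbtw a x b := fun hx => h1 (huniq x hx)
      simp only [Fin.sbtw_iff] at this ⊢
      omega
    have hle' : ∀ x, x ≠ m → vertexSlope κ a δ ≤ vertexSlope κ x δ := by
      intro x h1
      by_cases h2 : x = a
      · rw [h2]
      · by_cases h3 : x = b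
        · rw [h3, hδ, hva]
        · exact (hle x h1 h2 h3).le
    have hml : vertexSlope κ m δ < vertexSlope κ a δ :=
      (vertexSlope_wallDir_lt h.mono ha hb m).2 hs
    intro s hs2 n1 n2
    by_cases hm : m ∈ s
    · obtain ⟨x, rfl⟩ := Finset.eq_pair_of_mem hs2 hm
      have hxm := Finset.ne_of_card_pair hs2
      rw [slope₂_eq_vertexSlope hxm, slope₂_eq_vertexSlope ha, add_lt_add_iff_left]
      refine hle x hxm.symm ?_ ?_
      · rintro rfl; exact n1 rfl
      · rintro rfl; exact n2 rfl
    · obtain ⟨x, y, hxy, rfl⟩ := Finset.card_eq_two.1 hs2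
      simp only [Finset.mem_insert, Finset.mem_singleton, not_or] at hm
      rw [slope₂_eq_vertexSlope hxy, slope₂_eq_vertexSlope ha]
      have := hle' x (Ne.symm hm.1)
      have := hle' y (Ne.symm hm.2)
      linarith
  obtain ⟨p₀, hp₀⟩ : ∃ p₀, height κ c {m, a} p₀ = height κ c {m, b} p₀ := by
    refine ⟨((c {m, b} - c {m, a}) / (κ a - κ b), 0), ?_⟩
    unfold height
    rw [slope₂_eq_vertexSlope ha, slope₂_eq_vertexSlope hb]
    unfold vertexSlope
    field_simp
    ring
  have hev : ∀ s : Finset (Fin n), ∀ᶠ r : ℝ in atTop, s.card = 2 → s ≠ {m, a} → s ≠ {m, b} →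
      height κ c s (p₀ + r • -δ) < height κ c {m, a} (p₀ + r • -δ) := by
    intro s
    by_cases hc : s.card = 2 ∧ s ≠ {m, a} ∧ s ≠ {m, b}
    · have := hlow s hc.1 hc.2.1 hc.2.2
      have ht := tendsto_id.atTop_mul_const (sub_pos.2 this)
      filter_upwards [ht.eventually_gt_atTop (height κ c s p₀ - height κ c {m, a} p₀)]
        with r hr _ _ _
      rw [height_add_smul, height_add_smul, slope₂_neg, slope₂_neg]
      simp only [id] at hr
      linarith
    · exact Eventually.of_forall fun r h1 h2 h3 => absurd ⟨h1, h2, h3⟩ hc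
  obtain ⟨r, hr⟩ := (eventually_all.2 hev).exists
  have heq : height κ c {m, a} (p₀ + r • -δ) = height κ c {m, b} (p₀ + r • -δ) := by
    rw [height_add_smul, height_add_smul, hp₀, slope₂_neg, slope₂_neg, hδ, slope₂_wallDir]
  generalize p₀ + r • -δ = q at hr heq
  have hda : Dominates κ c q {m, a} := by
    refine ⟨Finset.card_pair ha, fun s hs => ?_⟩
    by_cases e1 : s = {m, a}
    · rw [e1]
    by_cases e2 : s = {m, b}
    · rw [e2, heq]
    exact (hr s hs e1 e2).le
  have hdb : Dominates κ c q {m, b} := ⟨Finset.card_pair hb, fun s hs => heq ▸ hda.2 s hs⟩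
  -- Only two phases tie at q, and a small horizontal step in either direction isolates one of them.
  have hreg : ∀ u v : Fin n, Dominates κ c q {m, u} → (∀ s, Dominates κ c q s → s = {m, u} ∨
      s = {m, v}) → κ u ≠ κ v → m ≠ u → m ≠ v → {m, u} ∈ regionLabels κ c := by
    intro u v hu hall hne hmu hmv
    obtain ⟨r, hr⟩ := (eventually_strictlyDominates (δ := (κ u - κ v, 0)) hu
      (fun s hs hsd => by
        rcases hall s hsd with rfl | rfl
        · exact absurd rfl hs
        · rw [slope₂_eq_vertexSlope hmu, slope₂_eq_vertexSlope hmv, add_lt_add_iff_left]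
          unfold vertexSlope
          have := mul_self_pos.2 (sub_ne_zero.2 hne)
          simp only [mul_zero, add_zero]
          linarith)).exists
    exact ⟨_, hr⟩
  have hall : ∀ s, Dominates κ c q s → s = {m, a} ∨ s = {m, b} := by
    intro s hs
    by_contra hcon
    push Not at hcon
    exact absurd (hs.2 _ hda.1) (not_le.2 (hr s hs.1 hcon.1 hcon.2))
  have hκab := sub_ne_zero.1 hκne
  exact ⟨hab, q, ⟨hreg a b hda hall hκab ha hb, hda⟩,
    ⟨hreg b a hdb (fun s hs => (hall s hs).symm) hκab.symm hb ha, hdb⟩⟩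

theorem mem_link_regionLabels {m b : Fin n} :
    b ∈ link (regionLabels κ c) m ↔ {m, b} ∈ regionLabels κ c :=
  ⟨fun h => h.1, fun h => ⟨h, Finset.ne_of_card_pair (card_of_mem_regionLabels h)⟩⟩

theorem IsWall.left_mem {m a b : Fin n} (hw : IsWall κ c m a b) : {m, a} ∈ regionLabels κ c := by
  obtain ⟨-, p, hp, -⟩ := hw
  exact hp.1

/-- If two of the chords are not nested, they cross. -/
theorem not_crosses_closed_arc {a b d e : Fin n} (hd : sbtw a d b)
    (hcr : ¬ Crosses {a, b} {d, e}) : e = a ∨ e = b ∨ sbtw a e b := by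
  rw [crosses_iff] at hcr
  simp only [Fin.sbtw_iff] at *
  omega

theorem arc_of_not_crosses {m a b d e z : Fin n} (hm : sbtw b m a)
    (hz : sbtw e z d)
    (h1 : ¬ Crosses {a, b} {e, z}) (h2 : ¬ Crosses {a, b} {d, z}) (hne : ¬ (d = a ∧ e = b)) :
    (z = a ∨ sbtw a z d) ∨ (z = b ∨ sbtw e z b) := by
  rw [crosses_iff] at h1 h2
  simp only [Fin.sbtw_iff] at *
  grind

theorem cycPos_lt_of_sbtw {m a b : Fin n} (h : sbtw m a b) : cycPos m a < cycPos m b :=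
  (sbtw_iff_cycPos.1 h).2

/-- The regions `{m, d}` with `d` between `a` and `b` are hidden behind a black vertex. -/
theorem GenericPlot.not_mem_of_black (h : GenericPlot κ c) {m a b : Fin n} {p : ℝ × ℝ}
    (ha : Adherent κ c p {m, a}) (hb : Adherent κ c p {m, b}) (hab : Adherent κ c p {a, b})
    (hs : sbtw b m a) {x : Fin n} (hx : sbtw a x b) : {m, x} ∉ regionLabels κ c := by
  intro hxm
  have hwab : IsWall κ c m a b := ⟨hab.ne, p, ha, hb⟩
  have hcr : ∀ u v, IsWall κ c m u v → ¬ Crosses {a, b} {u, v} := fun u v hw =>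
    h.not_crosses_wallPairs (mem_wallPairs.2 hwab) (mem_wallPairs.2 hw)
  obtain ⟨y, hy⟩ := h.exists_isWall hxm
  have hpstart : WallStarts κ c m a b p := ⟨ha, hb, Or.inr ⟨hab, hs⟩⟩
  -- The wall has a single starting point, and its three regions are {m,a}, {m,b}, {a,b}; hence it
  -- cannot also start at a white vertex.
  have hfinal : ∀ q z, Adherent κ c q {m, a} → Adherent κ c q {m, b} → Adherent κ c q {m, z} →
      sbtw a z b → False := by
    intro q z h1 h2 h3 h4
    have hq : WallStarts κ c m a b q := ⟨h1, h2, Or.inl ⟨z, h3, h4⟩⟩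
    obtain rfl := h.wallStarts_unique hab.ne hpstart hq
    have n1 := h1.ne
    have n2 := h2.ne
    have n3 := h3.ne
    have inj : ∀ u v : Fin n, u ≠ v → ({m, u} : Finset (Fin n)) ≠ {m, v} := fun u v huv e =>
      huv (pair_injective_right e)
    have hzab : a ≠ z ∧ b ≠ z := by simp only [Fin.sbtw_iff] at h4; omega
    have hmab : ∀ u, ({a, b} : Finset (Fin n)) ≠ {m, u} := by
      intro u e
      rcases Finset.pair_eq_iff.1 e with ⟨e, -⟩ | ⟨-, e⟩
      · exact n1 e.symm
      · exact n2 e.symm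
    rcases h.three p _ _ _ _ ha hb h3 hab (inj _ _ hab.ne) (inj _ _ hzab.1) (inj _ _ hzab.2) with
      e | e | e <;> exact hmab _ e
  -- Descent towards m. A wall with m between e and d starts, in the reversed orientation, at a
  -- white vertex with a region {m,z} where z is between e and d. Replacing d or e by z gives a wall
  -- that cuts off a shorter arc around m. The descent would have to reach (a,b), entering it at a
  -- white vertex, which `hfinal` excludes.
  have key : ∀ N : ℕ, ∀ d e : Fin n, IsWall κ c m d e → sbtw e m d →
      (d = a ∨ d = b ∨ sbtw a d b) → (e = a ∨ e = b ∨ sbtw a e b) → ¬ (d = a ∧ e = b) →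
      cycPos e d ≤ N → False := by
    intro N
    induction N with
    | zero =>
      intro d e hw hme hd he hne hN
      have := cycPos_lt_of_sbtw hme
      omega
    | succ N ih =>
      intro d e hw hme hd he hne hN
      rcases h.trichotomy hw.symm with ⟨q, z, h1, h2, h3, h4⟩ | ⟨q, h1, h2, h3, h4⟩ | ⟨h1, h2⟩
      · have wez : IsWall κ c m e z := ⟨by simp only [Fin.sbtw_iff] at h4; omega, q, h1, h3⟩
        have wdz : IsWall κ c m d z := ⟨by simp only [Fin.sbtw_iff] at h4; omega, q, h2, h3⟩
        rcases arc_of_not_crosses hs h4 (hcr _ _ wez) (hcr _ _ wdz) hne with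
          hz | hz
        · by_cases hfin : z = a ∧ e = b
          · obtain ⟨rfl, rfl⟩ := hfin
            refine hfinal q d h3 h1 h2 ?_
            simp only [Fin.sbtw_iff] at *
            clear ih hcr hfinal
            omega
          · have hmez : sbtw e m z := by
              have := h3.ne
              clear ih hcr hfinal hN
              simp only [Fin.sbtw_iff] at *
              grind
            refine ih z e wez.symm hmez ?_ he hfin ?_
            · rcases hz with hz | hz
              · exact Or.inl hz
              · refine Or.inr (Or.inr ?_)
                clear ih hcr hfinal hN
                simp only [Fin.sbtw_iff] at *
                grind
            · have := cycPos_lt_of_sbtw h4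
              omega
        · by_cases hfin : d = a ∧ z = b
          · obtain ⟨rfl, rfl⟩ := hfin
            refine hfinal q e h2 h3 h1 ?_
            simp only [Fin.sbtw_iff] at *
            clear ih hcr hfinal
            omega
          · have hmez : sbtw z m d := by
              have := h3.ne
              clear ih hcr hfinal hN
              simp only [Fin.sbtw_iff] at *
              grind
            refine ih d z wdz hmez hd ?_ hfin ?_
            · rcases hz with hz | hz
              · exact Or.inr (Or.inl hz)
              · refine Or.inr (Or.inr ?_)
                clear ih hcr hfinal hN
                simp only [Fin.sbtw_iff] at *
                grind
            · have : cycPos z d < cycPos e d := by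
                unfold cycPos
                simp only [Fin.sbtw_iff] at h4
                split_ifs <;> omega
              omega
      · simp only [Fin.sbtw_iff] at hme h4; omega
      · have e1 := h2 a
        have e2 := h2 b
        have n1 := ha.ne
        have n2 := hb.ne
        have n3 := hw.1
        clear ih hcr hfinal hN h2
        simp only [Fin.sbtw_iff] at *
        grind
  have hy2 := not_crosses_closed_arc hx (hcr _ _ hy)
  have n1 := hxm
  have hym : m ≠ y := Finset.ne_of_card_pair (card_of_mem_regionLabels hy.symm.left_mem)
  have hxm' : m ≠ x := Finset.ne_of_card_pair (card_of_mem_regionLabels hxm)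
  have hor : sbtw y m x ∨ sbtw x m y := by
    have := hy.1
    clear key hfinal hcr
    simp only [Fin.sbtw_iff] at *
    grind
  have hxa : x ≠ a ∧ x ≠ b := by
    simp only [Fin.sbtw_iff] at hx; omega
  rcases hor with hor | hor
  · exact key _ x y hy hor (Or.inr (Or.inr hx)) hy2 (fun hh => hxa.1 hh.1) le_rfl
  · exact key _ y x hy.symm hor hy2 (Or.inr (Or.inr hx)) (fun hh => hxa.2 hh.2) le_rfl

/-- The pairs of regions around `m` triangulate the polygon of the neighbours of `m`. -/
theorem GenericPlot.isTriangulation_wallPairs (h : GenericPlot κ c) (m : Fin n) :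
    IsTriangulation (link (regionLabels κ c) m) (wallPairs κ c m) := by
  obtain ⟨a₀, b₀, h0, huniq⟩ := exists_cyclic_neighbours h.three_le m
  have hw0 := h.isWall_neighbours h0 huniq
  refine isTriangulation_of_exists_apex (a₀ := b₀) (b₀ := a₀) ?_
    (fun e he f hf => h.not_crosses_wallPairs he hf) (mem_wallPairs.2 hw0.symm) ?_ ?_
  · rintro e ⟨a, b, rfl, hw⟩
    refine ⟨Finset.card_pair hw.1, fun i hi => ?_⟩
    rw [mem_link_regionLabels]
    simp only [Finset.mem_insert, Finset.mem_singleton] at hi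
    rcases hi with rfl | rfl
    · exact hw.left_mem
    · exact hw.symm.left_mem
  · intro x hx
    have := huniq x
    have := hx.2
    simp only [Fin.sbtw_iff] at *
    omega
  · intro a b hab x hx hxs hin
    rw [mem_wallPairs] at hab
    have hma : m ≠ a := Finset.ne_of_card_pair (card_of_mem_regionLabels hab.left_mem)
    have hmb : m ≠ b := Finset.ne_of_card_pair (card_of_mem_regionLabels hab.symm.left_mem)
    rcases h.trichotomy hab with ⟨p, z, h1, h2, h3, h4⟩ | ⟨p, h1, h2, h3, h4⟩ | ⟨h1, h2⟩
    · have wez : IsWall κ c m a z := ⟨by simp only [Fin.sbtw_iff] at h4; omega, p, h1, h3⟩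
      have wdz : IsWall κ c m z b := ⟨by simp only [Fin.sbtw_iff] at h4; omega, p, h3, h2⟩
      exact ⟨z, h4, mem_wallPairs.2 wez, mem_wallPairs.2 wdz⟩
    · exact absurd hx.1 (h.not_mem_of_black h1 h2 h3 h4 hxs)
    · have := h2 x hxs
      exact absurd this.symm hx.2

/-- Each edge is the side of a triangle that corresponds to a black vertex. -/
theorem GenericPlot.exists_black (h : GenericPlot κ c) {a b : Fin n}
    (hab : {a, b} ∈ regionLabels κ c) (hex : ∃ x, sbtw a x b) :
    ∃ d p, sbtw a d b ∧ Adherent κ c p {a, d} ∧ Adherent κ c p {a, b} ∧ Adherent κ c p {d, b} := by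
  have hne : a ≠ b := Finset.ne_of_card_pair (card_of_mem_regionLabels hab)
  have h1 : ∃ x, sbtw a x b ∧ ({a, x} : Finset (Fin n)) ∈ regionLabels κ c := by
    obtain ⟨u, v, huv, huniq⟩ := exists_cyclic_neighbours h.three_le a
    refine ⟨v, ?_, (h.isWall_neighbours huv huniq).symm.left_mem⟩
    obtain ⟨x, hx⟩ := hex
    have e1 := huniq x
    have e2 := huniq b
    simp only [Fin.sbtw_iff] at *
    grind
  -- No {a,x} with x between d and b is a region, so {d,b} crosses no wall around a and is one by
  -- maximality. By the choice of d it does not start at a white vertex, and the cyclic order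
  -- excludes infinity; its start is black.
  obtain ⟨d, hd, had, hmax⟩ := exists_maximal_sbtw a b (fun x => {a, x} ∈ regionLabels κ c) h1
  have htri := h.isTriangulation_wallPairs a
  have hdb : d ≠ b := by simp only [Fin.sbtw_iff] at hd; omega
  have hmem : {d, b} ∈ wallPairs κ c a := by
    refine htri.2.2 _ (Finset.card_pair hdb) ?_ fun f hf hcr => ?_
    · intro i hi
      rw [mem_link_regionLabels]
      simp only [Finset.mem_insert, Finset.mem_singleton] at hi
      rcases hi with rfl | rfl
      · exact had
      · exact hab
    · obtain ⟨x, y, rfl, hw⟩ := hf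
      rw [crosses_iff] at hcr
      rcases hcr with ⟨h1, -⟩ | ⟨h1, -⟩
      · exact hmax x h1 hw.left_mem
      · exact hmax y h1 hw.symm.left_mem
  rw [mem_wallPairs] at hmem
  rcases h.trichotomy hmem with ⟨p, z, h1, h2, h3, h4⟩ | ⟨p, h1, h2, h3, h4⟩ | ⟨h1, h2⟩
  · exact absurd h3.1 (hmax z h4)
  · exact ⟨d, p, hd, h1, h2, h3⟩
  · simp only [Fin.sbtw_iff] at hd h1
    omega

/-- Descent through the triangles of black vertices: a region {x,y} that crosses {m,b} either ends
at the apex a, which `not_mem_of_black` forbids, or crosses {m,a} or {a,b}, which cuts off a shorter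
arc. -/
theorem GenericPlot.not_crosses_regionLabels (h : GenericPlot κ c) {e f : Finset (Fin n)}
    (he : e ∈ regionLabels κ c) (hf : f ∈ regionLabels κ c) : ¬ Crosses e f := by
  have key : ∀ N : ℕ, ∀ m b x y : Fin n, {m, b} ∈ regionLabels κ c → {x, y} ∈ regionLabels κ c →
      sbtw m x b → sbtw b y m → cycPos m b ≤ N → False := by
    intro N
    induction N with
    | zero =>
      intro m b x y _ _ hx _ hN
      have := cycPos_lt_of_sbtw hx
      omega
    | succ N ih =>
      intro m b x y hmb hxy hx hy hN
      obtain ⟨a, p, ha, h1, h2, h3⟩ := h.exists_black hmb ⟨x, hx⟩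
      by_cases hxa : x = a
      · subst hxa
        refine h.not_mem_of_black (m := x) (a := b) (b := m) (by rwa [Finset.pair_comm] at *; ) (by rwa [Finset.pair_comm]) (by rwa [Finset.pair_comm]) ?_ hy hxy
        exact hx
      · have hlt := cycPos_lt_of_sbtw ha
        have hlt2 : cycPos a b < cycPos m b := by
          unfold cycPos
          simp only [Fin.sbtw_iff] at ha
          split_ifs <;> omega
        by_cases hxs : sbtw m x a
        · refine ih m a x y h1.1 hxy hxs ?_ (by omega)
          clear ih hN hlt hlt2
          simp only [Fin.sbtw_iff] at *
          omega
        · refine ih a b x y h3.1 hxy ?_ ?_ (by omega) <;>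
          · clear ih hN hlt hlt2
            simp only [Fin.sbtw_iff] at *
            omega
  intro hcr
  obtain ⟨m, b, -, rfl⟩ := Finset.card_eq_two.1 (card_of_mem_regionLabels he)
  obtain ⟨x, y, -, rfl⟩ := Finset.card_eq_two.1 (card_of_mem_regionLabels hf)
  rcases crosses_iff.1 hcr with ⟨h1, h2⟩ | ⟨h1, h2⟩
  · exact key _ m b x y he hf h1 h2 le_rfl
  · exact key _ m b y x he (by rwa [Finset.pair_comm]) h1 h2 le_rfl

/-- The labels of the regions form a triangulation. -/
theorem GenericPlot.isTriangulation_regionLabels (h : GenericPlot κ c) :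
    IsTriangulation Set.univ (regionLabels κ c) := by
  have hn := h.three_le
  -- Here m is the successor of 0, and the arc from m round to 0 contains every other corner.
  obtain ⟨a₀, m, h0, huniq⟩ := exists_cyclic_neighbours h.three_le ⟨0, by omega⟩
  have hw := (h.isWall_neighbours h0 huniq).symm.left_mem
  refine isTriangulation_of_exists_apex (a₀ := m) (b₀ := ⟨0, by omega⟩)
    (fun e he => ⟨card_of_mem_regionLabels he, by simp⟩)
    (fun e he f hf => h.not_crosses_regionLabels he hf) (by rwa [Finset.pair_comm]) ?_ ?_
  · intro x _
    have := huniq x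
    simp only [Fin.sbtw_iff] at *
    omega
  · intro a b hab x _ hx _
    obtain ⟨d, p, h1, h2, -, h3⟩ := h.exists_black hab ⟨x, hx⟩
    exact ⟨d, h1, h2.1, h3.1⟩

end PlotTriangulation

/-! ### Starting points of walls in combinatorial terms. -/

section GraphIso

variable {n : ℕ} {κ : Fin n → ℝ}

/-- The extreme point of the wall against its direction is the one where it cannot be continued
backwards, that is, where another phase takes over. -/
theorem GenericPlot.startsAt_iff {A : Matrix (Fin 2) (Fin n) ℝ} {t : ℝ}
    (h : GenericPlot κ (constTerm κ A t)) {m a b : Fin n} (hab : a ≠ b) (hma : m ≠ a) (hmb : m ≠ b)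
    (had : AreAdjacent κ A t ⟨{m, a}, Finset.card_pair hma⟩ ⟨{m, b}, Finset.card_pair hmb⟩)
    (p : ℝ × ℝ) :
    SolitonDart.StartsAt (κ := κ) (A := A) (t := t)
      ⟨(⟨{m, a}, Finset.card_pair hma⟩, ⟨{m, b}, Finset.card_pair hmb⟩), had⟩ p ↔
      WallStarts κ (constTerm κ A t) m a b p := by
  have hdir : SolitonDart.direction (κ := κ) (A := A) (t := t)
      ⟨(⟨{m, a}, Finset.card_pair hma⟩, ⟨{m, b}, Finset.card_pair hmb⟩), had⟩ =
      wallDir κ {m, a} {m, b} := rfl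
  unfold SolitonDart.StartsAt
  rw [hdir]
  simp only [solitonWall_eq h.sums, Set.mem_ofPred_eq]
  constructor
  · rintro ⟨⟨ha, hb⟩, hmin⟩
    rw [h.wallStarts_iff ha hb]
    by_contra hcon
    push Not at hcon
    have hall : ∀ K, Adherent κ (constTerm κ A t) p K → slope₂ κ K (-wallDir κ {m, a} {m, b}) ≤
        slope₂ κ {m, a} (-wallDir κ {m, a} {m, b}) := by
      intro K hK
      rw [slope₂_neg, slope₂_neg, neg_le_neg_iff]
      exact hcon K hK
    have hn : 2 ≤ n := le_of_lt h.three_le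
    obtain ⟨r, ⟨h5, h6⟩, hr⟩ := (((eventually_adherent hn h.sums ha hall).and
      (eventually_adherent hn h.sums hb (fun K hK => by
        rw [slope₂_neg {m, b}, ← slope₂_wallDir, ← slope₂_neg]; exact hall K hK))).and
      (self_mem_nhdsWithin : Set.Ioi (0 : ℝ) ∈ 𝓝[>] (0 : ℝ))).exists
    have hr' : (0 : ℝ) < r := hr
    have := hmin _ ⟨h5, h6⟩
    rw [wallDir_pair hma hmb] at this
    simp only [Prod.fst_add, Prod.smul_fst, Prod.snd_add, Prod.smul_snd, Prod.fst_neg, Prod.snd_neg,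
      smul_eq_mul] at this
    have hpos : 0 < (κ b - κ a) ^ 2 :=
      sq_pos_of_ne_zero (sub_ne_zero.2 fun e => hab (h.mono.injective e).symm)
    nlinarith [mul_pos hr' hpos, mul_nonneg hr'.le (sq_nonneg (κ a ^ 2 - κ b ^ 2))]
  · intro hw
    refine ⟨⟨hw.1, hw.2.1⟩, fun q hq => ?_⟩
    obtain ⟨K, hK, hlt⟩ := (h.wallStarts_iff hw.1 hw.2.1).1 hw
    obtain ⟨r, rfl⟩ := exists_eq_add_smul_wallDir h.mono hab hw.1 hw.2.1 hq.1 hq.2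
    have e1 := hq.1.2.2 K hK.2.1
    rw [height_add_smul, height_add_smul, hw.1.height_eq hK] at e1
    have hr : 0 ≤ r := by
      by_contra hr
      push Not at hr
      nlinarith
    simp only [Prod.fst_add, Prod.smul_fst, Prod.snd_add, Prod.smul_snd, smul_eq_mul,
      add_sub_cancel_left]
    nlinarith [mul_nonneg hr (sq_nonneg (wallDir κ {m, a} {m, b}).1),
      mul_nonneg hr (sq_nonneg (wallDir κ {m, a} {m, b}).2)]

section
variable {c : Finset (Fin n) → ℝ}

theorem WallStarts.isWall {m a b : Fin n} {p : ℝ × ℝ} (hab : a ≠ b) (hw : WallStarts κ c m a b p) :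
    IsWall κ c m a b := ⟨hab, p, hw.1, hw.2.1⟩

/-- A region {a,b} excludes a white start, because it would cross the third region {m,x}; the cyclic
order excludes a start at infinity. -/
theorem GenericPlot.exists_black_start_iff (h : GenericPlot κ c) {m a b : Fin n}
    (hw : IsWall κ c m a b) :
    (∃ p, Adherent κ c p {m, a} ∧ Adherent κ c p {m, b} ∧ Adherent κ c p {a, b} ∧ sbtw b m a) ↔
      sbtw m a b ∧ {a, b} ∈ regionLabels κ c := by
  constructor
  · rintro ⟨p, h1, h2, h3, h4⟩
    exact ⟨by simp only [Fin.sbtw_iff] at *; omega, h3.1⟩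
  · rintro ⟨h1, h2⟩
    rcases h.trichotomy hw with ⟨p, z, h3, h4, h5, h6⟩ | hp | ⟨h3, h4⟩
    · refine absurd (crosses_iff.2 (Or.inl ⟨h6, ?_⟩)) (h.not_crosses_regionLabels h2
        (Finset.pair_comm m z ▸ h5.1))
      simp only [Fin.sbtw_iff] at *; omega
    · exact hp
    · simp only [Fin.sbtw_iff] at *; omega

/-- A white start with another third region {m,z} would produce crossing walls around m, and a black
start a region {a,b} that crosses {m,x}. -/
theorem GenericPlot.exists_white_start_iff (h : GenericPlot κ c) {m a b x : Fin n}
    (hw : IsWall κ c m a b) :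
    (∃ p, Adherent κ c p {m, a} ∧ Adherent κ c p {m, b} ∧ Adherent κ c p {m, x} ∧ sbtw a x b) ↔
      sbtw a x b ∧ IsWall κ c m a x ∧ IsWall κ c m b x := by
  constructor
  · rintro ⟨p, h1, h2, h3, h4⟩
    have : a ≠ x ∧ b ≠ x := by simp only [Fin.sbtw_iff] at *; omega
    exact ⟨h4, ⟨this.1, p, h1, h3⟩, ⟨this.2, p, h2, h3⟩⟩
  · rintro ⟨h1, h2, h3⟩
    have hmx := Finset.ne_of_card_pair (card_of_mem_regionLabels h2.symm.left_mem)
    rcases h.trichotomy hw with ⟨p, z, h4, h5, h6, h7⟩ | ⟨p, h4, h5, h6, h7⟩ | ⟨h4, h5⟩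
    · have hzx : z = x := by
        by_contra hne
        have w1 : IsWall κ c m a z := ⟨by simp only [Fin.sbtw_iff] at h7; omega, p, h4, h6⟩
        have w2 : IsWall κ c m b z := ⟨by simp only [Fin.sbtw_iff] at h7; omega, p, h5, h6⟩
        have c1 := h.not_crosses_wallPairs (mem_wallPairs.2 w1) (mem_wallPairs.2 h3)
        have c2 := h.not_crosses_wallPairs (mem_wallPairs.2 w2) (mem_wallPairs.2 h2)
        rw [crosses_iff] at c1 c2
        clear hw
        simp only [Fin.sbtw_iff] at *
        grind
      exact ⟨p, h4, h5, hzx ▸ h6, h1⟩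
    · refine absurd (crosses_iff.2 (Or.inl ⟨h1, h7⟩)) (h.not_crosses_regionLabels h6.1
        (Finset.pair_comm m x ▸ h2.symm.left_mem))
    · exact absurd (h5 x h1).symm hmx

theorem GenericPlot.boundary_iff (h : GenericPlot κ c) {m a b : Fin n} (hw : IsWall κ c m a b) :
    (¬ ∃ p, WallStarts κ c m a b p) ↔ sbtw a m b ∧ ∀ x, sbtw a x b → x = m := by
  constructor
  · intro hno
    rcases h.trichotomy hw with ⟨p, z, h4, h5, h6, h7⟩ | ⟨p, h4, h5, h6, h7⟩ | h4
    · exact absurd ⟨p, h4, h5, Or.inl ⟨z, h6, h7⟩⟩ hno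
    · exact absurd ⟨p, h4, h5, Or.inr ⟨h6, h7⟩⟩ hno
    · exact h4
  · rintro ⟨h1, h2⟩ ⟨p, -, -, ⟨x, hx, hx'⟩ | ⟨-, h3⟩⟩
    · exact hx.ne (h2 x hx').symm
    · simp only [Fin.sbtw_iff] at *; omega

/-- At a black vertex exactly one wall extends downwards. -/
theorem GenericPlot.black_wallStarts (h : GenericPlot κ c) {x y z : Fin n} (hxy : x < y)
    (hyz : y < z) {p : ℝ × ℝ} (h1 : Adherent κ c p {x, y}) (h2 : Adherent κ c p {x, z})
    (h3 : Adherent κ c p {y, z}) (m a b : Fin n) (hab : a ≠ b) : WallStarts κ c m a b p ↔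
      (m = x ∧ a = y ∧ b = z) ∨ (m = y ∧ a = z ∧ b = x) ∨ (m = z ∧ a = x ∧ b = y) := by
  have inj : ∀ {u v w : Fin n}, u ≠ v → ({w, u} : Finset (Fin n)) ≠ {w, v} := fun huv e =>
    huv (pair_injective_right e)
  have i2 : ({x, y} : Finset (Fin n)) ≠ {y, z} := by
    rw [Finset.pair_comm x y]
    exact inj (hxy.trans hyz).ne
  have i3 : ({x, z} : Finset (Fin n)) ≠ {y, z} := by
    rw [Finset.pair_comm x z, Finset.pair_comm y z]
    exact inj hxy.ne
  have hall : ∀ s, Adherent κ c p s → s = {x, y} ∨ s = {x, z} ∨ s = {y, z} := fun s hs =>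
    h.three p _ _ _ _ h1 h2 h3 hs (inj hyz.ne) i2 i3
  constructor
  · rintro ⟨ha, hb, hc⟩
    rcases hc with ⟨w, hw, hs⟩ | ⟨-, hs⟩
    -- A third region containing m is impossible, for no index belongs to all three sides of a
    -- triangle.
    · exfalso
      have nab : ({m, a} : Finset (Fin n)) ≠ {m, b} := inj hab
      have nwa : ({m, w} : Finset (Fin n)) ≠ {m, a} := inj (by
        simp only [Fin.sbtw_iff] at hs; omega)
      have nwb : ({m, w} : Finset (Fin n)) ≠ {m, b} := inj (by
        simp only [Fin.sbtw_iff] at hs; omega)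
      have m1 : m ∈ ({m, a} : Finset (Fin n)) := by simp
      have m2 : m ∈ ({m, b} : Finset (Fin n)) := by simp
      have m3 : m ∈ ({m, w} : Finset (Fin n)) := by simp
      rcases hall _ ha with e | e | e <;> rcases hall _ hb with e' | e' | e' <;>
        rcases hall _ hw with e'' | e'' | e'' <;>
        first
        | exact absurd (e.trans e'.symm) nab
        | exact absurd (e''.trans e.symm) nwa
        | exact absurd (e''.trans e'.symm) nwb
        | rw [e] at m1
          rw [e'] at m2
          rw [e''] at m3
          simp only [Finset.mem_insert, Finset.mem_singleton] at m1 m2 m3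
          omega
    · have ea := hall _ ha
      have eb := hall _ hb
      clear hall inj h1 h2 h3 ha hb h i2 i3
      simp only [Finset.pair_eq_iff] at ea eb
      simp only [Fin.sbtw_iff] at *
      omega
  · rintro (⟨rfl, rfl, rfl⟩ | ⟨rfl, rfl, rfl⟩ | ⟨rfl, rfl, rfl⟩)
    · exact ⟨h1, h2, Or.inr ⟨h3, by simp only [Fin.sbtw_iff]; omega⟩⟩
    · exact ⟨h3, Finset.pair_comm b m ▸ h1, Or.inr ⟨Finset.pair_comm b a ▸ h2, by
        simp only [Fin.sbtw_iff]; omega⟩⟩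
    · exact ⟨Finset.pair_comm a m ▸ h2, Finset.pair_comm b m ▸ h3, Or.inr ⟨h1, by
        simp only [Fin.sbtw_iff]; omega⟩⟩

/-- At a white vertex exactly one wall extends upwards. -/
theorem GenericPlot.white_wallStarts (h : GenericPlot κ c) {x y z w : Fin n} (hxy : x < y)
    (hyz : y < z) {p : ℝ × ℝ} (h1 : Adherent κ c p {w, x}) (h2 : Adherent κ c p {w, y})
    (h3 : Adherent κ c p {w, z}) (m a b : Fin n) (hab : a ≠ b) : WallStarts κ c m a b p ↔
      (m = w ∧ a = x ∧ b = z) ∨ (m = w ∧ a = z ∧ b = y) ∨ (m = w ∧ a = y ∧ b = x) := by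
  have inj : ∀ {u v w : Fin n}, u ≠ v → ({w, u} : Finset (Fin n)) ≠ {w, v} := fun huv e =>
    huv (pair_injective_right e)
  have hall : ∀ s, Adherent κ c p s → s = {w, x} ∨ s = {w, y} ∨ s = {w, z} := fun s hs =>
    h.three p _ _ _ _ h1 h2 h3 hs (inj hxy.ne) (inj (hxy.trans hyz).ne) (inj hyz.ne)
  have n1 := h1.ne
  have n2 := h2.ne
  have n3 := h3.ne
  constructor
  · rintro ⟨ha, hb, hc⟩
    have hw : ∀ s, Adherent κ c p s → w ∈ s := fun s hs => by
      rcases hall s hs with rfl | rfl | rfl <;> simp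
    obtain rfl : w = m := by
      have e1 := hw _ ha
      have e2 := hw _ hb
      simp only [Finset.mem_insert, Finset.mem_singleton] at e1 e2
      by_contra hne
      exact hab ((e1.resolve_left hne).symm.trans (e2.resolve_left hne))
    have hleaf : ∀ u, Adherent κ c p {w, u} → u = x ∨ u = y ∨ u = z := fun u hu =>
      (hall _ hu).imp pair_injective_right (Or.imp pair_injective_right pair_injective_right)
    have ea := hleaf _ ha
    have eb := hleaf _ hb
    rcases hc with ⟨u, hu, hs⟩ | ⟨hu, hs⟩
    · have eu := hleaf _ hu
      clear hall inj hleaf hw h1 h2 h3 ha hb hu h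
      simp only [Fin.sbtw_iff, Fin.lt_def, Fin.ext_iff] at *
      grind
    · have := hw _ hu
      simp only [Finset.mem_insert, Finset.mem_singleton] at this
      exact absurd this (not_or.2 ⟨ha.ne, hb.ne⟩)
  · rintro (⟨rfl, rfl, rfl⟩ | ⟨rfl, rfl, rfl⟩ | ⟨rfl, rfl, rfl⟩)
    · exact ⟨h1, h3, Or.inl ⟨y, h2, by simp only [Fin.sbtw_iff]; omega⟩⟩
    · exact ⟨h3, h2, Or.inl ⟨x, h1, by simp only [Fin.sbtw_iff]; omega⟩⟩
    · exact ⟨h2, h1, Or.inl ⟨z, h3, by simp only [Fin.sbtw_iff]; omega⟩⟩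

end

end GraphIso

/-! ### Darts and colours. -/

section GraphIso

variable {n : ℕ} {κ : Fin n → ℝ} {A : Matrix (Fin 2) (Fin n) ℝ} {t : ℝ}

/-- Identifications of labelled embedded graphs can be inverted. -/
def DiskGraph.Iso.symm {G H : DiskGraph n} (e : DiskGraph.Iso G H) : DiskGraph.Iso H G where
  toEquiv := e.toEquiv.symm
  map_rev d := by
    apply e.toEquiv.injective
    rw [e.map_rev]
    simp
  map_next d d' := by
    rw [← e.map_next]
    simp
  map_black d := by
    rw [← e.map_black]
    simp
  map_white d := by
    rw [← e.map_white]
    simp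
  map_boundary d := by
    rw [← e.map_boundary]
    simp
  map_left d := by
    rw [← e.map_left]
    simp
  map_edgeLabel d := by
    rw [← e.map_edgeLabel]
    simp

theorem PsiDart.isWall {c : Finset (Fin n) → ℝ} (d : PsiDart (wallPairs κ c)) :
    IsWall κ c d.a d.b d.c := mem_wallPairs.1 d.mem

/-- The edge of the resolved graph given by a wall. -/
def IsWall.dart {c : Finset (Fin n) → ℝ} {m a b : Fin n} (hw : IsWall κ c m a b) :
    PsiDart (wallPairs κ c) := ⟨m, a, b, hw.1, mem_wallPairs.2 hw⟩

theorem IsWall.ne_left {c : Finset (Fin n) → ℝ} {m a b : Fin n} (hw : IsWall κ c m a b) : m ≠ a :=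
  Finset.ne_of_card_pair (card_of_mem_regionLabels hw.left_mem)

/-- The line-soliton that corresponds to an edge of the resolved graph. -/
def GenericPlot.solitonDart (h : GenericPlot κ (constTerm κ A t))
    (d : PsiDart (wallPairs κ (constTerm κ A t))) : SolitonDart κ A t :=
  ⟨(⟨{d.a, d.b}, Finset.card_pair d.isWall.ne_left⟩,
    ⟨{d.a, d.c}, Finset.card_pair d.isWall.symm.ne_left⟩),
    (areAdjacent_iff (le_of_lt h.three_le) h.sums h.three _ _).2
      ⟨fun e => d.ne (pair_injective_right e), d.isWall.2⟩⟩

theorem GenericPlot.startsAt_solitonDart_iff (h : GenericPlot κ (constTerm κ A t))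
    (d : PsiDart (wallPairs κ (constTerm κ A t))) (p : ℝ × ℝ) :
    (h.solitonDart d).StartsAt p ↔ WallStarts κ (constTerm κ A t) d.a d.b d.c p :=
  h.startsAt_iff d.ne d.isWall.ne_left d.isWall.symm.ne_left (h.solitonDart d).2 p

theorem GenericPlot.solitonDart_injective (h : GenericPlot κ (constTerm κ A t)) :
    Function.Injective h.solitonDart := by
  intro d d' e
  have e0 := congrArg Subtype.val e
  have e1 : ({d.a, d.b} : Finset (Fin n)) = {d'.a, d'.b} :=
    congrArg (fun x : KSubset 2 n × KSubset 2 n => x.1.1) e0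
  have e2 : ({d.a, d.c} : Finset (Fin n)) = {d'.a, d'.c} :=
    congrArg (fun x : KSubset 2 n × KSubset 2 n => x.2.1) e0
  have h1 : d.a = d'.a := by
    by_contra hne
    have m1 : d.a ∈ ({d'.a, d'.b} : Finset (Fin n)) := e1 ▸ by simp
    have m2 : d.a ∈ ({d'.a, d'.c} : Finset (Fin n)) := e2 ▸ by simp
    simp only [Finset.mem_insert, Finset.mem_singleton] at m1 m2
    exact d'.ne ((m1.resolve_left hne).symm.trans (m2.resolve_left hne))
  rw [← h1] at e1 e2
  exact PsiDart.ext h1 (pair_injective_right e1) (pair_injective_right e2)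

theorem GenericPlot.solitonDart_surjective (h : GenericPlot κ (constTerm κ A t)) :
    Function.Surjective h.solitonDart := by
  rintro ⟨⟨⟨I, hI⟩, ⟨J, hJ⟩⟩, had⟩
  obtain ⟨hne, p, h1, h2⟩ := (areAdjacent_iff (le_of_lt h.three_le) h.sums h.three _ _).1 had
  simp only at h1 h2 hne
  obtain ⟨m, hm, hm'⟩ := h.shares p _ _ h1 h2
  obtain ⟨a, rfl⟩ := Finset.eq_pair_of_mem hI hm
  obtain ⟨b, rfl⟩ := Finset.eq_pair_of_mem hJ hm'
  have hab : a ≠ b := by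
    rintro rfl
    exact hne rfl
  exact ⟨⟨m, a, b, hab, mem_wallPairs.2 ⟨hab, p, h1, h2⟩⟩, rfl⟩

theorem GenericPlot.existsUnique_dart_iff (h : GenericPlot κ (constTerm κ A t))
    (P : SolitonDart κ A t → Prop) :
    (∃! e, P e) ↔ ∃! d, P (h.solitonDart d) :=
  (Function.Bijective.existsUnique_iff ⟨h.solitonDart_injective, h.solitonDart_surjective⟩)

theorem GenericPlot.direction_solitonDart (h : GenericPlot κ (constTerm κ A t))
    (d : PsiDart (wallPairs κ (constTerm κ A t))) :
    (h.solitonDart d).direction.2 = κ d.c - κ d.b :=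
  congrArg Prod.snd (wallDir_pair d.isWall.ne_left d.isWall.symm.ne_left)

/-- The colours at the source of a wall that starts at a black vertex. -/
theorem GenericPlot.colours_black (h : GenericPlot κ (constTerm κ A t)) {x y z : Fin n} (hxy : x < y)
    (hyz : y < z) {p : ℝ × ℝ} (h1 : Adherent κ (constTerm κ A t) p {x, y})
    (h2 : Adherent κ (constTerm κ A t) p {x, z}) (h3 : Adherent κ (constTerm κ A t) p {y, z}) :
    (∃! e : SolitonDart κ A t, e.StartsAt p ∧ e.direction.2 < 0) ∧
      ¬ ∃! e : SolitonDart κ A t, e.StartsAt p ∧ 0 < e.direction.2 := by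
  have hw := h.black_wallStarts hxy hyz h1 h2 h3
  have k1 := h.mono hxy
  have k2 := h.mono hyz
  have s1 := (hw x y z hyz.ne).2 (by simp)
  have s2 := (hw y z x (hxy.trans hyz).ne').2 (by simp)
  have s3 := (hw z x y hxy.ne).2 (by simp)
  rw [h.existsUnique_dart_iff, h.existsUnique_dart_iff]
  simp only [h.startsAt_solitonDart_iff, h.direction_solitonDart]
  constructor
  -- The three darts have the vertical components κ z - κ y, κ x - κ z and κ y - κ x, of which only
  -- the second is negative.
  · refine ⟨(s2.isWall (hxy.trans hyz).ne').dart,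
      ⟨s2, by dsimp only [IsWall.dart]; linarith⟩, ?_⟩
    rintro ⟨m, a, b, hab, hmem⟩ ⟨hs, hd⟩
    simp only at hs hd
    rcases (hw m a b hab).1 hs with ⟨rfl, rfl, rfl⟩ | ⟨rfl, rfl, rfl⟩ | ⟨rfl, rfl, rfl⟩
    · linarith
    · rfl
    · linarith
  · rintro ⟨e, -, hu⟩
    have e1 := hu (s1.isWall hyz.ne).dart ⟨s1, by dsimp only [IsWall.dart]; linarith⟩
    have e2 := hu (s3.isWall hxy.ne).dart ⟨s3, by dsimp only [IsWall.dart]; linarith⟩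
    exact (hxy.trans hyz).ne (congrArg PsiDart.a (e1.trans e2.symm))

/-- The colours at the source of a wall that starts at a white vertex. -/
theorem GenericPlot.colours_white (h : GenericPlot κ (constTerm κ A t)) {x y z w : Fin n}
    (hxy : x < y) (hyz : y < z) {p : ℝ × ℝ} (h1 : Adherent κ (constTerm κ A t) p {w, x})
    (h2 : Adherent κ (constTerm κ A t) p {w, y}) (h3 : Adherent κ (constTerm κ A t) p {w, z}) :
    (¬ ∃! e : SolitonDart κ A t, e.StartsAt p ∧ e.direction.2 < 0) ∧
      ∃! e : SolitonDart κ A t, e.StartsAt p ∧ 0 < e.direction.2 := by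
  have hw := h.white_wallStarts hxy hyz h1 h2 h3
  have k1 := h.mono hxy
  have k2 := h.mono hyz
  have s1 := (hw w x z (hxy.trans hyz).ne).2 (by simp)
  have s2 := (hw w z y hyz.ne').2 (by simp)
  have s3 := (hw w y x hxy.ne').2 (by simp)
  rw [h.existsUnique_dart_iff, h.existsUnique_dart_iff]
  simp only [h.startsAt_solitonDart_iff, h.direction_solitonDart]
  constructor
  · rintro ⟨e, -, hu⟩
    have e1 := hu (s2.isWall hyz.ne').dart ⟨s2, by dsimp only [IsWall.dart]; linarith⟩
    have e2 := hu (s3.isWall hxy.ne').dart ⟨s3, by dsimp only [IsWall.dart]; linarith⟩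
    exact hyz.ne' (congrArg PsiDart.b (e1.trans e2.symm))
  -- The three darts have the vertical components κ z - κ x, κ y - κ z and κ x - κ y, of which only
  -- the first is positive.
  · refine ⟨(s1.isWall (hxy.trans hyz).ne).dart,
      ⟨s1, by dsimp only [IsWall.dart]; linarith⟩, ?_⟩
    rintro ⟨m, a, b, hab, hmem⟩ ⟨hs, hd⟩
    simp only at hs hd
    rcases (hw m a b hab).1 hs with ⟨rfl, rfl, rfl⟩ | ⟨rfl, rfl, rfl⟩ | ⟨rfl, rfl, rfl⟩
    · rfl
    · linarith
    · linarith

theorem GenericPlot.colours_black' (h : GenericPlot κ (constTerm κ A t)) {m a b : Fin n}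
    {p : ℝ × ℝ} (h1 : Adherent κ (constTerm κ A t) p {m, a})
    (h2 : Adherent κ (constTerm κ A t) p {m, b}) (h3 : Adherent κ (constTerm κ A t) p {a, b}) :
    (∃! e : SolitonDart κ A t, e.StartsAt p ∧ e.direction.2 < 0) ∧
      ¬ ∃! e : SolitonDart κ A t, e.StartsAt p ∧ 0 < e.direction.2 := by
  have n1 := h1.ne
  have n2 := h2.ne
  have n3 := h3.ne
  have h1' := Finset.pair_comm m a ▸ h1
  have h2' := Finset.pair_comm m b ▸ h2
  have h3' := Finset.pair_comm a b ▸ h3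
  rcases lt_or_gt_of_ne n1 with k1 | k1 <;> rcases lt_or_gt_of_ne n2 with k2 | k2 <;>
    rcases lt_or_gt_of_ne n3 with k3 | k3
  · exact h.colours_black k1 k3 h1 h2 h3
  · exact h.colours_black k2 k3 h2 h1 h3'
  · omega
  · exact h.colours_black k2 k1 h2' h3' h1
  · exact h.colours_black k1 k2 h1' h3 h2
  · omega
  · exact h.colours_black k3 k2 h3 h1' h2'
  · exact h.colours_black k3 k1 h3' h2' h1'

theorem GenericPlot.colours_white' (h : GenericPlot κ (constTerm κ A t)) {x y z w : Fin n}
    (hxy : x ≠ y) (hxz : x ≠ z) (hyz : y ≠ z)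
    {p : ℝ × ℝ} (h1 : Adherent κ (constTerm κ A t) p {w, x})
    (h2 : Adherent κ (constTerm κ A t) p {w, y}) (h3 : Adherent κ (constTerm κ A t) p {w, z}) :
    (¬ ∃! e : SolitonDart κ A t, e.StartsAt p ∧ e.direction.2 < 0) ∧
      ∃! e : SolitonDart κ A t, e.StartsAt p ∧ 0 < e.direction.2 := by
  rcases lt_or_gt_of_ne hxy with k1 | k1 <;> rcases lt_or_gt_of_ne hxz with k2 | k2 <;>
    rcases lt_or_gt_of_ne hyz with k3 | k3
  · exact h.colours_white k1 k3 h1 h2 h3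
  · exact h.colours_white k2 k3 h1 h3 h2
  · omega
  · exact h.colours_white k2 k1 h3 h1 h2
  · exact h.colours_white k1 k2 h2 h1 h3
  · omega
  · exact h.colours_white k3 k2 h2 h3 h1
  · exact h.colours_white k3 k1 h3 h2 h1

theorem finRotate_eq_iff (hn : 3 ≤ n) {a b m : Fin n} :
    (finRotate n a = m ∧ finRotate n m = b) ↔ (sbtw a m b ∧ ∀ x, sbtw a x b → x = m) := by
  obtain ⟨k, rfl⟩ : ∃ k, n = k + 1 := ⟨n - 1, by omega⟩
  have hrot : ∀ x y : Fin (k + 1), finRotate (k + 1) x = y ↔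
      (x.1 = k ∧ y.1 = 0) ∨ (y.1 = x.1 + 1) := by
    intro x y
    rw [Fin.ext_iff]
    have hx := x.2
    have hy := y.2
    rcases eq_or_ne x (Fin.last k) with rfl | hne
    · rw [finRotate_last]
      change 0 = y.1 ↔ (k = k ∧ y.1 = 0) ∨ y.1 = k + 1
      omega
    · rw [coe_finRotate_of_ne_last hne]
      have : x.1 ≠ k := fun e => hne (Fin.ext e)
      constructor
      · intro h; exact Or.inr h.symm
      · intro h; omega
  rw [hrot, hrot]
  have ha := a.2
  have hb := b.2
  have hm := m.2
  constructor
  · rintro ⟨h1, h2⟩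
    constructor
    · simp only [Fin.sbtw_iff, Fin.lt_def]; omega
    · intro x
      have := x.2
      simp only [Fin.sbtw_iff, Fin.lt_def, Fin.ext_iff]
      omega
  · rintro ⟨h1, h2⟩
    have key : ∀ i : ℕ, (hi : i < k + 1) → ¬ sbtw a ⟨i, hi⟩ b ∨ i = m.1 := by
      intro i hi
      by_cases hs : sbtw a ⟨i, hi⟩ b
      · exact Or.inr (Fin.ext_iff.1 (h2 _ hs))
      · exact Or.inl hs
    simp only [Fin.sbtw_iff, Fin.lt_def] at key h1
    -- It suffices to test the successor of a and the predecessor of b.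
    have e1 := key (if a.1 = k then 0 else a.1 + 1) (by split_ifs <;> omega)
    have e2 := key (if b.1 = 0 then k else b.1 - 1) (by split_ifs <;> omega)
    split_ifs at e1 e2 <;> omega

end GraphIso

/-! ### Rotation around vertices and the isomorphism. -/

section GraphIso

variable {n : ℕ} {κ : Fin n → ℝ} {A : Matrix (Fin 2) (Fin n) ℝ} {t : ℝ}

section
variable {c : Finset (Fin n) → ℝ}

theorem GenericPlot.starts_centre_iff (h : GenericPlot κ c) (d : PsiDart (wallPairs κ c)) :
    (∃ Δ, d.StartsAt (regionLabels κ c) (.centre Δ)) ↔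
      ∃ p, Adherent κ c p {d.a, d.b} ∧ Adherent κ c p {d.a, d.c} ∧ Adherent κ c p {d.b, d.c} ∧
        sbtw d.c d.a d.b := by
  rw [h.exists_black_start_iff d.isWall]
  exact ⟨fun ⟨Δ, h1, h2, _⟩ => ⟨h1, h2⟩, fun ⟨h1, h2⟩ => ⟨_, h1, h2, rfl⟩⟩

theorem sbtw_rotate_iff {a b x : Fin n} : sbtw b a x ↔ sbtw a x b := by
  simp only [Fin.sbtw_iff]; omega

theorem GenericPlot.starts_node_iff (h : GenericPlot κ c) (d : PsiDart (wallPairs κ c)) :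
    (∃ a δ, d.StartsAt (regionLabels κ c) (.node a δ)) ↔
      ∃ p x, Adherent κ c p {d.a, d.b} ∧ Adherent κ c p {d.a, d.c} ∧ Adherent κ c p {d.a, x} ∧
        sbtw d.b x d.c := by
  constructor
  · rintro ⟨a, δ, rfl, x, h1, h2, h3, -⟩
    obtain ⟨p, hp⟩ := (h.exists_white_start_iff d.isWall).2
      ⟨sbtw_rotate_iff.1 h1, mem_wallPairs.1 h2, mem_wallPairs.1 h3⟩
    exact ⟨p, x, hp⟩
  · rintro ⟨p, x, hp⟩
    obtain ⟨h1, h2, h3⟩ := (h.exists_white_start_iff d.isWall).1 ⟨p, hp⟩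
    exact ⟨_, _, rfl, x, sbtw_rotate_iff.2 h1, mem_wallPairs.2 h2, mem_wallPairs.2 h3, rfl⟩

theorem GenericPlot.starts_rayEnd_iff (h : GenericPlot κ c) (d : PsiDart (wallPairs κ c)) :
    (∃ a, d.StartsAt (regionLabels κ c) (.rayEnd a)) ↔ ¬ ∃ p, WallStarts κ c d.a d.b d.c p := by
  rw [h.boundary_iff d.isWall, ← finRotate_eq_iff h.three_le]
  exact ⟨fun ⟨a, _, h1⟩ => h1, fun h1 => ⟨_, rfl, h1⟩⟩

theorem GenericPlot.adherent_black (h : GenericPlot κ c) {m a b : Fin n} {p : ℝ × ℝ}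
    (h1 : Adherent κ c p {m, a}) (h2 : Adherent κ c p {m, b}) (h3 : Adherent κ c p {a, b})
    {s : Finset (Fin n)} (hs : Adherent κ c p s) : s = {m, a} ∨ s = {m, b} ∨ s = {a, b} := by
  refine h.three p _ _ _ _ h1 h2 h3 hs (fun e => h3.ne (pair_injective_right e)) (fun e => ?_)
    (fun e => ?_)
  · rw [Finset.pair_comm] at e
    exact h2.ne (pair_injective_right e)
  · rw [Finset.pair_comm m, Finset.pair_comm a] at e
    exact h1.ne (pair_injective_right e)

theorem GenericPlot.adherent_white (h : GenericPlot κ c) {m a b x : Fin n} {p : ℝ × ℝ}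
    (h1 : Adherent κ c p {m, a}) (h2 : Adherent κ c p {m, b}) (h3 : Adherent κ c p {m, x})
    (hx : sbtw a x b)
    {s : Finset (Fin n)} (hs : Adherent κ c p s) : s = {m, a} ∨ s = {m, b} ∨ s = {m, x} := by
  have hne : a ≠ b ∧ a ≠ x ∧ b ≠ x := by simp only [Fin.sbtw_iff] at hx; omega
  exact h.three p _ _ _ _ h1 h2 h3 hs (fun e => hne.1 (pair_injective_right e))
    (fun e => hne.2.1 (pair_injective_right e)) (fun e => hne.2.2 (pair_injective_right e))

/-- One counterclockwise turn around the centre of a triangle permutes its corners cyclically. -/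
theorem triangle_next {m a b m' a' b' : Fin n} (h1 : sbtw m a b) (h2 : sbtw m' a' b')
    (e : ({m', a', b'} : Finset (Fin n)) = {m, a, b}) (e' : ({m', b'} : Finset (Fin n)) = {m, a}) :
    m' = a ∧ a' = b ∧ b' = m := by
  have k : b ∈ ({m', a', b'} : Finset (Fin n)) := by rw [e]; simp
  simp only [Finset.mem_insert, Finset.mem_singleton] at k
  simp only [Fin.sbtw_iff] at h1 h2
  rcases Finset.pair_eq_iff.1 e' with ⟨rfl, rfl⟩ | ⟨rfl, rfl⟩ <;> omega

/-- The analogue of `triangle_next` at a white vertex, where m is fixed and the other labels rotate.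
-/
theorem star_next {a b x a' b' x' m : Fin n} (h1 : sbtw b a x) (h2 : sbtw b' a' x')
    (e : ({a', b', x'} : Finset (Fin n)) = {a, b, x}) (e' : ({m, b'} : Finset (Fin n)) = {m, a}) :
    b' = a ∧ a' = x ∧ x' = b := by
  obtain rfl := pair_injective_right e'
  have k : b ∈ ({a', b', x'} : Finset (Fin n)) := by rw [e]; simp
  have k' : x ∈ ({a', b', x'} : Finset (Fin n)) := by rw [e]; simp
  simp only [Finset.mem_insert, Finset.mem_singleton] at k k'
  simp only [Fin.sbtw_iff] at h1 h2
  omega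

/-- Inner vertices correspond to triple points of the plot. The three regions there determine the
three outgoing darts, so the condition on the common region singles out the same successor on both
sides. -/
theorem GenericPlot.next_iff (h : GenericPlot κ c) (d d' : PsiDart (wallPairs κ c)) :
    (∃ v, (∀ a, v ≠ .rayEnd a) ∧ d.StartsAt (regionLabels κ c) v ∧
      d'.StartsAt (regionLabels κ c) v ∧ ({d'.a, d'.c} : Finset (Fin n)) = {d.a, d.b}) ↔
    ∃ p, WallStarts κ c d.a d.b d.c p ∧ WallStarts κ c d'.a d'.b d'.c p ∧
      ({d'.a, d'.c} : Finset (Fin n)) = {d.a, d.b} := by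
  obtain ⟨m, a, b, hab, hmem⟩ := d
  obtain ⟨m', a', b', hab', hmem'⟩ := d'
  have hw := mem_wallPairs.1 hmem
  have hw' := mem_wallPairs.1 hmem'
  simp only
  constructor
  · rintro ⟨Δ | ⟨w, δ⟩ | w, hv, h1, h2, h3⟩
    · obtain ⟨h11, h12, rfl⟩ := h1
      obtain ⟨h21, h22, h23⟩ := h2
      simp only at *
      obtain ⟨rfl, rfl, rfl⟩ := triangle_next h11 h21 h23.symm h3
      obtain ⟨p, q1, q2, q3, q4⟩ := (h.exists_black_start_iff hw).2 ⟨h11, h12⟩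
      refine ⟨p, ⟨q1, q2, Or.inr ⟨q3, q4⟩⟩, ⟨q3, Finset.pair_comm b' m' ▸ q1,
        Or.inr ⟨Finset.pair_comm b' a' ▸ q2, h11⟩⟩, h3⟩
    · obtain ⟨rfl, x, h11, h12, h13, rfl⟩ := h1
      obtain ⟨h20, x', h21, h22, h23, h24⟩ := h2
      simp only at *
      subst h20
      obtain ⟨rfl, rfl, rfl⟩ := star_next h11 h21 h24.symm h3
      obtain ⟨p, q1, q2, q3, q4⟩ := (h.exists_white_start_iff hw).2 ⟨sbtw_rotate_iff.1 h11,
        mem_wallPairs.1 h12, mem_wallPairs.1 h13⟩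
      exact ⟨p, ⟨q1, q2, Or.inl ⟨_, q3, q4⟩⟩, ⟨q3, q1, Or.inl ⟨_, q2, sbtw_rotate_iff.1 h21⟩⟩, h3⟩
    · exact absurd rfl (hv w)
  · rintro ⟨p, ⟨q1, q2, q3⟩, ⟨r1, r2, r3⟩, e⟩
    rcases q3 with ⟨x, q3, q4⟩ | ⟨q3, q4⟩
    · have hall := fun s => h.adherent_white (s := s) q1 q2 q3 q4
      have hmm : ∀ s, Adherent κ c p s → m ∈ s := fun s hs => by
        rcases hall s hs with rfl | rfl | rfl <;> simp
      have hm : m = m' := by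
        have m1 := hmm _ r1
        have m2 := hmm _ r2
        simp only [Finset.mem_insert, Finset.mem_singleton] at m1 m2
        by_contra hne
        exact hab' ((m1.resolve_left hne).symm.trans (m2.resolve_left hne))
      subst hm
      obtain rfl := pair_injective_right e
      have hleaf : ∀ u, Adherent κ c p {m, u} → u = b' ∨ u = b ∨ u = x := fun u hu =>
        (hall _ hu).imp pair_injective_right (Or.imp pair_injective_right pair_injective_right)
      have ha' : a' = x := by
        have e1 := hleaf _ r1
        rcases r3 with ⟨y, hy, hy'⟩ | ⟨hy, -⟩
        · have e2 := hleaf _ hy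
          clear hall hmm hleaf hw hw'
          simp only [Fin.sbtw_iff] at *
          omega
        · have := hmm _ hy
          simp only [Finset.mem_insert, Finset.mem_singleton] at this
          exact absurd this (not_or.2 ⟨r1.ne, r2.ne⟩)
      subst ha'
      have w1 := (h.exists_white_start_iff hw).1 ⟨p, q1, q2, q3, q4⟩
      refine ⟨.node m {b', b, a'}, fun _ => by simp, ⟨rfl, a', sbtw_rotate_iff.2 q4,
        mem_wallPairs.2 w1.2.1, mem_wallPairs.2 w1.2.2, rfl⟩, ⟨rfl, b, ?_, mem_wallPairs.2 w1.2.2.symm,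
        mem_wallPairs.2 hw, ?_⟩, e⟩
      · simp only [Fin.sbtw_iff] at *; omega
      · ext i; simp only [Finset.mem_insert, Finset.mem_singleton]; tauto
    · have hall := fun s => h.adherent_black (s := s) q1 q2 q3
      have hm : m' = a ∧ b' = m ∧ a' = b := by
        have e1 := hall _ r1
        have n1 := q1.ne
        have n2 := q2.ne
        rcases Finset.pair_eq_iff.1 e with ⟨rfl, rfl⟩ | ⟨rfl, rfl⟩
        · exfalso
          have ha' : a' = b := by
            rcases e1 with e1 | e1 | e1
            · exact absurd (pair_injective_right e1) hab'
            · exact pair_injective_right e1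
            · rcases Finset.pair_eq_iff.1 e1 with ⟨e2, -⟩ | ⟨e2, -⟩
              · exact absurd e2 n1
              · exact absurd e2 n2
          subst ha'
          rcases r3 with ⟨y, hy, hy'⟩ | ⟨-, hy⟩
          · rcases hall _ hy with e2 | e2 | e2
            · have := pair_injective_right e2
              simp only [Fin.sbtw_iff] at hy'; omega
            · have := pair_injective_right e2
              simp only [Fin.sbtw_iff] at hy'; omega
            · rcases Finset.pair_eq_iff.1 e2 with ⟨e2, -⟩ | ⟨e2, -⟩
              · exact absurd e2 n1
              · exact absurd e2 n2
          · simp only [Fin.sbtw_iff] at hy q4; omega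
        · refine ⟨rfl, rfl, ?_⟩
          rcases e1 with e1 | e1 | e1
          · rw [Finset.pair_comm b' m'] at e1
            exact absurd (pair_injective_right e1) hab'
          · rcases Finset.pair_eq_iff.1 e1 with ⟨e2, -⟩ | ⟨e2, -⟩
            · exact absurd e2.symm n1
            · exact absurd e2 hab
          · exact pair_injective_right e1
      obtain ⟨rfl, rfl, rfl⟩ := hm
      have hs : sbtw b' m' a' := by simp only [Fin.sbtw_iff] at q4 ⊢; omega
      refine ⟨.centre {b', m', a'}, fun _ => by simp, ⟨hs, q3.1, rfl⟩, ⟨?_, ?_, ?_⟩, e⟩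
      · simp only [Fin.sbtw_iff] at q4 ⊢; omega
      · exact Finset.pair_comm b' a' ▸ q2.1
      · ext i; simp only [Finset.mem_insert, Finset.mem_singleton]; tauto

end

theorem symmDiff_pair {m a b : Fin n} (ha : m ≠ a) (hb : m ≠ b) (hab : a ≠ b) :
    symmDiff ({m, a} : Finset (Fin n)) {m, b} = {a, b} := by
  ext i
  simp only [Finset.mem_symmDiff, Finset.mem_insert, Finset.mem_singleton]
  constructor
  · tauto
  · rintro (rfl | rfl)
    · exact Or.inl ⟨Or.inr rfl, not_or.2 ⟨ha.symm, hab⟩⟩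
    · exact Or.inr ⟨Or.inr rfl, not_or.2 ⟨hb.symm, hab.symm⟩⟩

/-- The soliton graph of a generic contour plot without `X`-crossings is the graph of the
triangulation formed by its region labels. -/
noncomputable def GenericPlot.iso (h : GenericPlot κ (constTerm κ A t)) :
    DiskGraph.Iso (psiGraph (regionLabels κ (constTerm κ A t)) (wallPairs κ (constTerm κ A t)))
      (solitonGraph κ A t) where
  toEquiv := Equiv.ofBijective h.solitonDart ⟨h.solitonDart_injective, h.solitonDart_surjective⟩
  map_rev d := rfl
  map_next d d' := by
    refine or_congr ?_ (and_congr ?_ ?_)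
    · refine Iff.trans ?_ (h.next_iff d d').symm
      refine exists_congr fun p => and_congr (h.startsAt_solitonDart_iff d p)
        (and_congr (h.startsAt_solitonDart_iff d' p) ?_)
      exact Subtype.ext_iff
    · refine Iff.trans ?_ (h.starts_rayEnd_iff d).symm
      exact not_congr (exists_congr fun p => h.startsAt_solitonDart_iff d p)
    · exact h.solitonDart_injective.eq_iff
  map_black d := by
    refine Iff.trans ?_ (h.starts_centre_iff d).symm
    refine exists_congr fun p => ?_
    refine (and_congr_left' (h.startsAt_solitonDart_iff d p)).trans ?_
    constructor
    · rintro ⟨⟨h1, h2, ⟨x, h3, h4⟩ | ⟨h3, h4⟩⟩, hu⟩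
      · have : d.b ≠ x ∧ d.c ≠ x := by simp only [Fin.sbtw_iff] at h4; omega
        exact absurd hu (h.colours_white' d.ne this.1 this.2 h1 h2 h3).1
      · exact ⟨h1, h2, h3, h4⟩
    · rintro ⟨h1, h2, h3, h4⟩
      exact ⟨⟨h1, h2, Or.inr ⟨h3, h4⟩⟩, (h.colours_black' h1 h2 h3).1⟩
  map_white d := by
    refine Iff.trans ?_ (h.starts_node_iff d).symm
    refine exists_congr fun p => ?_
    refine (and_congr_left' (h.startsAt_solitonDart_iff d p)).trans ?_
    constructor
    · rintro ⟨⟨h1, h2, ⟨x, h3, h4⟩ | ⟨h3, h4⟩⟩, hu⟩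
      · exact ⟨x, h1, h2, h3, h4⟩
      · exact absurd hu (h.colours_black' h1 h2 h3).2
    · rintro ⟨x, h1, h2, h3, h4⟩
      have : d.b ≠ x ∧ d.c ≠ x := by simp only [Fin.sbtw_iff] at h4; omega
      exact ⟨⟨h1, h2, Or.inl ⟨x, h3, h4⟩⟩, (h.colours_white' d.ne this.1 this.2 h1 h2 h3).2⟩
  map_boundary d := by
    refine Iff.trans ?_ (h.starts_rayEnd_iff d).symm
    exact not_congr (exists_congr fun p => h.startsAt_solitonDart_iff d p)
  map_left d := rfl
  map_edgeLabel d := symmDiff_pair d.isWall.ne_left d.isWall.symm.ne_left d.ne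

theorem IsGenericParameter.distinctSums (hκ : IsGenericParameter 2 κ) : DistinctSums κ :=
  fun I J hI hJ => hκ.2 2 le_rfl le_rfl I J hI hJ

theorem IsGenericParameter.genericPlot (hn : 3 ≤ n) (hκ : IsGenericParameter 2 κ)
    (h : IsGenericWithoutXCrossings κ A t) : GenericPlot κ (constTerm κ A t) := by
  obtain ⟨h1, h2⟩ := (isGenericWithoutXCrossings_iff (le_of_lt hn) hκ.distinctSums).1 h
  exact ⟨hn, hκ.1, hκ.distinctSums, h1, h2⟩

theorem exists_psiGraph_of_isGenericWithoutXCrossings (hn : 3 ≤ n) (hκ : IsGenericParameter 2 κ)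
    (h : IsGenericWithoutXCrossings κ A t) :
    ∃ (T : Set (Finset (Fin n))) (τ : Fin n → Set (Finset (Fin n))),
      IsTriangulation Set.univ T ∧ IsResolution T τ ∧
        Nonempty (DiskGraph.Iso (solitonGraph κ A t) (psiGraph T τ)) :=
  have hg := hκ.genericPlot hn h
  ⟨_, _, hg.isTriangulation_regionLabels, hg.isTriangulation_wallPairs, ⟨hg.iso.symm⟩⟩

/-- This is what reduces the realization of T and τ to two inclusions. -/
theorem IsTriangulation.eq_of_subset {S : Set (Fin n)} {T T' : Set (Finset (Fin n))}
    (hT : IsTriangulation S T) (hT' : IsTriangulation S T') (h : T ⊆ T') : T = T' :=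
  h.antisymm fun e he => hT.2.2 e (hT'.1 e he).1 (hT'.1 e he).2 fun f hf => hT'.2.1 e he f (h hf)

/-- A generic contour plot has the soliton graph of `T` and `τ` if its regions are labelled by
elements of `T` and its walls by elements of `τ`. -/
theorem nonempty_iso_of_subset (hn : 3 ≤ n) (hκ : IsGenericParameter 2 κ)
    {T : Set (Finset (Fin n))} {τ : Fin n → Set (Finset (Fin n))} (hT : IsTriangulation Set.univ T)
    (hτ : IsResolution T τ) (h : IsGenericWithoutXCrossings κ A t)
    (h1 : regionLabels κ (constTerm κ A t) ⊆ T)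
    (h2 : ∀ m a b, IsWall κ (constTerm κ A t) m a b → {a, b} ∈ τ m) :
    Nonempty (DiskGraph.Iso (solitonGraph κ A t) (psiGraph T τ)) := by
  have hg := hκ.genericPlot hn h
  have e1 := hg.isTriangulation_regionLabels.eq_of_subset hT h1
  have e2 : wallPairs κ (constTerm κ A t) = τ := by
    funext m
    refine (hg.isTriangulation_wallPairs m).eq_of_subset (e1 ▸ hτ m) ?_
    rintro e ⟨a, b, rfl, hw⟩
    exact h2 m a b hw
  rw [← e1, ← e2]
  exact ⟨hg.iso.symm⟩

end GraphIso

/-! ### Choosing data along the tree of triangles. -/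

section Gluing

variable {n : ℕ} {T : Set (Finset (Fin n))}

theorem IsTriangulation.not_crossing (hT : IsTriangulation Set.univ T) {a b c d : Fin n}
    (hac : {a, c} ∈ T) (hbd : {b, d} ∈ T) (h1 : a < b) (h2 : b < c) (h3 : c < d) : False :=
  hT.2.1 _ hac _ hbd ⟨a, b, c, d, h1, h2, h3, Or.inl ⟨rfl, rfl⟩⟩

/-- Data at the vertices of a triangulated polygon can be chosen successively, starting with a side
and choosing in each triangle the data of the third vertex. -/
theorem IsTriangulation.exists_gluing (hT : IsTriangulation Set.univ T) (hn : 2 ≤ n) {X : Type*}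
    (E : Fin n → Fin n → X → X → Prop) (F : Fin n → Fin n → Fin n → X → X → X → Prop)
    (hroot : ∀ a b, a < b → ∃ xa xb, E a b xa xb)
    (hstep : ∀ a b c xa xc, a < b → b < c → E a c xa xc →
      ∃ xb, E a b xa xb ∧ E b c xb xc ∧ F a b c xa xb xc) :
    ∃ x : Fin n → X, (∀ a b, a < b → {a, b} ∈ T → E a b (x a) (x b)) ∧
      ∀ a b c, a < b → b < c → {a, b} ∈ T → {b, c} ∈ T → {a, c} ∈ T →
        F a b c (x a) (x b) (x c) := by
  -- The data at a and c are given and those in between are to be filled in. The triangle on {a,c}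
  -- supplies the datum at its apex b, and the parts from a to b and from b to c are independent.
  have key : ∀ N : ℕ, ∀ a c : Fin n, a < c → c.1 - a.1 ≤ N → {a, c} ∈ T → ∀ xa xc, E a c xa xc →
      ∃ x : Fin n → X, x a = xa ∧ x c = xc ∧
        (∀ i j, a ≤ i → i < j → j ≤ c → {i, j} ∈ T → E i j (x i) (x j)) ∧
        ∀ i j k, a ≤ i → i < j → j < k → k ≤ c → {i, j} ∈ T → {j, k} ∈ T → {i, k} ∈ T →
          F i j k (x i) (x j) (x k) := by
    intro N
    induction N with
    | zero => intro a c hac hN; omega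
    | succ N ih =>
      intro a c hac hN hT' xa xc hE
      by_cases hex : ∃ x, sbtw a x c
      · obtain ⟨b, hb, hab, hbc⟩ := hT.exists_apex hT' hex
        have hb' : a < b ∧ b < c := by simp only [Fin.sbtw_iff] at hb; omega
        obtain ⟨h1, h2⟩ := hb'
        obtain ⟨xb, e1, e2, e3⟩ := hstep a b c xa xc h1 h2 hE
        obtain ⟨y, ya, yb, yE, yF⟩ := ih a b h1 (by omega) hab xa xb e1
        obtain ⟨z, zb, zc, zE, zF⟩ := ih b c h2 (by omega) hbc xb xc e2
        -- Since {a,b} and {b,c} are edges, no edge other than {a,c} passes over b.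
        have hsplit : ∀ i j, a ≤ i → i < j → j ≤ c → {i, j} ∈ T → (i = a ∧ j = c) ∨ j ≤ b ∨ b ≤ i := by
          intro i j hi hij hj hm
          by_contra hcon
          push Not at hcon
          obtain ⟨k1, k2, k3⟩ := hcon
          by_cases hia : i = a
          · subst hia
            exact hT.not_crossing hm hbc k3 k2 (lt_of_le_of_ne hj (k1 rfl))
          · exact hT.not_crossing hab hm (lt_of_le_of_ne hi (Ne.symm hia)) k3 k2
        obtain ⟨w, ey, ez⟩ : ∃ w : Fin n → X, (∀ i, i ≤ b → w i = y i) ∧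
            ∀ i, b ≤ i → w i = z i := by
          refine ⟨fun i => if i ≤ b then y i else z i, fun i hi => if_pos hi, fun i hi => ?_⟩
          rcases hi.eq_or_lt with rfl | hlt
          · exact (if_pos le_rfl).trans (yb.trans zb.symm)
          · exact if_neg (not_le.2 hlt)
        refine ⟨w, (ey a h1.le).trans ya, (ez c h2.le).trans zc, ?_, ?_⟩
        · intro i j hi hij hj hm
          rcases hsplit i j hi hij hj hm with ⟨rfl, rfl⟩ | h | h
          · rwa [ey i h1.le, ez j h2.le, ya, zc]
          · rw [ey i (hij.le.trans h), ey j h]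
            exact yE i j hi hij h hm
          · rw [ez i h, ez j (h.trans hij.le)]
            exact zE i j h hij hj hm
        · intro i j k hi hij hjk hk m1 m2 m3
          rcases hsplit i k hi (hij.trans hjk) hk m3 with ⟨rfl, rfl⟩ | h | h
          · obtain rfl : j = b := by
              rcases lt_trichotomy j b with h | h | h
              · exact (hT.not_crossing hab m2 hij h h2).elim
              · exact h
              · exact (hT.not_crossing m1 hbc h1 h hjk).elim
            rwa [ey i h1.le, ey j le_rfl, ez k h2.le, ya, yb, zc]
          · rw [ey i ((hij.trans hjk).le.trans h), ey j (hjk.le.trans h), ey k h]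
            exact yF i j k hi hij hjk h m1 m2 m3
          · rw [ez i h, ez j (h.trans hij.le), ez k (h.trans (hij.trans hjk).le)]
            exact zF i j k h hij hjk hk m1 m2 m3
      · push Not at hex
        have hno : ∀ x : Fin n, ¬ (a < x ∧ x < c) := fun x hx => hex x (by
          simp only [Fin.sbtw_iff]; omega)
        refine ⟨fun i => if i = a then xa else xc, by simp, by simp [hac.ne'], ?_, ?_⟩
        · intro i j hi hij hj _
          have e1 := hno i
          have e2 := hno j
          obtain rfl : i = a := by omega
          obtain rfl : j = c := by omega
          simpa [hij.ne'] using hE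
        · intro i j k hi hij hjk hk _ _ _
          exact absurd ⟨lt_of_le_of_lt hi hij, lt_of_lt_of_le hjk hk⟩ (hno j)
  have h0 : (⟨0, by omega⟩ : Fin n) < ⟨n - 1, by omega⟩ := by
    simp only [Fin.lt_def]; omega
  have hside : ({⟨0, by omega⟩, ⟨n - 1, by omega⟩} : Finset (Fin n)) ∈ T := by
    rw [Finset.pair_comm]
    refine hT.side_mem h0.ne' fun x => ?_
    have := x.2
    simp only [Fin.sbtw_iff, Fin.lt_def]
    omega
  obtain ⟨xa, xc, hE⟩ := hroot _ _ h0
  obtain ⟨x, -, -, h1, h2⟩ := key _ _ _ h0 le_rfl hside xa xc hE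
  have hlo : ∀ i : Fin n, (⟨0, by omega⟩ : Fin n) ≤ i := fun i => by simp [Fin.le_def]
  have hhi : ∀ i : Fin n, i ≤ (⟨n - 1, by omega⟩ : Fin n) := fun i => by
    have := i.2
    simp only [Fin.le_def]; omega
  exact ⟨x, fun a b hab hm => h1 a b (hlo a) hab (hhi b) hm,
    fun a b c hab hbc => h2 a b c (hlo a) hab hbc (hhi c)⟩

end Gluing

/-! ### Interpolation by quadratic polynomials. -/

section CoarseData

/-- The quadratic polynomial with the coefficients `q`. -/
def quadEval (q : ℝ × ℝ × ℝ) (x : ℝ) : ℝ := q.1 + q.2.1 * x + q.2.2 * x ^ 2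

/-- Newton interpolation; `d1` and `d2` are the divided differences. -/
theorem exists_quadEval_eq {a b c : ℝ} (hab : a < b) (hbc : b < c) (u v w : ℝ) :
    ∃ q, quadEval q a = u ∧ quadEval q b = v ∧ quadEval q c = w := by
  have h1 : b - a ≠ 0 := (sub_pos.2 hab).ne'
  have h2 : c - b ≠ 0 := (sub_pos.2 hbc).ne'
  have h3 : c - a ≠ 0 := (sub_pos.2 (hab.trans hbc)).ne'
  set d1 := (v - u) / (b - a) with hd1
  set d2 := ((w - u) / (c - a) - d1) / (c - b) with hd2
  refine ⟨(u - d1 * a + d2 * a * b, d1 - d2 * (a + b), d2), ?_, ?_, ?_⟩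
  · unfold quadEval; ring
  · unfold quadEval
    have : d1 * (b - a) = v - u := by rw [hd1]; field_simp
    linear_combination this
  · unfold quadEval
    have : (d1 + d2 * (c - b)) * (c - a) = w - u := by rw [hd2]; field_simp; ring
    linear_combination this

/-- The increments of a quadratic polynomial with prescribed values. -/
theorem quadEval_strictly_between {q : ℝ × ℝ × ℝ} {a b c σ s : ℝ} (hab : a < b) (hbc : b < c)
    (hσ : 0 < σ) (hs : 0 < s) (h1 : quadEval q b - quadEval q a = σ + s)
    (h2 : quadEval q c - quadEval q a = σ) (h3 : s * (b - a) ^ 2 ≤ σ * (c - b) ^ 2) {x : ℝ}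
    (hax : a < x) (hxb : x < b) : quadEval q a < quadEval q x ∧ quadEval q x < quadEval q b := by
  unfold quadEval at *
  obtain ⟨q0, q1, q2⟩ := q
  simp only at *
  have hp : 0 < b - a := sub_pos.2 hab
  have hr : 0 < c - b := sub_pos.2 hbc
  have e1 : (b - a) * (q1 + q2 * (a + b)) = σ + s := by linear_combination h1
  have e2 : (c - a) * (q1 + q2 * (a + c)) = σ := by linear_combination h2
  -- The mean slope on [a,b] is positive, the polynomial is concave, and `hD3` is the positivity of
  -- its derivative at b. So it increases on [a,b].
  have hD1 : 0 < q1 + q2 * (a + b) := by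
    by_contra hcon
    push Not at hcon
    nlinarith
  have hD2 : q2 < 0 := by
    by_contra hcon
    push Not at hcon
    nlinarith [mul_nonneg hcon hr.le, mul_nonneg (mul_nonneg hcon hr.le) hp.le,
      mul_nonneg (mul_nonneg hcon hr.le) hr.le, mul_pos hr hD1]
  have hD3 : 0 < q1 + q2 * (a + b) + q2 * (b - a) := by
    have e3 : (b - a) * (c - b) * (c - a) * (q1 + q2 * (a + b) + q2 * (b - a)) =
        (σ + s) * (c - b) ^ 2 - s * (b - a) ^ 2 + 0 := by
      have e4 : (c - b) * (c - a) * q2 * (b - a) = σ * (b - a) - (σ + s) * (c - a) := by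
        linear_combination (b - a) * e2 - (c - a) * e1
      linear_combination (b - a) * e4 + (c - b) * (c - a) * e1
    have e5 : 0 < (σ + s) * (c - b) ^ 2 - s * (b - a) ^ 2 + 0 := by
      nlinarith [mul_pos hs (pow_pos hr 2)]
    rw [← e3] at e5
    have : 0 < (b - a) * (c - b) * (c - a) := mul_pos (mul_pos hp hr) (by linarith)
    exact (mul_pos_iff_of_pos_left this).1 e5
  constructor
  · have : 0 < (x - a) * (q1 + q2 * (a + b) + q2 * (x - b)) :=
      mul_pos (sub_pos.2 hax) (by nlinarith)
    nlinarith
  · have : 0 < (b - x) * (q1 + q2 * (a + b) + q2 * (x - a)) :=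
      mul_pos (sub_pos.2 hxb) (by nlinarith)
    nlinarith

end CoarseData

/-! ### Acute levels, symmetric corrections and prescribed minors. -/

section CoarseData

variable {n : ℕ} {T : Set (Finset (Fin n))} {κ : Fin n → ℝ}

theorem quadEval_sub (p q : ℝ × ℝ × ℝ) (x : ℝ) :
    quadEval (p - q) x = quadEval p x - quadEval q x := by
  simp only [quadEval, Prod.fst_sub, Prod.snd_sub]
  ring

/-- The third quadratic polynomial of a triangle. -/
theorem exists_acute_step {a b c : ℝ} (hab : a < b) (hbc : b < c) {p r : ℝ × ℝ × ℝ}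
    (hpr : quadEval p c = quadEval r a)
    (h : ∀ x, a < x → x < c → quadEval p a - quadEval r a < quadEval p x - quadEval r x ∧
      quadEval p x - quadEval r x < quadEval p c - quadEval r c) :
    ∃ q, quadEval q a = quadEval p b ∧ quadEval q c = quadEval r b ∧
      0 < quadEval q a + quadEval q c - quadEval q b - quadEval p c ∧
      (∀ x, a < x → x < b → quadEval p a - quadEval q a < quadEval p x - quadEval q x ∧
        quadEval p x - quadEval q x < quadEval p b - quadEval q b) ∧
      (∀ x, b < x → x < c → quadEval q b - quadEval r b < quadEval q x - quadEval r x ∧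
        quadEval q x - quadEval r x < quadEval q c - quadEval r c) := by
  -- The numbers `σa` and `σc` are the acuteness at the corners a and c; the hypothesis on p - r
  -- makes them positive.
  obtain ⟨h1, h2⟩ := h b hab hbc
  have hp : 0 < b - a := sub_pos.2 hab
  have hr : 0 < c - b := sub_pos.2 hbc
  set σa := quadEval p b - quadEval r b - (quadEval p a - quadEval r a) with hσa
  set σc := quadEval p c - quadEval r c - (quadEval p b - quadEval r b) with hσc
  have ha : 0 < σa := by linarith
  have hc : 0 < σc := by linarith
  -- `s` will be the acuteness at b. It is small enough for `quadEval_strictly_between` to apply to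
  -- p - q and to q - r, so that both new edges inherit the hypothesis.
  set s := min (σa * (c - b) ^ 2 / (b - a) ^ 2) (σc * (b - a) ^ 2 / (c - b) ^ 2) with hs
  have hspos : 0 < s := lt_min (by positivity) (by positivity)
  have hs1 : s * (b - a) ^ 2 ≤ σa * (c - b) ^ 2 := by
    rw [← le_div_iff₀ (by positivity)]; exact min_le_left _ _
  have hs2 : s * (c - b) ^ 2 ≤ σc * (b - a) ^ 2 := by
    rw [← le_div_iff₀ (by positivity)]; exact min_le_right _ _
  -- The values at a and c are forced by agreement along the edges; the value at b produces the
  -- acuteness `s`.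
  obtain ⟨q, qa, qb, qc⟩ := exists_quadEval_eq hab hbc (quadEval p b)
    (quadEval p b + quadEval r b - quadEval p c - s) (quadEval r b)
  refine ⟨q, qa, qc, by rw [qa, qb, qc]; linarith, fun x hax hxb => ?_, fun x hbx hxc => ?_⟩
  · have := quadEval_strictly_between (q := p - q) (σ := σa) (s := s) hab hbc ha hspos
      (by rw [quadEval_sub, quadEval_sub, qa, qb]; linarith)
      (by rw [quadEval_sub, quadEval_sub, qa, qc]; linarith) hs1 hax hxb
    simpa only [quadEval_sub] using this
  · have hrefl : ∀ x, quadEval (r.1 - q.1, q.2.1 - r.2.1, r.2.2 - q.2.2) (-x) =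
        quadEval r x - quadEval q x := by
      intro x; simp only [quadEval]; ring
    have := quadEval_strictly_between (q := (r.1 - q.1, q.2.1 - r.2.1, r.2.2 - q.2.2))
      (a := -c) (b := -b) (c := -a) (σ := σc) (s := s) (x := -x) (by linarith) (by linarith) hc hspos
      (by rw [hrefl, hrefl, qb, qc]; linarith)
      (by rw [hrefl, hrefl, qa, qc]; linarith)
      (by rw [neg_sub_neg, neg_sub_neg]; exact hs2) (by linarith) (by linarith)
    rw [hrefl, hrefl, hrefl] at this
    constructor <;> linarith [this.1, this.2]

/-- Quadratic polynomials at the vertices which agree along the edges and for which each triangle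
is acute. -/
theorem IsTriangulation.exists_acute (hT : IsTriangulation Set.univ T) (hn : 2 ≤ n)
    (hκ : StrictMono κ) : ∃ q : Fin n → ℝ × ℝ × ℝ,
      (∀ a b, {a, b} ∈ T → quadEval (q a) (κ b) = quadEval (q b) (κ a)) ∧
      ∀ a b c, a ≠ b → b ≠ c → a ≠ c → {a, b} ∈ T → {b, c} ∈ T → {a, c} ∈ T →
        0 < quadEval (q a) (κ b) + quadEval (q a) (κ c) - quadEval (q a) (κ a) -
          quadEval (q b) (κ c) := by
  obtain ⟨q, hE, hF⟩ := hT.exists_gluing hn (X := ℝ × ℝ × ℝ)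
    (fun a c p r => quadEval p (κ c) = quadEval r (κ a) ∧ ∀ x, κ a < x → x < κ c →
      quadEval p (κ a) - quadEval r (κ a) < quadEval p x - quadEval r x ∧
      quadEval p x - quadEval r x < quadEval p (κ c) - quadEval r (κ c))
    (fun a b c p q r =>
      0 < quadEval p (κ b) + quadEval p (κ c) - quadEval p (κ a) - quadEval r (κ b) ∧
      0 < quadEval q (κ a) + quadEval q (κ c) - quadEval q (κ b) - quadEval p (κ c) ∧
      0 < quadEval r (κ a) + quadEval r (κ b) - quadEval r (κ c) - quadEval p (κ b))
    -- On the first side p - r is x - κ a, which is increasing.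
    (fun a b _ => ⟨(0, 0, 0), (κ a, -1, 0), by simp [quadEval], fun x h1 h2 => by
      simp only [quadEval]; constructor <;> linarith⟩)
    (fun a b c p r hab hbc ⟨h1, h2⟩ => by
      obtain ⟨q, e1, e2, e3, e4, e5⟩ := exists_acute_step (hκ hab) (hκ hbc) h1 h2
      have := h2 (κ b) (hκ hab) (hκ hbc)
      exact ⟨q, ⟨e1.symm, e4⟩, ⟨e2, e5⟩, by linarith, e3, by linarith⟩)
  have hsym : ∀ a b, {a, b} ∈ T → quadEval (q a) (κ b) = quadEval (q b) (κ a) := by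
    intro a b hab
    rcases lt_trichotomy a b with h | rfl | h
    · exact (hE a b h hab).1
    · rfl
    · exact (hE b a h (Finset.pair_comm a b ▸ hab)).1.symm
  refine ⟨q, hsym, fun a b c n1 n2 n3 hab hbc hac => ?_⟩
  have hba := Finset.pair_comm a b ▸ hab
  have hcb := Finset.pair_comm b c ▸ hbc
  have hca := Finset.pair_comm a c ▸ hac
  have s1 := hsym _ _ hab
  have s2 := hsym _ _ hbc
  have s3 := hsym _ _ hac
  rcases lt_or_gt_of_ne n1 with k1 | k1 <;> rcases lt_or_gt_of_ne n2 with k2 | k2 <;>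
    rcases lt_or_gt_of_ne n3 with k3 | k3
  · have := (hF a b c k1 k2 hab hbc hac).1; linarith
  · omega
  · have := (hF a c b k3 k2 hac hcb hab).1; linarith
  · have := (hF c a b k3 k1 hca hab hcb).2.1; linarith
  · have := (hF b a c k1 k3 hba hac hbc).2.1; linarith
  · have := (hF b c a k2 k3 hbc hca hba).2.2; linarith
  · omega
  · have := (hF c b a k2 k1 hcb hba hca).2.2; linarith

/-- Functions on the edges can be made symmetric by adding quadratic polynomials. -/
theorem IsTriangulation.exists_symmetrizing (hT : IsTriangulation Set.univ T) (hn : 2 ≤ n)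
    (hκ : StrictMono κ) (f : Fin n → Fin n → ℝ) : ∃ r : Fin n → ℝ × ℝ × ℝ,
      ∀ a b, {a, b} ∈ T → f a b + quadEval (r a) (κ b) = f b a + quadEval (r b) (κ a) := by
  obtain ⟨r, hE, -⟩ := hT.exists_gluing hn (X := ℝ × ℝ × ℝ)
    (fun a b p q => f a b + quadEval p (κ b) = f b a + quadEval q (κ a)) (fun _ _ _ _ _ _ => True)
    (fun a b _ => ⟨(0, 0, 0), (f a b - f b a, 0, 0), by simp [quadEval]⟩)
    (fun a b c p q hab hbc _ => by
      -- Two values are forced by the edges; the value 0 at b is arbitrary.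
      obtain ⟨r, e1, -, e2⟩ := exists_quadEval_eq (hκ hab) (hκ hbc)
        (f a b + quadEval p (κ b) - f b a) 0 (f c b + quadEval q (κ b) - f b c)
      exact ⟨r, by rw [e1]; ring, by rw [e2]; ring, trivial⟩)
  refine ⟨r, fun a b hab => ?_⟩
  rcases lt_trichotomy a b with h | rfl | h
  · exact hE a b h hab
  · rfl
  · exact (hE b a h (Finset.pair_comm a b ▸ hab)).symm

/-- The minors of a `2 × n` matrix with the columns `v`, made symmetric. -/
def symMinor (v : Fin n → ℝ × ℝ) (a b : Fin n) : ℝ :=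
  if a < b then (v a).1 * (v b).2 - (v b).1 * (v a).2 else (v b).1 * (v a).2 - (v a).1 * (v b).2

theorem symMinor_of_lt (v : Fin n → ℝ × ℝ) {a b : Fin n} (h : a < b) :
    symMinor v a b = (v a).1 * (v b).2 - (v b).1 * (v a).2 := if_pos h

theorem symMinor_comm (v : Fin n → ℝ × ℝ) (a b : Fin n) : symMinor v a b = symMinor v b a := by
  rcases lt_trichotomy a b with h | rfl | h
  · rw [symMinor, symMinor, if_pos h, if_neg h.not_gt]
  · rfl
  · rw [symMinor, symMinor, if_pos h, if_neg h.not_gt]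

/-- The minors on the edges of a triangulation can be prescribed. -/
theorem IsTriangulation.exists_columns (hT : IsTriangulation Set.univ T) (hn : 2 ≤ n)
    (δ : Fin n → Fin n → ℝ) (hδ : ∀ a b, 0 < δ a b) : ∃ v : Fin n → ℝ × ℝ,
      ∀ a b, a < b → {a, b} ∈ T → symMinor v a b = δ a b := by
  obtain ⟨v, hE, -⟩ := hT.exists_gluing hn (X := ℝ × ℝ)
    (fun a b p q => p.1 * q.2 - q.1 * p.2 = δ a b) (fun _ _ _ _ _ _ => True)
    (fun a b _ => ⟨(1, 0), (0, δ a b), by simp⟩)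
    (fun a b c p q hab hbc h => by
      have hne := (hδ a c).ne'
      -- Cramer's rule: the new column is determined by its minors with the two given ones.
      refine ⟨((δ a b * q.1 + δ b c * p.1) / δ a c, (δ a b * q.2 + δ b c * p.2) / δ a c), ?_, ?_,
        trivial⟩
      · simp only
        field_simp
        linear_combination (δ a b) * h
      · simp only
        field_simp
        linear_combination (δ b c) * h)
  exact ⟨v, fun a b hab hm => (symMinor_of_lt v hab).trans (hE a b hab hm)⟩

/-- The Plücker relation for two crossing chords. -/
theorem symMinor_plucker (v : Fin n → ℝ × ℝ) {a b c d : Fin n}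
    (h : Crosses ({a, c} : Finset (Fin n)) {b, d}) : symMinor v a c * symMinor v b d =
      symMinor v a b * symMinor v c d + symMinor v b c * symMinor v a d := by
  have key : ∀ a b c d : Fin n, a < b → b < c → c < d → symMinor v a c * symMinor v b d =
      symMinor v a b * symMinor v c d + symMinor v b c * symMinor v a d := by
    intro a b c d h1 h2 h3
    rw [symMinor_of_lt v h1, symMinor_of_lt v h2, symMinor_of_lt v h3,
      symMinor_of_lt v (h1.trans h2), symMinor_of_lt v (h2.trans h3),
      symMinor_of_lt v ((h1.trans h2).trans h3)]
    ring
  have hc := symMinor_comm v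
  obtain ⟨x, y, z, w, h1, h2, h3, ⟨h4, h5⟩ | ⟨h4, h5⟩⟩ := h <;>
    have := key x y z w h1 h2 h3 <;>
    rcases Finset.pair_eq_iff.1 h4 with ⟨rfl, rfl⟩ | ⟨rfl, rfl⟩ <;>
    rcases Finset.pair_eq_iff.1 h5 with ⟨rfl, rfl⟩ | ⟨rfl, rfl⟩ <;>
    (try simp only [hc b a, hc c a, hc d a, hc c b, hc d b, hc d c] at this ⊢) <;>
    linear_combination this

end CoarseData

/-! ### Growth rates of minors and tropical Plücker relations. -/

section Tropical

variable {n : ℕ} {T : Set (Finset (Fin n))}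

/-- A property of pairs of vertices holds for all pairs if it holds for the edges of a triangulation
and can be transferred along the Plücker relations. -/
theorem IsTriangulation.pair_induction (hT : IsTriangulation Set.univ T) {G : Fin n → Fin n → Prop}
    (hsymm : ∀ a b, G a b → G b a) (hedge : ∀ a b, a ≠ b → {a, b} ∈ T → G a b)
    (hstep : ∀ i j a b, Crosses ({i, j} : Finset (Fin n)) {a, b} → G i a → G i b → G j a → G j b →
      G a b → G i j) : ∀ i j, i ≠ j → G i j := by
  have key : ∀ N : ℕ, ∀ α β : Fin n, α < β → β.1 - α.1 ≤ N → {α, β} ∈ T → ∀ i j, α ≤ i → i < j →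
      j ≤ β → G i j := by
    intro N
    induction N with
    | zero => intro α β h hN; omega
    | succ N ih =>
      intro α β hαβ hN hm i j hi hij hj
      by_cases hends : i = α ∧ j = β
      · obtain ⟨rfl, rfl⟩ := hends
        exact hedge i j hij.ne hm
      have hex : ∃ x, sbtw α x β := by
        by_cases hia : i = α
        · exact ⟨j, by simp only [Fin.sbtw_iff]; omega⟩
        · exact ⟨i, by simp only [Fin.sbtw_iff]; omega⟩
      obtain ⟨γ, hγ, hαγ, hγβ⟩ := hT.exists_apex hm hex
      obtain ⟨h1, h2⟩ : α < γ ∧ γ < β := by simp only [Fin.sbtw_iff] at hγ; omega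
      have ihl := ih α γ h1 (by omega) hαγ
      have ihr := ih γ β h2 (by omega) hγβ
      have hG1 := hedge _ _ h1.ne hαγ
      have hG2 := hedge _ _ h2.ne hγβ
      have hG3 := hedge _ _ hαβ.ne hm
      -- Chords from α first, which cross the edge {γ,β}; the remaining mixed chords then cross
      -- {α,γ}.
      have hα : ∀ y, γ < y → y ≤ β → G α y := by
        intro y hy hyβ
        by_cases hyb : y = β
        · rwa [hyb]
        · have hlt := lt_of_le_of_ne hyβ hyb
          exact hstep α y γ β ⟨α, γ, y, β, h1, hy, hlt, Or.inl ⟨rfl, rfl⟩⟩ hG1 hG3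
            (hsymm _ _ (ihr γ y le_rfl hy hyβ)) (ihr y β hy.le hlt le_rfl) hG2
      by_cases c1 : j ≤ γ
      · exact ihl i j hi hij c1
      by_cases c2 : γ ≤ i
      · exact ihr i j c2 hij hj
      push Not at c1 c2
      by_cases hia : i = α
      · rw [hia]; exact hα j c1 hj
      · have hlt := lt_of_le_of_ne hi (Ne.symm hia)
        exact hstep i j α γ ⟨α, i, γ, j, hlt, c2, c1, Or.inr ⟨rfl, rfl⟩⟩
          (hsymm _ _ (ihl α i le_rfl hlt c2.le)) (ihl i γ hi c2 le_rfl) (hsymm _ _ (hα j c1 hj))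
          (hsymm _ _ (ihr γ j le_rfl c1 hj)) hG1
  have key2 : ∀ i j, i < j → G i j := by
    intro i j hij
    have hn : 2 ≤ n := by omega
    have h0 : (⟨0, by omega⟩ : Fin n) < ⟨n - 1, by omega⟩ := by
      simp only [Fin.lt_def]; omega
    have hside : ({⟨0, by omega⟩, ⟨n - 1, by omega⟩} : Finset (Fin n)) ∈ T := by
      rw [Finset.pair_comm]
      refine hT.side_mem h0.ne' fun x => ?_
      have := x.2
      simp only [Fin.sbtw_iff, Fin.lt_def]
      omega
    exact key _ _ _ h0 le_rfl hside i j (by simp [Fin.le_def]) hij (by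
      have := j.2
      simp only [Fin.le_def]; omega)
  intro i j hij
  rcases lt_or_gt_of_ne hij with h | h
  · exact key2 i j h
  · exact hsymm _ _ (key2 j i h)

/-- The function `f` grows like `exp (M * d)`. -/
def ExpGrowth (f : ℝ → ℝ) (d : ℝ) : Prop :=
  ∃ C, ∀ M, 0 ≤ M → Real.exp (M * d - C) ≤ f M ∧ f M ≤ Real.exp (M * d + C)

theorem ExpGrowth.pos {f : ℝ → ℝ} {d : ℝ} (h : ExpGrowth f d) {M : ℝ} (hM : 0 ≤ M) : 0 < f M := by
  obtain ⟨C, hC⟩ := h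
  exact (Real.exp_pos _).trans_le (hC M hM).1

theorem ExpGrowth.mul {f g : ℝ → ℝ} {d e : ℝ} (hf : ExpGrowth f d) (hg : ExpGrowth g e) :
    ExpGrowth (fun M => f M * g M) (d + e) := by
  have hf0 := fun M (hM : 0 ≤ M) => hf.pos hM
  have hg0 := fun M (hM : 0 ≤ M) => hg.pos hM
  obtain ⟨C, hC⟩ := hf
  obtain ⟨D, hD⟩ := hg
  refine ⟨C + D, fun M hM => ⟨?_, ?_⟩⟩
  · have : M * (d + e) - (C + D) = (M * d - C) + (M * e - D) := by ring
    rw [this, Real.exp_add]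
    exact mul_le_mul (hC M hM).1 (hD M hM).1 (Real.exp_pos _).le (hf0 M hM).le
  · have : M * (d + e) + (C + D) = (M * d + C) + (M * e + D) := by ring
    rw [this, Real.exp_add]
    exact mul_le_mul (hC M hM).2 (hD M hM).2 (hg0 M hM).le (Real.exp_pos _).le

theorem ExpGrowth.add {f g : ℝ → ℝ} {d e : ℝ} (hf : ExpGrowth f d) (hg : ExpGrowth g e) :
    ExpGrowth (fun M => f M + g M) (max d e) := by
  have hf0 := fun M (hM : 0 ≤ M) => hf.pos hM
  have hg0 := fun M (hM : 0 ≤ M) => hg.pos hM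
  obtain ⟨C, hC⟩ := hf
  obtain ⟨D, hD⟩ := hg
  refine ⟨max C D + Real.log 2, fun M hM => ⟨?_, ?_⟩⟩
  · have hl : 0 ≤ Real.log 2 := Real.log_nonneg (by norm_num)
    have h1 := hf0 M hM
    have h2 := hg0 M hM
    rcases le_total d e with h | h
    · rw [max_eq_right h]
      have := (hD M hM).1
      have : Real.exp (M * e - (max C D + Real.log 2)) ≤ Real.exp (M * e - D) :=
        Real.exp_le_exp.2 (by linarith [le_max_right C D])
      linarith
    · rw [max_eq_left h]
      have := (hC M hM).1
      have : Real.exp (M * d - (max C D + Real.log 2)) ≤ Real.exp (M * d - C) :=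
        Real.exp_le_exp.2 (by linarith [le_max_left C D])
      linarith
  · have h1 : f M ≤ Real.exp (M * max d e + max C D) := (hC M hM).2.trans (Real.exp_le_exp.2
      (add_le_add (mul_le_mul_of_nonneg_left (le_max_left _ _) hM) (le_max_left _ _)))
    have h2 : g M ≤ Real.exp (M * max d e + max C D) := (hD M hM).2.trans (Real.exp_le_exp.2
      (add_le_add (mul_le_mul_of_nonneg_left (le_max_right _ _) hM) (le_max_right _ _)))
    rw [← add_assoc, Real.exp_add, Real.exp_log (by norm_num)]
    linarith

/-- Solving a Plücker relation for one of its minors requires division. -/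
theorem ExpGrowth.of_mul {f g : ℝ → ℝ} {d e : ℝ} (hg : ExpGrowth g e)
    (hfg : ExpGrowth (fun M => f M * g M) d) : ExpGrowth f (d - e) := by
  obtain ⟨C, hC⟩ := hfg
  obtain ⟨D, hD⟩ := hg
  refine ⟨C + D, fun M hM => ⟨?_, ?_⟩⟩
  · have h1 := (hC M hM).1
    have h2 := (hD M hM).2
    have h3 := (Real.exp_pos (M * d - C)).trans_le h1
    have hg := (Real.exp_pos (M * e - D)).trans_le (hD M hM).1
    have hf : 0 < f M := (mul_pos_iff_of_pos_right hg).1 h3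
    have h4 : Real.exp (M * d - C) ≤ f M * Real.exp (M * e + D) :=
      h1.trans (mul_le_mul_of_nonneg_left h2 hf.le)
    have : M * d - C = (M * (d - e) - (C + D)) + (M * e + D) := by ring
    rw [this, Real.exp_add] at h4
    exact le_of_mul_le_mul_right h4 (Real.exp_pos _)
  · have h1 := (hC M hM).2
    have h2 := (hD M hM).1
    have h3 := (Real.exp_pos (M * d - C)).trans_le (hC M hM).1
    have hg := (Real.exp_pos (M * e - D)).trans_le h2
    have hf : 0 < f M := (mul_pos_iff_of_pos_right hg).1 h3
    have h4 : f M * Real.exp (M * e - D) ≤ Real.exp (M * d + C) :=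
      (mul_le_mul_of_nonneg_left h2 hf.le).trans h1
    have : M * d + C = (M * (d - e) + (C + D)) + (M * e - D) := by ring
    rw [this, Real.exp_add] at h4
    exact le_of_mul_le_mul_right h4 (Real.exp_pos _)

theorem ExpGrowth.unique {f : ℝ → ℝ} {d e : ℝ} (h : ExpGrowth f d) (h' : ExpGrowth f e) : d = e := by
  have key : ∀ {d e : ℝ}, ExpGrowth f d → ExpGrowth f e → d ≤ e := by
    rintro d e ⟨C, hC⟩ ⟨D, hD⟩
    by_contra hcon
    push Not at hcon
    -- At this M the difference of the exponents outweighs the constants C + D.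
    have hM : 0 ≤ (|C| + |D| + 1) / (d - e) :=
      div_nonneg (by positivity) (sub_pos.2 hcon).le
    have := Real.exp_le_exp.1 ((hC _ hM).1.trans (hD _ hM).2)
    have h2 : (|C| + |D| + 1) / (d - e) * (d - e) = |C| + |D| + 1 :=
      div_mul_cancel₀ _ (sub_pos.2 hcon).ne'
    have h3 : (|C| + |D| + 1) / (d - e) * (d - e) ≤ C + D := by linarith
    linarith [le_abs_self C, le_abs_self D]
  exact le_antisymm (key h h') (key h' h)

theorem expGrowth_exp (d g : ℝ) : ExpGrowth (fun M => Real.exp (M * d + g)) d :=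
  ⟨|g|, fun M _ => ⟨Real.exp_le_exp.2 (by linarith [neg_abs_le g]),
    Real.exp_le_exp.2 (by linarith [le_abs_self g])⟩⟩

/-- The growth rates of the minors, and the tropical Plücker relations between them. -/
theorem IsTriangulation.exists_growth (hT : IsTriangulation Set.univ T)
    {v : ℝ → Fin n → ℝ × ℝ} {w g : Fin n → Fin n → ℝ}
    (hv : ∀ M a b, a < b → {a, b} ∈ T → symMinor (v M) a b = Real.exp (M * w a b + g a b)) :
    ∃ d : Fin n → Fin n → ℝ, (∀ a b, d a b = d b a) ∧
      (∀ a b, a < b → {a, b} ∈ T → d a b = w a b) ∧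
      (∀ a b, a ≠ b → ExpGrowth (fun M => symMinor (v M) a b) (d a b)) ∧
      ∀ a b c e, Crosses ({a, c} : Finset (Fin n)) {b, e} →
        d a c + d b e ≤ max (d a b + d c e) (d b c + d a e) := by
  have hcomm : ∀ a b, (fun M => symMinor (v M) a b) = fun M => symMinor (v M) b a := fun a b =>
    funext fun M => symMinor_comm _ _ _
  have hex : ∀ a b, a ≠ b → ∃ d, ExpGrowth (fun M => symMinor (v M) a b) d := by
    refine hT.pair_induction (fun a b ⟨d, hd⟩ => ⟨d, hcomm a b ▸ hd⟩) ?_ ?_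
    · intro a b hab hm
      rcases lt_or_gt_of_ne hab with h | h
      · exact ⟨w a b, by simp only [hv _ a b h hm]; exact expGrowth_exp _ _⟩
      · refine ⟨w b a, ?_⟩
        rw [hcomm]
        simp only [hv _ b a h (Finset.pair_comm a b ▸ hm)]
        exact expGrowth_exp _ _
    · rintro i j a b hcr ⟨d1, h1⟩ ⟨d2, h2⟩ ⟨d3, h3⟩ ⟨d4, h4⟩ ⟨d5, h5⟩
      -- The product with the minor of the crossing chord is a sum of two positive products, whose
      -- rate is the larger of the two rates.
      refine ⟨_, ExpGrowth.of_mul h5 (d := max (d1 + d4) (d3 + d2)) ?_⟩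
      have := (h1.mul h4).add (h3.mul h2)
      convert this using 2 with M
      rw [symMinor_plucker (v M) hcr, symMinor_comm (v M) a j]
  choose! d hd using hex
  refine ⟨d, fun a b => ?_, fun a b hab hm => ?_, hd, fun a b c e hcr => ?_⟩
  · by_cases hab : a = b
    · rw [hab]
    · exact (hd a b hab).unique (hcomm b a ▸ hd b a (Ne.symm hab))
  · refine (hd a b hab.ne).unique ?_
    simp only [hv _ a b hab hm]
    exact expGrowth_exp _ _
  · have hne : a ≠ b ∧ c ≠ e ∧ b ≠ c ∧ a ≠ e ∧ a ≠ c ∧ b ≠ e := by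
      rw [crosses_iff] at hcr
      simp only [Fin.sbtw_iff] at hcr
      omega
    have h1 := ((hd a b hne.1).mul (hd c e hne.2.1)).add
      ((hd b c hne.2.2.1).mul (hd a e hne.2.2.2.1))
    have h2 := (hd a c hne.2.2.2.2.1).mul (hd b e hne.2.2.2.2.2)
    refine (h2.unique ?_).le
    convert h1 using 2 with M
    exact symMinor_plucker (v M) hcr

end Tropical

/-! ### Quadratic polynomials in the parameters. -/

section Quadratics

variable {n : ℕ} {κ : Fin n → ℝ}

/-- The function `f` is a quadratic polynomial in the parameters. -/
def IsQuad (κ : Fin n → ℝ) (f : Fin n → ℝ) : Prop := ∃ q, ∀ x, f x = quadEval q (κ x)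

theorem IsQuad.add {f g : Fin n → ℝ} (hf : IsQuad κ f) (hg : IsQuad κ g) :
    IsQuad κ fun x => f x + g x := by
  obtain ⟨p, hp⟩ := hf
  obtain ⟨q, hq⟩ := hg
  exact ⟨p + q, fun x => by
    beta_reduce; rw [hp, hq]; simp only [quadEval, Prod.fst_add, Prod.snd_add]; ring⟩

theorem IsQuad.const_mul {f : Fin n → ℝ} (hf : IsQuad κ f) (r : ℝ) :
    IsQuad κ fun x => r * f x := by
  obtain ⟨p, hp⟩ := hf
  exact ⟨r • p, fun x => by
    beta_reduce; rw [hp]; simp only [quadEval, Prod.smul_fst, Prod.smul_snd, smul_eq_mul]; ring⟩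

theorem IsQuad.sub {f g : Fin n → ℝ} (hf : IsQuad κ f) (hg : IsQuad κ g) :
    IsQuad κ fun x => f x - g x := by
  obtain ⟨p, hp⟩ := hf
  obtain ⟨q, hq⟩ := hg
  exact ⟨p - q, fun x => by beta_reduce; rw [hp, hq, quadEval_sub]⟩

theorem isQuad_const (r : ℝ) : IsQuad κ fun _ => r := ⟨(r, 0, 0), fun x => by simp [quadEval]⟩

theorem isQuad_mul_sub (r u v : ℝ) : IsQuad κ fun x => r * ((κ x - u) * (κ x - v)) :=
  ⟨(r * u * v, -r * (u + v), r), fun x => by simp only [quadEval]; ring⟩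

theorem IsQuad.eq_zero (hκ : StrictMono κ) {f : Fin n → ℝ} (hf : IsQuad κ f) {a b c : Fin n}
    (hab : a ≠ b) (hbc : b ≠ c) (hac : a ≠ c) (ha : f a = 0) (hb : f b = 0) (hc : f c = 0)
    (x : Fin n) : f x = 0 := by
  obtain ⟨⟨q0, q1, q2⟩, hq⟩ := hf
  rw [hq] at ha hb hc
  rw [hq]
  simp only [quadEval] at *
  have n1 : κ a - κ b ≠ 0 := sub_ne_zero.2 (hκ.injective.ne hab)
  have n2 : κ b - κ c ≠ 0 := sub_ne_zero.2 (hκ.injective.ne hbc)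
  have n3 : κ a - κ c ≠ 0 := sub_ne_zero.2 (hκ.injective.ne hac)
  have e1 : q1 + q2 * (κ a + κ b) = 0 :=
    mul_left_cancel₀ n1 (by linear_combination ha - hb)
  have e2 : q1 + q2 * (κ a + κ c) = 0 :=
    mul_left_cancel₀ n3 (by linear_combination ha - hc)
  have e3 : q2 = 0 := mul_left_cancel₀ n2 (by linear_combination e1 - e2)
  have e4 : q1 = 0 := by rw [e3] at e1; linarith
  have e5 : q0 = 0 := by rw [e3, e4] at ha; linarith
  rw [e3, e4, e5]; ring

theorem IsQuad.ext (hκ : StrictMono κ) {f g : Fin n → ℝ} (hf : IsQuad κ f) (hg : IsQuad κ g)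
    {a b c : Fin n} (hab : a ≠ b) (hbc : b ≠ c) (hac : a ≠ c) (ha : f a = g a) (hb : f b = g b)
    (hc : f c = g c) (x : Fin n) : f x = g x :=
  sub_eq_zero.1 ((hf.sub hg).eq_zero hκ hab hbc hac (sub_eq_zero.2 ha) (sub_eq_zero.2 hb)
    (sub_eq_zero.2 hc) x)

/-- The weights of `exists_crossing_weights` are compatible with constants too, because both sides
have the same total weight; hence with all quadratic polynomials. -/
theorem Crosses.exists_weights (hκ : StrictMono κ) {a b c d : Fin n}
    (h : Crosses ({a, c} : Finset (Fin n)) {b, d}) : ∃ α β γ δ : ℝ, 0 < α ∧ 0 < β ∧ 0 < γ ∧ 0 < δ ∧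
      α + γ = β + δ ∧ ∀ f, IsQuad κ f → α * f a + γ * f c = β * f b + δ * f d := by
  obtain ⟨x, y, z, w, h1, h2, h3, h⟩ := h
  obtain ⟨α, β, γ, δ, hα, hβ, hγ, hδ, hs, hv⟩ := exists_crossing_weights hκ h1 h2 h3
  have hq : ∀ f, IsQuad κ f → α * f x + γ * f z = β * f y + δ * f w := by
    rintro f ⟨⟨q0, q1, q2⟩, hq⟩
    have := hv (q1, q2)
    simp only [hq, quadEval]
    unfold vertexSlope at this
    linear_combination q0 * hs + this
  rcases h with ⟨h4, h5⟩ | ⟨h4, h5⟩ <;>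
    rcases Finset.pair_eq_iff.1 h4 with ⟨rfl, rfl⟩ | ⟨rfl, rfl⟩ <;>
    rcases Finset.pair_eq_iff.1 h5 with ⟨rfl, rfl⟩ | ⟨rfl, rfl⟩
  · exact ⟨α, β, γ, δ, hα, hβ, hγ, hδ, hs, hq⟩
  · exact ⟨α, δ, γ, β, hα, hδ, hγ, hβ, by linarith, fun f hf => by linarith [hq f hf]⟩
  · exact ⟨γ, β, α, δ, hγ, hβ, hα, hδ, by linarith, fun f hf => by linarith [hq f hf]⟩
  · exact ⟨γ, δ, α, β, hγ, hδ, hα, hβ, by linarith, fun f hf => by linarith [hq f hf]⟩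
  · exact ⟨β, α, δ, γ, hβ, hα, hδ, hγ, by linarith, fun f hf => by linarith [hq f hf]⟩
  · exact ⟨β, γ, δ, α, hβ, hγ, hδ, hα, by linarith, fun f hf => by linarith [hq f hf]⟩
  · exact ⟨δ, α, β, γ, hδ, hα, hβ, hγ, by linarith, fun f hf => by linarith [hq f hf]⟩
  · exact ⟨δ, γ, β, α, hδ, hγ, hβ, hα, by linarith, fun f hf => by linarith [hq f hf]⟩

/-- The coordinate of `x` which is `1` at `m` and vanishes at `a` and `b`. -/
noncomputable def lagrange (κ : Fin n → ℝ) (m a b x : Fin n) : ℝ :=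
  1 / ((κ m - κ a) * (κ m - κ b)) * ((κ x - κ a) * (κ x - κ b))

theorem isQuad_lagrange (m a b : Fin n) : IsQuad κ (lagrange κ m a b) := isQuad_mul_sub _ _ _

theorem lagrange_self (hκ : StrictMono κ) {m a b : Fin n} (ha : m ≠ a) (hb : m ≠ b) :
    lagrange κ m a b m = 1 := by
  have n1 : κ m - κ a ≠ 0 := sub_ne_zero.2 (hκ.injective.ne ha)
  have n2 : κ m - κ b ≠ 0 := sub_ne_zero.2 (hκ.injective.ne hb)
  unfold lagrange
  field_simp

theorem lagrange_left (m a b : Fin n) : lagrange κ m a b a = 0 := by simp [lagrange]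

theorem lagrange_right (m a b : Fin n) : lagrange κ m a b b = 0 := by simp [lagrange]

/-- The polynomial vanishes at a and b and is 1 at m, so its sign changes across the chord {a,b}. -/
theorem lagrange_neg (hκ : StrictMono κ) {m a b x : Fin n}
    (h : Crosses ({x, m} : Finset (Fin n)) {a, b}) : lagrange κ m a b x < 0 := by
  have key : ∀ {a b : Fin n}, sbtw a x b → sbtw b m a →
      (κ m - κ a) * (κ m - κ b) * ((κ x - κ a) * (κ x - κ b)) < 0 := by
    intro a b h1 h2
    have e1 := (prod_neg_iff_sbtw hκ).2 h1
    have e2 := (prod_neg_iff_sbtw hκ).2 h2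
    have e3 := mul_pos_of_neg_of_neg e1 e2
    have e4 : 0 < (κ b - κ a) ^ 2 * (-((κ m - κ a) * (κ m - κ b) * ((κ x - κ a) * (κ x - κ b)))) := by
      linarith
    have := (pos_iff_pos_of_mul_pos e4).1 (by
      have : κ b - κ a ≠ 0 := fun h0 => by rw [h0] at e1; simp at e1
      positivity)
    linarith
  have hmain : (κ m - κ a) * (κ m - κ b) * ((κ x - κ a) * (κ x - κ b)) < 0 := by
    rw [crosses_iff] at h
    rcases h with ⟨h1, h2⟩ | ⟨h1, h2⟩
    · have := key (a := b) (b := a) (by simp only [Fin.sbtw_iff] at *; omega)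
        (by simp only [Fin.sbtw_iff] at *; omega)
      linarith
    · exact key (by simp only [Fin.sbtw_iff] at *; omega) (by simp only [Fin.sbtw_iff] at *; omega)
  unfold lagrange
  rw [one_div_mul_eq_div]
  rcases lt_trichotomy ((κ m - κ a) * (κ m - κ b)) 0 with h0 | h0 | h0
  · exact div_neg_of_pos_of_neg (pos_of_mul_neg_right hmain h0.le) h0
  · rw [h0] at hmain; simp at hmain
  · exact div_neg_of_neg_of_pos (neg_of_mul_neg_right hmain h0.le) h0

end Quadratics

/-! ### Coarse plots and the corner formula. -/

section Coarse

variable {n : ℕ} {κ : Fin n → ℝ} {T : Set (Finset (Fin n))} {D : Fin n → Fin n → ℝ}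
  {k : Fin n → Fin n → ℝ}

/-- The amount by which the phase with the constant term `D i j` stays below the level `f`. -/
def gap (D : Fin n → Fin n → ℝ) (f : Fin n → ℝ) (i j : Fin n) : ℝ := f i + f j - D i j

/-- Coarse phases: the phases of the edges at `m` are equal to the level `k m`, each triangle is
acute, and the constant terms satisfy the tropical Plücker relations. -/
structure CoarsePlot (κ : Fin n → ℝ) (T : Set (Finset (Fin n))) (D k : Fin n → Fin n → ℝ) :
    Prop where
  three_le : 3 ≤ n
  tri : IsTriangulation Set.univ T
  mono : StrictMono κ
  symm : ∀ a b, D a b = D b a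
  quad : ∀ m, IsQuad κ (k m)
  edge : ∀ a b, a ≠ b → {a, b} ∈ T → gap D (k a) a b = 0
  acute : ∀ a b c, a ≠ b → b ≠ c → a ≠ c → {a, b} ∈ T → {b, c} ∈ T → {a, c} ∈ T →
    0 < gap D (k a) b c
  plucker : ∀ a b c e, Crosses ({a, c} : Finset (Fin n)) {b, e} →
    D a c + D b e ≤ max (D a b + D c e) (D b c + D a e)

/-- Three vertices that span a triangle. -/
structure IsTriangle (T : Set (Finset (Fin n))) (a b c : Fin n) : Prop where
  ab : a ≠ b
  bc : b ≠ c
  ac : a ≠ c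
  mem_ab : {a, b} ∈ T
  mem_bc : {b, c} ∈ T
  mem_ac : {a, c} ∈ T

theorem IsTriangle.rotate {a b c : Fin n} (t : IsTriangle T a b c) : IsTriangle T b c a :=
  ⟨t.bc, t.ac.symm, t.ab.symm, t.mem_bc, Finset.pair_comm a c ▸ t.mem_ac,
    Finset.pair_comm a b ▸ t.mem_ab⟩

theorem IsTriangle.swap {a b c : Fin n} (t : IsTriangle T a b c) : IsTriangle T b a c :=
  ⟨t.ab.symm, t.ac, t.bc, Finset.pair_comm a b ▸ t.mem_ab, t.mem_ac, t.mem_bc⟩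

theorem CoarsePlot.gap_comm (h : CoarsePlot κ T D k) (f : Fin n → ℝ) (i j : Fin n) :
    gap D f i j = gap D f j i := by
  unfold gap; rw [h.symm i j]; ring

theorem CoarsePlot.edge' (h : CoarsePlot κ T D k) {a b : Fin n} (hab : a ≠ b) (hm : {a, b} ∈ T) :
    gap D (k b) a b = 0 := by
  rw [h.gap_comm]
  exact h.edge b a hab.symm (Finset.pair_comm a b ▸ hm)

theorem CoarsePlot.gap_pos (h : CoarsePlot κ T D k) {a b c : Fin n} (t : IsTriangle T a b c) :
    0 < gap D (k a) b c := h.acute a b c t.ab t.bc t.ac t.mem_ab t.mem_bc t.mem_ac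

/-- The tropical Plücker relation for the gaps. -/
theorem CoarsePlot.gap_plucker (h : CoarsePlot κ T D k) (f : Fin n → ℝ) {a b c e : Fin n}
    (hcr : Crosses ({a, c} : Finset (Fin n)) {b, e}) :
    min (gap D f a b + gap D f c e) (gap D f b c + gap D f a e) ≤ gap D f a c + gap D f b e := by
  have := h.plucker a b c e hcr
  unfold gap
  rw [min_le_iff]
  rcases le_max_iff.1 this with h | h
  · left; linarith
  · right; linarith

/-- The level at a vertex of a triangle in terms of the levels at the other two. -/
theorem CoarsePlot.exists_corner (h : CoarsePlot κ T D k) {m α γ : Fin n} (t : IsTriangle T m α γ)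
    {f : Fin n → ℝ} (hf : IsQuad κ f) (h1 : gap D f m α = 0) (h2 : gap D f m γ = 0) :
    ∃ θ s, 0 < θ ∧ θ < 1 ∧ 0 < s ∧ (∀ x, f x = θ * k α x + (1 - θ) * k γ x + gap D f α γ / 2 -
      (s + gap D f α γ) * lagrange κ m α γ x) ∧ ∀ i j, gap D f i j = θ * gap D (k α) i j +
      (1 - θ) * gap D (k γ) i j + gap D f α γ -
      (s + gap D f α γ) * (lagrange κ m α γ i + lagrange κ m α γ j) := by
  have hα := h.gap_pos t.rotate
  have hγ := h.gap_pos t.rotate.rotate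
  have e1 := h.edge α γ t.bc t.mem_bc
  have e2 := h.edge' t.ab t.mem_ab
  have e3 := h.edge' t.ac t.mem_ac
  have e4 := h.edge' t.bc t.mem_bc
  have hs := h.symm
  set σα := gap D (k α) γ m with hσα
  set σγ := gap D (k γ) m α with hσγ
  set σ := gap D f α γ with hσ
  have hsum : 0 < σα + σγ := by linarith
  -- The weight is chosen so that θ σα = (1 - θ) σγ. This common value is s, and it makes the gaps
  -- of both {m,α} and {m,γ} vanish.
  have hθ : σγ / (σα + σγ) * (σα + σγ) = σγ := div_mul_cancel₀ _ hsum.ne'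
  set θ := σγ / (σα + σγ) with hθdef
  have hθ1 : θ < 1 := (div_lt_one hsum).2 (by linarith)
  have hθ0 : 0 < θ := div_pos hγ hsum
  have key : ∀ x, f x = θ * k α x + (1 - θ) * k γ x + σ / 2 -
      (θ * σα + σ) * lagrange κ m α γ x := by
    unfold gap at hσα hσγ hσ e1 e2 e3 e4 h1 h2
    rw [hs γ m] at hσα
    have hq : IsQuad κ fun x => θ * k α x + (1 - θ) * k γ x + σ / 2 -
        (θ * σα + σ) * lagrange κ m α γ x :=
      ((((h.quad α).const_mul θ).add ((h.quad γ).const_mul (1 - θ))).add (isQuad_const _)).sub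
        ((isQuad_lagrange m α γ).const_mul _)
    -- The gaps on the three sides determine the levels at the three corners, and a quadratic
    -- polynomial is determined by these values.
    have f1 : k α α = (D α γ + D m α - D m γ - σα) / 2 := by linarith
    have f2 : k γ γ = (D α γ + D m γ - D m α - σγ) / 2 := by linarith
    have f3 : k α γ = (D α γ - D m α + D m γ + σα) / 2 := by linarith
    have f4 : k γ α = (D α γ - D m γ + D m α + σγ) / 2 := by linarith
    have f5 : k α m = (D m α - D α γ + D m γ + σα) / 2 := by linarith
    have f6 : k γ m = (D m γ - D α γ + D m α + σγ) / 2 := by linarith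
    have g1 : f m = (D m α + D m γ - D α γ - σ) / 2 := by linarith
    have g2 : f α = (D m α - D m γ + D α γ + σ) / 2 := by linarith
    have g3 : f γ = (D m γ - D m α + D α γ + σ) / 2 := by linarith
    refine hf.ext h.mono hq t.ab t.bc t.ac ?_ ?_ ?_
    · rw [lagrange_self h.mono t.ab t.ac, g1, f5, f6]
      linear_combination (1 / 2) * hθ
    · rw [lagrange_left, g2, f1, f4]
      linear_combination (1 / 2) * hθ
    · rw [lagrange_right, g3, f3, f2]
      linear_combination (-1 / 2) * hθ
  refine ⟨θ, θ * σα, hθ0, hθ1, mul_pos hθ0 hα, key, fun i j => ?_⟩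
  unfold gap at *
  rw [key i, key j]
  ring

end Coarse

/-! ### Levels at corners and at black vertices. -/

section ArcInduction

variable {n : ℕ} {κ : Fin n → ℝ} {T : Set (Finset (Fin n))} {D : Fin n → Fin n → ℝ}
  {k : Fin n → Fin n → ℝ}

/-- The phase of `{i, j}` is below the level of `m`, unless `{i, j}` is an edge at `m`. -/
def BelowLevel (T : Set (Finset (Fin n))) (D k : Fin n → Fin n → ℝ) (m i j : Fin n) : Prop :=
  0 < gap D (k m) i j ∨ ({i, j} ∈ T ∧ (m = i ∨ m = j))

theorem CoarsePlot.nonneg_of_belowLevel (h : CoarsePlot κ T D k) {m i j : Fin n} (hij : i ≠ j)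
    (hb : BelowLevel T D k m i j) : 0 ≤ gap D (k m) i j := by
  rcases hb with hb | ⟨hm, rfl | rfl⟩
  · exact hb.le
  · exact (h.edge m j hij hm).ge
  · exact (h.edge' hij hm).ge

theorem BelowLevel.pos_of_ne {m i j : Fin n} (hb : BelowLevel T D k m i j) (hi : m ≠ i)
    (hj : m ≠ j) : 0 < gap D (k m) i j := by
  rcases hb with hb | ⟨-, h | h⟩
  · exact hb
  · exact absurd h hi
  · exact absurd h hj

theorem CoarsePlot.belowLevel_comm (h : CoarsePlot κ T D k) {m i j : Fin n}
    (hb : BelowLevel T D k m i j) : BelowLevel T D k m j i := by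
  rcases hb with hb | ⟨h1, h2⟩
  · left; rwa [h.gap_comm]
  · exact Or.inr ⟨Finset.pair_comm i j ▸ h1, h2.symm⟩

theorem crosses_of_opposite {α β γ x y : Fin n} (h1 : Crosses ({x, β} : Finset (Fin n)) {α, γ})
    (h2 : Crosses ({y, α} : Finset (Fin n)) {γ, β}) : Crosses ({x, y} : Finset (Fin n)) {α, γ} := by
  rw [crosses_iff] at *
  simp only [Fin.sbtw_iff] at *
  omega

/-- The levels at the vertices of one side of a triangle bound the phases in the arcs behind the
other two sides. -/
theorem CoarsePlot.apex_step (h : CoarsePlot κ T D k) {α β γ : Fin n} (t : IsTriangle T α β γ)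
    {S₁ S₂ : Fin n → Prop}
    (hS₁ : ∀ x, S₁ x → x = α ∨ x = γ ∨ Crosses ({x, β} : Finset (Fin n)) {α, γ})
    (hS₂ : ∀ x, S₂ x → x = γ ∨ x = β ∨ Crosses ({x, α} : Finset (Fin n)) {γ, β})
    (h1α : S₁ α) (h1γ : S₁ γ) (h2γ : S₂ γ) (h2β : S₂ β)
    (ih₁ : ∀ i j, S₁ i → S₁ j → i ≠ j → BelowLevel T D k α i j)
    (ih₂γ : ∀ i j, S₂ i → S₂ j → i ≠ j → BelowLevel T D k γ i j)
    (ih₂β : ∀ i j, S₂ i → S₂ j → i ≠ j → BelowLevel T D k β i j) :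
    ∀ i j, (S₁ i ∨ S₂ i) → (S₁ j ∨ S₂ j) → i ≠ j → BelowLevel T D k α i j := by
  have t' : IsTriangle T α γ β := t.rotate.rotate.swap
  have e1 := h.edge α γ t.ac t.mem_ac
  have e2 := h.edge α β t.ab t.mem_ab
  have hσ := h.gap_pos t'
  obtain ⟨θ, s, hθ0, hθ1, hs, -, hcorner⟩ := h.exists_corner t' (h.quad α)
    (h.edge α γ t.ac t.mem_ac) (h.edge α β t.ab t.mem_ab)
  -- Behind {γ,β} the coordinate of α is not positive. In the corner formula all terms besides the
  -- acuteness are then nonnegative.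
  have hL : ∀ x, S₂ x → lagrange κ α γ β x ≤ 0 := by
    intro x hx
    rcases hS₂ x hx with rfl | rfl | hc
    · exact (lagrange_left _ _ _).le
    · exact (lagrange_right _ _ _).le
    · exact (lagrange_neg h.mono hc).le
  have hc2 : ∀ i j, S₂ i → S₂ j → i ≠ j → gap D (k α) γ β - (s + gap D (k α) γ β) *
      (lagrange κ α γ β i + lagrange κ α γ β j) ≤ gap D (k α) i j := by
    intro i j hi hj hij
    rw [hcorner i j]
    have := mul_nonneg hθ0.le (h.nonneg_of_belowLevel hij (ih₂γ i j hi hj hij))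
    have := mul_nonneg (sub_pos.2 hθ1).le (h.nonneg_of_belowLevel hij (ih₂β i j hi hj hij))
    linarith
  have hS2pos : ∀ i j, S₂ i → S₂ j → i ≠ j → 0 < gap D (k α) i j := by
    intro i j hi hj hij
    have := hc2 i j hi hj hij
    nlinarith [mul_nonneg (add_pos hs hσ).le (neg_nonneg.2 (add_nonpos (hL i hi) (hL j hj)))]
  have hS2gt : ∀ i j, S₂ i → S₂ j → i ≠ j → Crosses ({i, α} : Finset (Fin n)) {γ, β} →
      gap D (k α) γ β < gap D (k α) i j := by
    intro i j hi hj hij hcr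
    have := hc2 i j hi hj hij
    have h1 := hL j hj
    have h2 := lagrange_neg h.mono hcr
    nlinarith [mul_pos (add_pos hs hσ) (neg_pos.2 (add_neg_of_neg_of_nonpos h2 h1))]
  -- In the Plücker relation for {α,j} and {γ,β} the edges at α contribute nothing, and both {j,β}
  -- and {j,γ} have a larger gap than {γ,β}.
  have hα : ∀ j, S₂ j → Crosses ({j, α} : Finset (Fin n)) {γ, β} → 0 < gap D (k α) α j := by
    intro j hj hcr
    have hne : j ≠ γ ∧ j ≠ β := by
      rw [crosses_iff] at hcr; simp only [Fin.sbtw_iff] at hcr; omega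
    have hp := h.gap_plucker (k α) (a := α) (c := j) (b := γ) (e := β) (by
      rw [Finset.pair_comm]; exact hcr)
    have g1 := hS2gt j β hj h2β hne.2 hcr
    have g2 := hS2gt j γ hj h2γ hne.1 hcr
    rw [h.gap_comm _ γ j, e1, e2, zero_add, add_zero] at hp
    rcases min_le_iff.1 hp with hp | hp <;> linarith
  -- Chords from strictly behind {α,γ} to a point other than γ of the other arc cross {α,γ}, whose
  -- gap vanishes; Plücker reduces them to the chords already treated.
  have hmix : ∀ i j, S₁ i → S₂ j → i ≠ j → BelowLevel T D k α i j := by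
    intro i j hi hj hij
    rcases hS₁ i hi with rfl | rfl | ci
    · rcases hS₂ j hj with rfl | rfl | cj
      · exact ih₁ _ _ hi h1γ hij
      · exact Or.inr ⟨t.mem_ab, Or.inl rfl⟩
      · exact Or.inl (hα j hj cj)
    · exact Or.inl (hS2pos _ _ h2γ hj hij)
    · have hne : α ≠ i ∧ i ≠ γ := by
        rw [crosses_iff] at ci; simp only [Fin.sbtw_iff] at ci; omega
      have g1 := h.nonneg_of_belowLevel hne.1.symm (ih₁ i α hi h1α hne.1.symm)
      have g2 := (ih₁ i γ hi h1γ hne.2).pos_of_ne hne.1 t.ac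
      rcases hS₂ j hj with rfl | rfl | cj
      · exact ih₁ _ _ hi h1γ hij
      · have hp := h.gap_plucker (k α) ci
        rw [e1, e2, zero_add, add_zero, h.gap_comm _ j γ] at hp
        left
        rcases min_le_iff.1 hp with hp | hp <;> linarith
      · have hnej : j ≠ γ := by
          rw [crosses_iff] at cj; simp only [Fin.sbtw_iff] at cj; omega
        have hp := h.gap_plucker (k α) (crosses_of_opposite ci cj)
        have g3 := hα j hj cj
        have g4 := hS2pos j γ hj h2γ hnej
        rw [e1, add_zero] at hp
        left
        rcases min_le_iff.1 hp with hp | hp <;> linarith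
  intro i j hi hj hij
  rcases hi with hi | hi <;> rcases hj with hj | hj
  · exact ih₁ i j hi hj hij
  · exact hmix i j hi hj hij
  · exact h.belowLevel_comm (hmix j i hj hi hij.symm)
  · exact Or.inl (hS2pos i j hi hj hij)

theorem arc_crosses {α β γ x : Fin n} (hγ : sbtw α γ β) (hx : sbtw α x γ) :
    Crosses ({x, β} : Finset (Fin n)) {α, γ} := by
  rw [crosses_iff]
  simp only [Fin.sbtw_iff] at *
  omega

theorem arc_crosses' {α β γ x : Fin n} (hγ : sbtw α γ β) (hx : sbtw γ x β) :
    Crosses ({x, α} : Finset (Fin n)) {γ, β} := by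
  rw [crosses_iff]
  simp only [Fin.sbtw_iff] at *
  omega

theorem arc_cover {α β γ x : Fin n} (hγ : sbtw α γ β) (hx : x = α ∨ x = β ∨ sbtw α x β) :
    (x = α ∨ x = γ ∨ sbtw α x γ) ∨ (x = γ ∨ x = β ∨ sbtw γ x β) := by
  simp only [Fin.sbtw_iff] at *
  omega

/-- Induction over the edges by the length of the arc behind them: `apex_step` is applied to the
triangle on the arc, once for each end of the edge. -/
theorem CoarsePlot.belowLevel_arc (h : CoarsePlot κ T D k) : ∀ N : ℕ, ∀ α β : Fin n, α ≠ β →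
    {α, β} ∈ T → cycPos α β ≤ N → ∀ i j, (i = α ∨ i = β ∨ sbtw α i β) →
      (j = α ∨ j = β ∨ sbtw α j β) → i ≠ j → BelowLevel T D k α i j ∧ BelowLevel T D k β i j := by
  intro N
  induction N with
  | zero =>
    intro α β hne _ hN
    exfalso
    unfold cycPos at hN
    split_ifs at hN <;> omega
  | succ N ih =>
    intro α β hne hm hN i j hi hj hij
    by_cases hex : ∃ x, sbtw α x β
    · obtain ⟨γ, hγ, h1, h2⟩ := h.tri.exists_apex hm hex
      have n1 : α ≠ γ ∧ γ ≠ β := by simp only [Fin.sbtw_iff] at hγ; omega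
      have t : IsTriangle T α β γ := ⟨hne, n1.2.symm, n1.1, hm, Finset.pair_comm γ β ▸ h2, h1⟩
      have hlt := cycPos_lt_of_sbtw hγ
      have hlt2 : cycPos γ β < cycPos α β := by
        unfold cycPos
        simp only [Fin.sbtw_iff] at hγ
        split_ifs <;> omega
      have ih1 := ih α γ n1.1 h1 (by omega)
      have ih2 := ih γ β n1.2 h2 (by omega)
      have c1 : ∀ x, (x = α ∨ x = γ ∨ sbtw α x γ) →
          x = α ∨ x = γ ∨ Crosses ({x, β} : Finset (Fin n)) {α, γ} :=
        fun x hx => hx.imp id (Or.imp id (arc_crosses hγ))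
      have c2 : ∀ x, (x = γ ∨ x = β ∨ sbtw γ x β) →
          x = γ ∨ x = β ∨ Crosses ({x, α} : Finset (Fin n)) {γ, β} :=
        fun x hx => hx.imp id (Or.imp id (arc_crosses' hγ))
      have hi' := arc_cover hγ hi
      have hj' := arc_cover hγ hj
      refine ⟨h.apex_step t c1 c2 (Or.inl rfl) (Or.inr (Or.inl rfl)) (Or.inl rfl)
        (Or.inr (Or.inl rfl)) (fun i j hi hj hij => (ih1 i j hi hj hij).1)
        (fun i j hi hj hij => (ih2 i j hi hj hij).1) (fun i j hi hj hij => (ih2 i j hi hj hij).2)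
        i j hi' hj' hij, ?_⟩
      refine h.apex_step t.swap (S₁ := fun x => x = γ ∨ x = β ∨ sbtw γ x β)
        (S₂ := fun x => x = α ∨ x = γ ∨ sbtw α x γ) (fun x hx => ?_) (fun x hx => ?_)
        (Or.inr (Or.inl rfl)) (Or.inl rfl)
        (Or.inr (Or.inl rfl)) (Or.inl rfl) (fun i j hi hj hij => (ih2 i j hi hj hij).2)
        (fun i j hi hj hij => (ih1 i j hi hj hij).2) (fun i j hi hj hij => (ih1 i j hi hj hij).1)
        i j hi'.symm hj'.symm hij
      · rcases c2 x hx with e | e | e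
        · exact Or.inr (Or.inl e)
        · exact Or.inl e
        · exact Or.inr (Or.inr (Finset.pair_comm γ β ▸ e))
      · rcases c1 x hx with e | e | e
        · exact Or.inr (Or.inl e)
        · exact Or.inl e
        · exact Or.inr (Or.inr (Finset.pair_comm α γ ▸ e))
    · push Not at hex
      have hi' : i = α ∨ i = β := by
        rcases hi with e | e | e
        · exact Or.inl e
        · exact Or.inr e
        · exact absurd e (hex i)
      have hj' : j = α ∨ j = β := by
        rcases hj with e | e | e
        · exact Or.inl e
        · exact Or.inr e
        · exact absurd e (hex j)
      rcases hi' with rfl | rfl <;> rcases hj' with rfl | rfl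
      · exact absurd rfl hij
      · exact ⟨Or.inr ⟨hm, Or.inl rfl⟩, Or.inr ⟨hm, Or.inr rfl⟩⟩
      · exact ⟨Or.inr ⟨Finset.pair_comm i j ▸ hm, Or.inr rfl⟩,
          Or.inr ⟨Finset.pair_comm i j ▸ hm, Or.inl rfl⟩⟩
      · exact absurd rfl hij

/-- At the level of `m` only the edges at `m` are visible. -/
theorem CoarsePlot.belowLevel (h : CoarsePlot κ T D k) (m i j : Fin n) (hij : i ≠ j) :
    BelowLevel T D k m i j := by
  obtain ⟨a, b, hab, huniq⟩ := exists_cyclic_neighbours h.three_le m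
  have hne : m ≠ a := by simp only [Fin.sbtw_iff] at hab; omega
  -- The side from m to its predecessor a is the edge whose arc contains the whole polygon.
  have hm : {m, a} ∈ T := by
    rw [Finset.pair_comm]
    refine h.tri.side_mem hne.symm fun x hx => ?_
    have := huniq x (sbtw_of_sbtw_left hab hx)
    simp only [Fin.sbtw_iff] at hx
    omega
  have hall : ∀ x, x = m ∨ x = a ∨ sbtw m x a := by
    intro x
    have : ¬ sbtw a x m := fun hx => by
      have := huniq x (sbtw_of_sbtw_left hab hx)
      simp only [Fin.sbtw_iff] at hx
      omega
    simp only [Fin.sbtw_iff] at *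
    omega
  exact (h.belowLevel_arc _ m a hne hm le_rfl i j (hall i) (hall j) hij).1

theorem CoarsePlot.gap_nonneg (h : CoarsePlot κ T D k) (m : Fin n) {i j : Fin n} (hij : i ≠ j) :
    0 ≤ gap D (k m) i j := h.nonneg_of_belowLevel hij (h.belowLevel m i j hij)

theorem CoarsePlot.gap_pos_of_not_mem (h : CoarsePlot κ T D k) (m : Fin n) {i j : Fin n}
    (hij : i ≠ j) (hm : {i, j} ∉ T) : 0 < gap D (k m) i j := by
  rcases h.belowLevel m i j hij with hb | ⟨hb, -⟩
  · exact hb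
  · exact absurd hb hm

/-- The level at the black vertex of a triangle. -/
noncomputable def blackLevel (κ : Fin n → ℝ) (D k : Fin n → Fin n → ℝ) (a b c x : Fin n) : ℝ :=
  k a x + (-(gap D (k a) b c / 2) + gap D (k a) b c * lagrange κ a b c x)

theorem CoarsePlot.isQuad_blackLevel (h : CoarsePlot κ T D k) (a b c : Fin n) :
    IsQuad κ (blackLevel κ D k a b c) :=
  (h.quad a).add ((isQuad_const _).add ((isQuad_lagrange a b c).const_mul _))

/-- The correction adds half of the acuteness at a and subtracts it at b and c: the sums along {a,b}
and {a,c} do not change, and {b,c} comes up to the level. -/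
theorem CoarsePlot.gap_blackLevel (h : CoarsePlot κ T D k) {a b c : Fin n}
    (t : IsTriangle T a b c) : gap D (blackLevel κ D k a b c) a b = 0 ∧
      gap D (blackLevel κ D k a b c) b c = 0 ∧ gap D (blackLevel κ D k a b c) a c = 0 := by
  have e1 := h.edge a b t.ab t.mem_ab
  have e2 := h.edge a c t.ac t.mem_ac
  have l1 := lagrange_self h.mono t.ab t.ac
  have l2 := lagrange_left (κ := κ) a b c
  have l3 := lagrange_right (κ := κ) a b c
  unfold gap at e1 e2
  simp only [gap, blackLevel, l1, l2, l3]
  refine ⟨?_, ?_, ?_⟩ <;> linarith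

/-- The corner formula when the side opposite to m has zero gap too. -/
theorem CoarsePlot.gap_black_lower (h : CoarsePlot κ T D k) {m α γ : Fin n}
    (t : IsTriangle T m α γ) {f : Fin n → ℝ} (hf : IsQuad κ f) (h1 : gap D f m α = 0)
    (h2 : gap D f m γ = 0) (h3 : gap D f α γ = 0) : ∃ s, 0 < s ∧ ∀ i j, i ≠ j →
      -s * (lagrange κ m α γ i + lagrange κ m α γ j) ≤ gap D f i j := by
  obtain ⟨θ, s, hθ0, hθ1, hs, -, hg⟩ := h.exists_corner t hf h1 h2
  refine ⟨s, hs, fun i j hij => ?_⟩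
  rw [hg i j, h3]
  have := mul_nonneg hθ0.le (h.gap_nonneg α hij)
  have := mul_nonneg (sub_pos.2 hθ1).le (h.gap_nonneg γ hij)
  linarith

theorem crosses_cases {a b c x : Fin n} (hab : a ≠ b) (hbc : b ≠ c) (hac : a ≠ c) (ha : x ≠ a)
    (hb : x ≠ b) (hc : x ≠ c) : Crosses ({x, a} : Finset (Fin n)) {b, c} ∨
      Crosses ({x, b} : Finset (Fin n)) {c, a} ∨ Crosses ({x, c} : Finset (Fin n)) {a, b} := by
  simp only [crosses_iff, Fin.sbtw_iff]
  rcases lt_or_gt_of_ne hab with h1 | h1 <;> rcases lt_or_gt_of_ne hbc with h2 | h2 <;>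
  rcases lt_or_gt_of_ne hac with h3 | h3 <;> rcases lt_or_gt_of_ne ha with h4 | h4 <;>
  rcases lt_or_gt_of_ne hb with h5 | h5 <;> rcases lt_or_gt_of_ne hc with h6 | h6 <;>
  simp only [h1, h2, h3, h4, h5, h6, h1.not_gt, h2.not_gt, h3.not_gt, h4.not_gt, h5.not_gt,
    h6.not_gt, and_true, and_false, or_false, or_true]

theorem crosses_iff' {x y α γ : Fin n} : Crosses ({x, y} : Finset (Fin n)) {α, γ} ↔
    (sbtw α x γ ∧ sbtw γ y α) ∨ (sbtw α y γ ∧ sbtw γ x α) :=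
  Iff.trans ⟨Crosses.symm, Crosses.symm⟩ crosses_iff

theorem crosses_or_crosses {m α γ i j : Fin n} (h : Crosses ({i, m} : Finset (Fin n)) {α, γ})
    (h1 : j ≠ α) (h2 : j ≠ γ) : Crosses ({j, m} : Finset (Fin n)) {α, γ} ∨
      Crosses ({i, j} : Finset (Fin n)) {α, γ} := by
  have key : α ≠ γ := by
    rintro rfl
    rw [crosses_iff'] at h
    simp only [Fin.sbtw_iff] at h
    omega
  have hj : sbtw α j γ ∨ sbtw γ j α := by
    clear h
    simp only [Fin.sbtw_iff]
    omega
  rw [crosses_iff'] at *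
  rw [crosses_iff']
  tauto

/-- At the level of a black vertex only the sides of the triangle are visible. -/
theorem CoarsePlot.gap_black_pos (h : CoarsePlot κ T D k) {a b c : Fin n}
    (t : IsTriangle T a b c) {f : Fin n → ℝ} (hf : IsQuad κ f) (h1 : gap D f a b = 0)
    (h2 : gap D f b c = 0) (h3 : gap D f a c = 0) {i j : Fin n} (hij : i ≠ j) (hm : {i, j} ∉ T) :
    0 < gap D f i j := by
  -- For x behind {α,γ} the lower bound gives positivity against α and γ, and the Plücker relation
  -- then gives it against m.
  have hvertex : ∀ m α γ, IsTriangle T m α γ → gap D f m α = 0 → gap D f m γ = 0 →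
      gap D f α γ = 0 → ∀ x, Crosses ({x, m} : Finset (Fin n)) {α, γ} →
      0 < gap D f x m ∧ 0 < gap D f x α ∧ 0 < gap D f x γ := by
    intro m α γ t h1 h2 h3 x hx
    obtain ⟨s, hs, hlow⟩ := h.gap_black_lower t hf h1 h2 h3
    have hne : x ≠ α ∧ x ≠ γ := by
      rw [crosses_iff] at hx; simp only [Fin.sbtw_iff] at hx; omega
    have hL := lagrange_neg h.mono hx
    have g1 := hlow x α hne.1
    have g2 := hlow x γ hne.2
    rw [lagrange_left, add_zero] at g1
    rw [lagrange_right, add_zero] at g2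
    have hp := mul_pos hs (neg_pos.2 hL)
    have g1' : 0 < gap D f x α := by linarith
    have g2' : 0 < gap D f x γ := by linarith
    have hpl := h.gap_plucker f hx
    rw [h2, h3, h.gap_comm f α m, h1] at hpl
    refine ⟨?_, g1', g2'⟩
    rcases min_le_iff.1 hpl with hp | hp <;> linarith
  have hc := h.gap_comm f
  have hpair : ∀ m α γ, IsTriangle T m α γ → gap D f m α = 0 → gap D f m γ = 0 →
      gap D f α γ = 0 → ∀ x, Crosses ({x, m} : Finset (Fin n)) {α, γ} → ∀ y, x ≠ y →
      0 < gap D f x y := by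
    intro m α γ t h1 h2 h3 x hx y hxy
    have hv := hvertex m α γ t h1 h2 h3 x hx
    by_cases ya : y = α
    · rw [ya]; exact hv.2.1
    by_cases yc : y = γ
    · rw [yc]; exact hv.2.2
    by_cases ym : y = m
    · rw [ym]; exact hv.1
    -- Either y is behind the same side and the lower bound is positive, or {x,y} crosses this side
    -- and Plücker applies.
    rcases crosses_or_crosses hx ya yc with hy | hy
    · obtain ⟨s, hs, hlow⟩ := h.gap_black_lower t hf h1 h2 h3
      have := hlow x y hxy
      have := mul_pos hs (neg_pos.2 (lagrange_neg h.mono hx))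
      have := mul_pos hs (neg_pos.2 (lagrange_neg h.mono hy))
      linarith
    · have hyv : 0 < gap D f y α ∧ 0 < gap D f y γ := by
        rcases crosses_cases t.ab t.bc t.ac ym ya yc with e | e | e
        · exact (hvertex m α γ t h1 h2 h3 y e).2
        · have := hvertex α γ m t.rotate h3 (by rw [hc]; exact h1) (by rw [hc]; exact h2) y e
          exact ⟨this.1, this.2.1⟩
        · have := hvertex γ m α t.rotate.rotate (by rw [hc]; exact h2) (by rw [hc]; exact h3) h1 y e
          exact ⟨this.2.2, this.1⟩
      have hpl := h.gap_plucker f hy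
      rw [h3, hc α y] at hpl
      rcases min_le_iff.1 hpl with hp | hp <;> linarith [hv.2.1, hv.2.2]
  have hcorner : ∀ x, x ≠ a → x ≠ b → x ≠ c → ∀ y, x ≠ y → 0 < gap D f x y := by
    intro x xa xb xc y hxy
    rcases crosses_cases t.ab t.bc t.ac xa xb xc with e | e | e
    · exact hpair a b c t h1 h3 h2 x e y hxy
    · exact hpair b c a t.rotate h2 (by rw [hc]; exact h1) (by rw [hc]; exact h3) x e y hxy
    · exact hpair c a b t.rotate.rotate (by rw [hc]; exact h3) (by rw [hc]; exact h2) h1 x e y hxy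
  by_cases hi : i = a ∨ i = b ∨ i = c
  · by_cases hj : j = a ∨ j = b ∨ j = c
    · exfalso
      apply hm
      rcases hi with rfl | rfl | rfl <;> rcases hj with rfl | rfl | rfl
      · exact absurd rfl hij
      · exact t.mem_ab
      · exact t.mem_ac
      · exact Finset.pair_comm j i ▸ t.mem_ab
      · exact absurd rfl hij
      · exact t.mem_bc
      · exact Finset.pair_comm j i ▸ t.mem_ac
      · exact Finset.pair_comm j i ▸ t.mem_bc
      · exact absurd rfl hij
    · push Not at hj
      rw [hc]
      exact hcorner j hj.1 hj.2.1 hj.2.2 i hij.symm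
  · push Not at hi
    exact hcorner i hi.1 hi.2.1 hi.2.2 j hij

end ArcInduction

/-! ### A uniform gap on all cells of the coarse plot. -/

section Cells

variable {n : ℕ} {κ : Fin n → ℝ} {T : Set (Finset (Fin n))} {D : Fin n → Fin n → ℝ}
  {k : Fin n → Fin n → ℝ}

/-- A corner of the polygon has a second neighbour besides a given one. -/
theorem IsTriangulation.exists_other_neighbour (hT : IsTriangulation Set.univ T) (hn : 3 ≤ n)
    {a b : Fin n} (hab : a ≠ b) (hs : (∀ x, ¬ sbtw a x b) ∨ ∀ x, ¬ sbtw b x a) :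
    ∃ p, a ≠ p ∧ {a, p} ∈ T ∧
      ∀ x, x ≠ a → x ≠ b → x ≠ p → Crosses ({a, x} : Finset (Fin n)) {b, p} := by
  obtain ⟨p, q, hpq, huniq⟩ := exists_cyclic_neighbours hn a
  have hpa : ∀ x, ¬ sbtw p x a := fun x hx => by
    have := huniq x (sbtw_of_sbtw_left hpq hx)
    simp only [Fin.sbtw_iff] at hx
    omega
  have haq : ∀ x, ¬ sbtw a x q := fun x hx => by
    have := huniq x (sbtw_of_sbtw_right hpq hx)
    simp only [Fin.sbtw_iff] at hx
    omega
  have hne : p ≠ a ∧ a ≠ q := by simp only [Fin.sbtw_iff] at hpq; omega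
  have hcr : ∀ x, x ≠ a → x ≠ q → x ≠ p → Crosses ({a, x} : Finset (Fin n)) {q, p} := by
    intro x h1 h2 h3
    have h4 : ¬ sbtw p x q := fun hx => h1 (huniq x hx)
    rw [crosses_iff']
    right
    simp only [Fin.sbtw_iff] at *
    omega
  have hb : b = p ∨ b = q := by
    by_contra hcon
    push Not at hcon
    have h4 : ¬ sbtw p b q := fun hx => hab (huniq b hx).symm
    rcases hs with hs | hs
    · have := hs q
      simp only [Fin.sbtw_iff] at *
      omega
    · have := hs p
      simp only [Fin.sbtw_iff] at *
      omega
  rcases hb with rfl | rfl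
  · refine ⟨q, hne.2, hT.side_mem hne.2 haq, fun x h1 h2 h3 => ?_⟩
    rw [Finset.pair_comm b q]
    exact hcr x h1 h3 h2
  · exact ⟨p, hne.1.symm, Finset.pair_comm p a ▸ hT.side_mem hne.1 hpa, hcr⟩

/-- The levels at which {a,b} has zero gap form an affine plane. The levels of a and b are distinct
points of it, and the polynomial that vanishes at a and b gives the second direction. -/
theorem CoarsePlot.exists_edge_decomposition (h : CoarsePlot κ T D k) {a b y : Fin n}
    (t : IsTriangle T a b y) {f : Fin n → ℝ} (hf : IsQuad κ f) (h0 : gap D f a b = 0) :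
    0 < k b a - k a a ∧ ∃ μ ν, ∀ x, f x = μ * k a x + (1 - μ) * k b x +
      ν * ((κ x - κ a) * (κ x - κ b)) := by
  have e1 := h.edge a b t.ab t.mem_ab
  have e2 := h.edge a y t.ac t.mem_ac
  have e3 := h.edge' t.ab t.mem_ab
  have e4 := h.edge b y t.bc t.mem_bc
  have hσa := h.gap_pos t
  have hσb := h.gap_pos t.swap
  unfold gap at *
  have hpos : 0 < k b a - k a a := by linarith
  refine ⟨hpos, ?_⟩
  have hμ := div_mul_cancel₀ (k b a - f a) hpos.ne'
  set μ := (k b a - f a) / (k b a - k a a)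
  have hS : (κ y - κ a) * (κ y - κ b) ≠ 0 := mul_ne_zero
    (sub_ne_zero.2 (h.mono.injective.ne t.ac.symm)) (sub_ne_zero.2 (h.mono.injective.ne t.bc.symm))
  have hν := div_mul_cancel₀ (f y - (μ * k a y + (1 - μ) * k b y)) hS
  set ν := (f y - (μ * k a y + (1 - μ) * k b y)) / ((κ y - κ a) * (κ y - κ b))
  refine ⟨μ, ν, hf.ext h.mono ((((h.quad a).const_mul μ).add ((h.quad b).const_mul (1 - μ))).add
    (isQuad_mul_sub ν (κ a) (κ b))) t.ab t.bc t.ac ?_ ?_ ?_⟩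
  · linear_combination hμ
  · have ha : f b = D a b - f a := by linarith
    have hb : k a b = D a b - k a a := by linarith
    have hc : k b b = D a b - k b a := by linarith
    rw [ha, hb, hc]
    linear_combination -hμ
  · linear_combination -hν

/-- A level between the level of an edge and that of the black vertex of a triangle. -/
theorem CoarsePlot.le_gap_of_apex (h : CoarsePlot κ T D k) {a b y : Fin n}
    (t : IsTriangle T y a b) {f : Fin n → ℝ} {μ ν : ℝ} (hf : ∀ x, f x = μ * k a x +
      (1 - μ) * k b x + ν * ((κ x - κ a) * (κ x - κ b)))
    (hν : ν * ((κ y - κ a) * (κ y - κ b)) ≤ 0) (hay : 0 ≤ gap D f a y) (hby : 0 ≤ gap D f b y)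
    {i j : Fin n} {η : ℝ} (ha : η ≤ gap D (k a) i j) (hb : η ≤ gap D (k b) i j)
    (hY : η ≤ gap D (blackLevel κ D k y a b) i j) : η ≤ gap D f i j := by
  obtain ⟨z1, z2, z3⟩ := h.gap_blackLevel t
  obtain ⟨θ, s, hθ0, hθ1, hs, -, hg⟩ := h.exists_corner t (h.isQuad_blackLevel y a b) z1 z3
  have hS : (κ y - κ a) * (κ y - κ b) ≠ 0 := mul_ne_zero
    (sub_ne_zero.2 (h.mono.injective.ne t.ab)) (sub_ne_zero.2 (h.mono.injective.ne t.ac))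
  set l := -(ν * ((κ y - κ a) * (κ y - κ b))) / s with hl
  have hl0 : 0 ≤ l := div_nonneg (by linarith) hs.le
  have hls : l * s = -(ν * ((κ y - κ a) * (κ y - κ b))) := div_mul_cancel₀ _ hs.ne'
  have hlag : ∀ x, ν * ((κ x - κ a) * (κ x - κ b)) = -(l * s) * lagrange κ y a b x := by
    intro x
    rw [hls]
    unfold lagrange
    linear_combination (-(ν * ((κ x - κ a) * (κ x - κ b)))) * mul_one_div_cancel hS
  -- Affine coordinates of f in the triangle spanned by the levels of a, b and the black vertex. The
  -- gaps of {b,y} and {a,y} isolate the first two coordinates, which are therefore nonnegative.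
  have key : ∀ i j, gap D f i j = (μ - l * θ) * gap D (k a) i j +
      (1 - μ - l * (1 - θ)) * gap D (k b) i j + l * gap D (blackLevel κ D k y a b) i j := by
    intro i j
    rw [hg i j, z2]
    have e1 := hf i
    have e2 := hf j
    rw [hlag] at e1 e2
    have : gap D f i j = f i + f j - D i j := rfl
    rw [this, e1, e2]
    simp only [gap]
    ring
  have k1 := key b y
  have k2 := key a y
  rw [h.edge b y t.ac.symm (Finset.pair_comm y b ▸ t.mem_ac), h.gap_comm (blackLevel κ D k y a b) b y, z3] at k1
  rw [h.edge a y t.ab.symm (Finset.pair_comm y a ▸ t.mem_ab), h.gap_comm (blackLevel κ D k y a b) a y, z1] at k2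
  have hσa := h.gap_pos t.rotate
  have hσb := h.gap_pos t.rotate.rotate
  rw [h.gap_comm] at hσb
  have c1 : 0 ≤ μ - l * θ := nonneg_of_mul_nonneg_left (by linarith) hσa
  have c2 : 0 ≤ 1 - μ - l * (1 - θ) :=
    nonneg_of_mul_nonneg_left (by linarith) hσb
  rw [key i j]
  nlinarith [mul_le_mul_of_nonneg_left ha c1, mul_le_mul_of_nonneg_left hb c2,
    mul_le_mul_of_nonneg_left hY hl0]

/-- A level below that of a corner along a side of the polygon. -/
theorem CoarsePlot.le_gap_of_side (h : CoarsePlot κ T D k) {a b : Fin n} (hab : a ≠ b)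
    (hs : (∀ x, ¬ sbtw a x b) ∨ ∀ x, ¬ sbtw b x a) (hm : {a, b} ∈ T)
    {f : Fin n → ℝ} (hf : IsQuad κ f) (h0 : gap D f a b = 0)
    (hT : ∀ x y, x ≠ y → {x, y} ∈ T → 0 ≤ gap D f x y) (ha : f a ≤ k a a) {i j : Fin n}
    (hij : i ≠ j) {η : ℝ} (hη : η ≤ gap D (k a) i j) : η ≤ gap D f i j := by
  obtain ⟨p, hp, hpT, hcr⟩ := h.tri.exists_other_neighbour h.three_le hab hs
  have hu := (h.quad a).sub hf
  have e1 := h.edge a b hab hm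
  have e2 := h.edge a p hp hpT
  have e3 := hT a p hp hpT
  -- Let u = k a - f. The edges at a and the hypothesis on f a give u p ≤ u b ≤ u a. Any other x is
  -- opposite to a in a quadrangle with b and p, and the weights then force u x ≤ u b.
  have hle : ∀ x, x ≠ a → k a x - f x ≤ k a b - f b := by
    intro x hx
    by_cases hxb : x = b
    · rw [hxb]
    by_cases hxp : x = p
    · rw [hxp]; unfold gap at *; linarith
    obtain ⟨α, β, γ, δ, hα, hβ, hγ, hδ, hsum, hw⟩ := (hcr x hx hxb hxp).exists_weights h.mono
    have hv := hw _ hu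
    beta_reduce at hv
    have h1 : k a p - f p ≤ k a b - f b := by unfold gap at *; linarith
    have h2 : k a b - f b ≤ k a a - f a := by unfold gap at *; linarith
    refine le_of_mul_le_mul_left ?_ hγ
    have := mul_le_mul_of_nonneg_left h1 hδ.le
    have := mul_le_mul_of_nonneg_left h2 hα.le
    have : γ * (k a b - f b) = β * (k a b - f b) + δ * (k a b - f b) - α * (k a b - f b) := by
      linear_combination (k a b - f b) * hsum
    linarith
  have hi : (k a i - f i) + (k a j - f j) ≤ 0 := by
    by_cases hia : i = a
    · have := hle j (fun e => hij (hia.trans e.symm))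
      rw [hia]
      unfold gap at *
      linarith
    · have h1 := hle i hia
      by_cases hja : j = a
      · rw [hja]; unfold gap at *; linarith
      · have h2 := hle j hja
        unfold gap at *
        linarith
  unfold gap at *
  linarith

/-- A phase that is not an edge stays below the maximum of the edge phases as far as it does at the
levels of the corners and of the triangles. -/
theorem CoarsePlot.le_gap (h : CoarsePlot κ T D k) {f : Fin n → ℝ} (hf : IsQuad κ f)
    {a b : Fin n} (hab : a ≠ b) (hm : {a, b} ∈ T) (h0 : gap D f a b = 0)
    (hT : ∀ x y, x ≠ y → {x, y} ∈ T → 0 ≤ gap D f x y) {i j : Fin n} (hij : i ≠ j) {η : ℝ}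
    (hη : ∀ m, η ≤ gap D (k m) i j)
    (hηΔ : ∀ x y z, IsTriangle T x y z → η ≤ gap D (blackLevel κ D k x y z) i j) :
    η ≤ gap D f i j := by
  have hapex : ∀ a b, a ≠ b → {a, b} ∈ T → ∀ {x}, sbtw a x b → ∃ y, sbtw a y b ∧
      IsTriangle T y a b := by
    intro a b hab hm x hx
    obtain ⟨y, hy, h1, h2⟩ := h.tri.exists_apex hm ⟨x, hx⟩
    have hne : a ≠ y ∧ y ≠ b := by simp only [Fin.sbtw_iff] at hy; omega
    exact ⟨y, hy, hne.1.symm, hab, hne.2, Finset.pair_comm a y ▸ h1, hm, h2⟩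
  have hside : ∀ a b, a ≠ b → {a, b} ∈ T → gap D f a b = 0 → (∀ x, ¬ sbtw a x b) →
      η ≤ gap D f i j := by
    intro a b hab hm h0 hs
    obtain ⟨x, hx⟩ : ∃ x, sbtw b x a := by
      obtain ⟨c, d, hcd, -⟩ := exists_cyclic_neighbours h.three_le a
      obtain ⟨x, hxa, hxb⟩ : ∃ x, x ≠ a ∧ x ≠ b := by
        have hne : c ≠ a ∧ d ≠ a ∧ c ≠ d := by
          clear hs
          simp only [Fin.sbtw_iff] at hcd
          omega
        by_cases hc : c = b
        · exact ⟨d, hne.2.1, fun e => hne.2.2 (hc.trans e.symm)⟩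
        · exact ⟨c, hne.1, hc⟩
      refine ⟨x, ?_⟩
      have hx := hs x
      clear hcd hs
      simp only [Fin.sbtw_iff] at *
      omega
    obtain ⟨y, hy, t⟩ := hapex b a hab.symm (Finset.pair_comm a b ▸ hm) hx
    have t' : IsTriangle T y a b := t.swap.rotate
    obtain ⟨hpos, μ, ν, hdec⟩ := h.exists_edge_decomposition t'.rotate hf h0
    have ya := hT a y t'.ab.symm (Finset.pair_comm y a ▸ t'.mem_ab)
    have yb := hT b y t'.ac.symm (Finset.pair_comm y b ▸ t'.mem_ac)
    -- The cell of a side is unbounded. Towards the apex it is a triangle; on the other side it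
    -- extends beyond the level of a (μ > 1), beyond that of b (μ < 0), or outwards from the segment
    -- between them, where the last term is nonnegative at every index.
    rcases le_or_gt (ν * ((κ y - κ a) * (κ y - κ b))) 0 with hν | hν
    · exact h.le_gap_of_apex t' hdec hν ya yb (hη a) (hη b) (hηΔ y a b t')
    have hSy := (prod_neg_iff_sbtw h.mono).2 hy
    have hSx : ∀ x, 0 ≤ ν * ((κ x - κ a) * (κ x - κ b)) := by
      intro x
      have h1 : ¬ (κ b - κ a) * (κ x - κ a) * (κ x - κ b) < 0 := fun h' =>
        hs x ((prod_neg_iff_sbtw h.mono).1 h')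
      have h2 : 0 < ν * (κ b - κ a) * ((κ y - κ a) * (κ y - κ b)) ^ 2 := by
        have : 0 < (ν * ((κ y - κ a) * (κ y - κ b))) * (-((κ a - κ b) * (κ y - κ b) * (κ y - κ a))) :=
          mul_pos hν (by linarith)
        calc _ < _ := this
          _ = _ := by ring
      have h3 : 0 < ν * (κ b - κ a) := pos_of_mul_pos_left h2 (sq_nonneg _)
      have h4 := mul_nonneg h3.le (not_lt.1 h1)
      have h5 : 0 < (κ b - κ a) ^ 2 := by
        have := h.mono.injective.ne hab
        have : κ b - κ a ≠ 0 := sub_ne_zero.2 this.symm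
        positivity
      refine nonneg_of_mul_nonneg_right (a := (κ b - κ a) ^ 2) ?_ h5
      calc (0 : ℝ) ≤ _ := h4
        _ = _ := by ring
    have e1 := h.edge a b hab hm
    have e3 := h.edge' hab hm
    have hfa : f a = k b a - μ * (k b a - k a a) := by rw [hdec a]; ring
    rcases lt_or_ge 1 μ with hμ1 | hμ1
    · refine h.le_gap_of_side hab (Or.inl hs) hm hf h0 hT ?_ hij (hη a)
      nlinarith
    rcases lt_or_ge μ 0 with hμ0 | hμ0
    · refine h.le_gap_of_side hab.symm (Or.inr hs) (Finset.pair_comm a b ▸ hm) hf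
        (by rw [h.gap_comm]; exact h0) hT ?_ hij (hη b)
      have : k b a ≤ f a := by nlinarith
      unfold gap at *
      linarith
    have h1 := mul_le_mul_of_nonneg_left (hη a) hμ0
    have h2 := mul_le_mul_of_nonneg_left (hη b) (sub_nonneg.2 hμ1)
    have : gap D f i j = μ * gap D (k a) i j + (1 - μ) * gap D (k b) i j +
        ν * ((κ i - κ a) * (κ i - κ b)) + ν * ((κ j - κ a) * (κ j - κ b)) := by
      unfold gap
      rw [hdec i, hdec j]
      ring
    linarith [hSx i, hSx j]
  by_cases hs1 : ∀ x, ¬ sbtw a x b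
  · exact hside a b hab hm h0 hs1
  by_cases hs2 : ∀ x, ¬ sbtw b x a
  · exact hside b a hab.symm (Finset.pair_comm a b ▸ hm) (by rw [h.gap_comm]; exact h0) hs2
  push Not at hs1 hs2
  obtain ⟨x, hx⟩ := hs1
  obtain ⟨x', hx'⟩ := hs2
  obtain ⟨y, hy, t⟩ := hapex a b hab hm hx
  obtain ⟨y', hy', t'⟩ := hapex b a hab.symm (Finset.pair_comm a b ▸ hm) hx'
  have t'' : IsTriangle T y' a b := t'.swap.rotate
  obtain ⟨hpos, μ, ν, hdec⟩ := h.exists_edge_decomposition t.rotate hf h0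
  have hS := (prod_neg_iff_sbtw h.mono).2 hy
  have hS' := (prod_neg_iff_sbtw h.mono).2 hy'
  -- The apexes y and y' lie on different sides of {a,b}, so the polynomial has opposite signs there
  -- and f lies towards one of them.
  have : ν * ((κ y - κ a) * (κ y - κ b)) ≤ 0 ∨ ν * ((κ y' - κ a) * (κ y' - κ b)) ≤ 0 := by
    by_contra hcon
    push Not at hcon
    have h1 := mul_pos hcon.1 hcon.2
    have h2 := mul_pos_of_neg_of_neg hS hS'
    have h3 : ν ^ 2 * (κ b - κ a) ^ 2 * (((κ y - κ a) * (κ y - κ b)) *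
        ((κ y' - κ a) * (κ y' - κ b))) ^ 2 < 0 := by
      nlinarith [mul_pos h1 h2]
    have : 0 ≤ ν ^ 2 * (κ b - κ a) ^ 2 * (((κ y - κ a) * (κ y - κ b)) *
        ((κ y' - κ a) * (κ y' - κ b))) ^ 2 := by positivity
    linarith
  rcases this with hν | hν
  · exact h.le_gap_of_apex t hdec hν (hT a y t.ab.symm (Finset.pair_comm y a ▸ t.mem_ab))
      (hT b y t.ac.symm (Finset.pair_comm y b ▸ t.mem_ac)) (hη a) (hη b) (hηΔ y a b t)
  · exact h.le_gap_of_apex t'' hdec hν (hT a y' t''.ab.symm (Finset.pair_comm y' a ▸ t''.mem_ab))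
      (hT b y' t''.ac.symm (Finset.pair_comm y' b ▸ t''.mem_ac)) (hη a) (hη b) (hηΔ y' a b t'')

/-- The maximum of the edge phases exceeds all other phases by a positive constant. -/
theorem CoarsePlot.exists_gap (h : CoarsePlot κ T D k) : ∃ η > 0, ∀ f, IsQuad κ f →
    (∀ x y, x ≠ y → {x, y} ∈ T → 0 ≤ gap D f x y) →
    (∃ a b, a ≠ b ∧ {a, b} ∈ T ∧ gap D f a b = 0) →
    ∀ i j, i ≠ j → {i, j} ∉ T → η ≤ gap D f i j := by
  have hlt : ∀ c : ℝ, 0 < c → ∀ᶠ η in 𝓝[>] (0 : ℝ), η ≤ c := fun c hc =>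
    (eventually_le_nhds hc).filter_mono nhdsWithin_le_nhds
  have e1 : ∀ᶠ η in 𝓝[>] (0 : ℝ), ∀ m i j, i ≠ j → {i, j} ∉ T → η ≤ gap D (k m) i j := by
    simp only [eventually_all]
    exact fun m i j hij hm => hlt _ (h.gap_pos_of_not_mem m hij hm)
  have e2 : ∀ᶠ η in 𝓝[>] (0 : ℝ), ∀ x y z i j, IsTriangle T x y z → i ≠ j → {i, j} ∉ T →
      η ≤ gap D (blackLevel κ D k x y z) i j := by
    simp only [eventually_all]
    intro x y z i j t hij hm
    obtain ⟨z1, z2, z3⟩ := h.gap_blackLevel t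
    exact hlt _ (h.gap_black_pos t (h.isQuad_blackLevel x y z) z1 z2 z3 hij hm)
  obtain ⟨η, ⟨h1, h2⟩, hη⟩ := ((e1.and e2).and self_mem_nhdsWithin).exists
  refine ⟨η, hη, fun f hf hT ⟨a, b, hab, hm, h0⟩ i j hij hij' => ?_⟩
  exact h.le_gap hf hab hm h0 hT hij (fun m => h1 m i j hij hij')
    fun x y z t => h2 x y z i j t hij hij'

end Cells

/-! ### Resolving the corners by concave folds. -/

section Folds

variable {n : ℕ} {κ : Fin n → ℝ}

theorem Crosses.of_mul_neg (hκ : StrictMono κ) {d e u v : Fin n}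
    (h : (κ d - κ u) * (κ d - κ v) * ((κ e - κ u) * (κ e - κ v)) < 0) :
    Crosses ({d, e} : Finset (Fin n)) {u, v} := by
  have key : ∀ {u v : Fin n}, κ u < κ v →
      (κ d - κ u) * (κ d - κ v) * ((κ e - κ u) * (κ e - κ v)) < 0 →
      Crosses ({d, e} : Finset (Fin n)) {u, v} := by
    intro u v huv h
    have hpos := sub_pos.2 huv
    rw [crosses_iff']
    rcases mul_neg_iff.1 h with ⟨h1, h2⟩ | ⟨h1, h2⟩
    · right
      constructor <;> refine (prod_neg_iff_sbtw hκ).1 ?_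
      · have := mul_pos hpos (neg_pos.2 h2); linarith
      · have := mul_pos hpos h1; linarith
    · left
      constructor <;> refine (prod_neg_iff_sbtw hκ).1 ?_
      · have := mul_pos hpos (neg_pos.2 h1); linarith
      · have := mul_pos hpos h2; linarith
  rcases lt_trichotomy (κ u) (κ v) with h1 | h1 | h1
  · exact key h1 h
  · rw [h1] at h
    have : 0 ≤ (κ d - κ v) * (κ d - κ v) * ((κ e - κ v) * (κ e - κ v)) :=
      mul_nonneg (mul_self_nonneg _) (mul_self_nonneg _)
    exact absurd h this.not_gt
  · rw [Finset.pair_comm u v]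
    exact key h1 (by linarith)

open Classical in
/-- A concave perturbation that folds along the chords in `τ`. -/
noncomputable def foldTerm (κ : Fin n → ℝ) (τ : Set (Finset (Fin n))) (x : Fin n) : ℝ :=
  -∑ f ∈ Finset.univ.filter (· ∈ τ), |∏ i ∈ f, (κ x - κ i)|

/-- Across a chord in `τ` the perturbation is strictly concave. -/
theorem IsTriangulation.foldTerm_lt {S : Set (Fin n)} {τ : Set (Finset (Fin n))}
    (hτ : IsTriangulation S τ) (hκ : StrictMono κ) {a b d e : Fin n}
    (hcr : Crosses ({a, b} : Finset (Fin n)) {d, e}) (hde : {d, e} ∈ τ) {α β γ δ : ℝ} (hα : 0 < α)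
    (hγ : 0 < γ) (hw : ∀ f, IsQuad κ f → α * f a + γ * f b = β * f d + δ * f e) :
    α * foldTerm κ τ a + γ * foldTerm κ τ b < β * foldTerm κ τ d + δ * foldTerm κ τ e := by
  classical
  have hne : a ≠ d ∧ a ≠ e := by
    rw [crosses_iff] at hcr
    simp only [Fin.sbtw_iff] at hcr
    omega
  -- Compared term by term: a chord f of τ does not separate d from e, so the absolute value of its
  -- polynomial is linear on {d,e}, and its weighted sum over {a,b} is at least as large. For f =
  -- {d,e} it vanishes at d and e but not at a.
  have key : ∑ f ∈ Finset.univ.filter (· ∈ τ), (β * |∏ i ∈ f, (κ d - κ i)| +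
      δ * |∏ i ∈ f, (κ e - κ i)|) < ∑ f ∈ Finset.univ.filter (· ∈ τ),
      (α * |∏ i ∈ f, (κ a - κ i)| + γ * |∏ i ∈ f, (κ b - κ i)|) := by
    refine Finset.sum_lt_sum (fun f hf => ?_) ⟨{d, e}, by simpa using hde, ?_⟩
    · have hf' : f ∈ τ := by simpa using hf
      obtain ⟨u, v, huv, rfl⟩ := Finset.card_eq_two.1 (hτ.1 f hf').1
      simp only [Finset.prod_pair huv]
      have hq := hw _ (by simpa using isQuad_mul_sub (κ := κ) 1 (κ u) (κ v))
      have hs : 0 ≤ (κ d - κ u) * (κ d - κ v) * ((κ e - κ u) * (κ e - κ v)) := by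
        by_contra hcon
        exact hτ.2.1 _ hde _ hf' (Crosses.of_mul_neg hκ (not_le.1 hcon))
      beta_reduce at hq
      set sa := (κ a - κ u) * (κ a - κ v)
      set sb := (κ b - κ u) * (κ b - κ v)
      set sd := (κ d - κ u) * (κ d - κ v)
      set se := (κ e - κ u) * (κ e - κ v)
      have h1 : α * sa ≤ α * |sa| := mul_le_mul_of_nonneg_left (le_abs_self _) hα.le
      have h2 : γ * sb ≤ γ * |sb| := mul_le_mul_of_nonneg_left (le_abs_self _) hγ.le
      have h3 : α * -sa ≤ α * |sa| := mul_le_mul_of_nonneg_left (neg_le_abs _) hα.le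
      have h4 : γ * -sb ≤ γ * |sb| := mul_le_mul_of_nonneg_left (neg_le_abs _) hγ.le
      rcases le_total 0 sd with hd | hd <;> rcases le_total 0 se with he | he
      · rw [abs_of_nonneg hd, abs_of_nonneg he]; linarith
      · rcases mul_eq_zero.1 (le_antisymm (mul_nonpos_of_nonneg_of_nonpos hd he) hs) with h0 | h0
        · rw [h0] at hq ⊢; rw [abs_of_nonpos he, abs_zero]; linarith
        · rw [h0] at hq ⊢; rw [abs_of_nonneg hd, abs_zero]; linarith
      · rcases mul_eq_zero.1 (le_antisymm (mul_nonpos_of_nonpos_of_nonneg hd he) hs) with h0 | h0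
        · rw [h0] at hq ⊢; rw [abs_of_nonneg he, abs_zero]; linarith
        · rw [h0] at hq ⊢; rw [abs_of_nonpos hd, abs_zero]; linarith
      · rw [abs_of_nonpos hd, abs_of_nonpos he]; linarith
    · have hde' : d ≠ e := Finset.ne_of_card_pair (hτ.1 _ hde).1
      simp only [Finset.prod_pair hde']
      rw [sub_self, sub_self, zero_mul, mul_zero, abs_zero, mul_zero, mul_zero, add_zero]
      have h1 : 0 < |(κ a - κ d) * (κ a - κ e)| := abs_pos.2 (mul_ne_zero
        (sub_ne_zero.2 (hκ.injective.ne hne.1)) (sub_ne_zero.2 (hκ.injective.ne hne.2)))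
      have := mul_pos hα h1
      have := mul_nonneg hγ.le (abs_nonneg ((κ b - κ d) * (κ b - κ e)))
      linarith
  rw [Finset.sum_add_distrib, Finset.sum_add_distrib, ← Finset.mul_sum, ← Finset.mul_sum,
    ← Finset.mul_sum, ← Finset.mul_sum] at key
  unfold foldTerm
  linarith

/-- Constant terms whose phases at the edges are quadratic polynomials perturbed by folds. -/
structure FoldedPlot (κ : Fin n → ℝ) (T : Set (Finset (Fin n))) (τ : Fin n → Set (Finset (Fin n)))
    (c : Finset (Fin n) → ℝ) : Prop where
  mono : StrictMono κ
  resolution : IsResolution T τ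
  labels : regionLabels κ c ⊆ T
  fold : ∀ m, ∃ g, IsQuad κ g ∧ ∀ x, m ≠ x → {m, x} ∈ T → c {m, x} = g x + foldTerm κ (τ m) x
  shares : SharesLabel κ c

variable {T : Set (Finset (Fin n))} {τ : Fin n → Set (Finset (Fin n))} {c : Finset (Fin n) → ℝ}

theorem isQuad_vertexSlope (p : ℝ × ℝ) : IsQuad κ fun x => vertexSlope κ x p :=
  ⟨(0, p.1, p.2), fun x => by simp only [vertexSlope, quadEval]; ring⟩

/-- If {a,b} crossed a chord {d,e} of τ m, the fold would lift a weighted mean of the phases {m,d}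
and {m,e} above that of the maximal phases {m,a} and {m,b}. So {a,b} crosses no chord of τ m and
belongs to it. -/
theorem FoldedPlot.mem_of_adherent (h : FoldedPlot κ T τ c) {m a b : Fin n} (hab : a ≠ b)
    {p : ℝ × ℝ} (ha : Adherent κ c p {m, a}) (hb : Adherent κ c p {m, b}) : {a, b} ∈ τ m := by
  refine (h.resolution m).2.2 _ (Finset.card_pair hab) (fun i hi => ?_) (fun f hf hcr => ?_)
  · simp only [Finset.mem_insert, Finset.mem_singleton] at hi
    rcases hi with rfl | rfl
    · exact ⟨h.labels ha.1, ha.ne⟩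
    · exact ⟨h.labels hb.1, hb.ne⟩
  · obtain ⟨d, e, hde, rfl⟩ := Finset.card_eq_two.1 ((h.resolution m).1 f hf).1
    have hd := ((h.resolution m).1 _ hf).2 d (by simp)
    have he := ((h.resolution m).1 _ hf).2 e (by simp)
    obtain ⟨α, β, γ, δ, hα, hβ, hγ, hδ, hs, hw⟩ := hcr.exists_weights h.mono
    have hlt := (h.resolution m).foldTerm_lt h.mono hcr hf hα hγ hw
    obtain ⟨g, hg, hc⟩ := h.fold m
    have hq := hw _ (hg.add (isQuad_vertexSlope p))
    beta_reduce at hq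
    have hh : ∀ x, m ≠ x → {m, x} ∈ T → height κ c {m, x} p =
        g x + foldTerm κ (τ m) x + vertexSlope κ m p + vertexSlope κ x p := by
      intro x hx hm
      unfold height
      rw [hc x hx hm, slope₂_eq_vertexSlope hx]
      ring
    have e1 := ha.height_eq hb
    have e2 := ha.2.2 {m, d} (Finset.card_pair hd.2)
    have e3 := ha.2.2 {m, e} (Finset.card_pair he.2)
    rw [hh d hd.2 hd.1, hh a ha.ne (h.labels ha.1)] at e2
    rw [hh e he.2 he.1, hh a ha.ne (h.labels ha.1)] at e3
    rw [hh b hb.ne (h.labels hb.1), hh a ha.ne (h.labels ha.1)] at e1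
    set X := g a + foldTerm κ (τ m) a + vertexSlope κ a p with hX
    have e1' : g b + foldTerm κ (τ m) b + vertexSlope κ b p = X := by linarith
    have i1 := mul_le_mul_of_nonneg_left
      (show g d + foldTerm κ (τ m) d + vertexSlope κ d p ≤ X by linarith) hβ.le
    have i2 := mul_le_mul_of_nonneg_left
      (show g e + foldTerm κ (τ m) e + vertexSlope κ e p ≤ X by linarith) hδ.le
    have i3 : α * X + γ * X = β * X + δ * X := by linear_combination X * hs
    have i4 : α * X = α * (g a + foldTerm κ (τ m) a + vertexSlope κ a p) := by rw [hX]
    have i5 : γ * X = γ * (g b + foldTerm κ (τ m) b + vertexSlope κ b p) := by rw [e1']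
    linarith

/-- Three pairs that meet pairwise form a star or a triangle, and no fourth pair meets all sides of
a triangle. -/
theorem exists_common_of_pairwise {α : Type*} [DecidableEq α] {s₁ s₂ s₃ s₄ : Finset α}
    (c1 : s₁.card = 2) (c2 : s₂.card = 2) (c3 : s₃.card = 2) (c4 : s₄.card = 2)
    (h12 : s₁ ≠ s₂) (h13 : s₁ ≠ s₃) (h23 : s₂ ≠ s₃) (h14 : s₁ ≠ s₄) (h24 : s₂ ≠ s₄) (h34 : s₃ ≠ s₄)
    (i12 : ∃ i, i ∈ s₁ ∧ i ∈ s₂) (i13 : ∃ i, i ∈ s₁ ∧ i ∈ s₃) (i23 : ∃ i, i ∈ s₂ ∧ i ∈ s₃)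
    (i14 : ∃ i, i ∈ s₁ ∧ i ∈ s₄) (i24 : ∃ i, i ∈ s₂ ∧ i ∈ s₄) (i34 : ∃ i, i ∈ s₃ ∧ i ∈ s₄) :
    ∃ m, m ∈ s₁ ∧ m ∈ s₂ ∧ m ∈ s₃ ∧ m ∈ s₄ := by
  obtain ⟨m, h1, h2⟩ := i12
  obtain ⟨a, rfl⟩ := Finset.eq_pair_of_mem c1 h1
  obtain ⟨b, rfl⟩ := Finset.eq_pair_of_mem c2 h2
  have hab : a ≠ b := fun e => h12 (by rw [e])
  have key : ∀ s : Finset α, s.card = 2 → (∃ i, i ∈ ({m, a} : Finset α) ∧ i ∈ s) →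
      (∃ i, i ∈ ({m, b} : Finset α) ∧ i ∈ s) → m ∈ s ∨ s = {a, b} := by
    rintro s hs ⟨x, hx, hxs⟩ ⟨y, hy, hys⟩
    simp only [Finset.mem_insert, Finset.mem_singleton] at hx hy
    rcases hx with rfl | rfl
    · exact Or.inl hxs
    rcases hy with rfl | rfl
    · exact Or.inl hys
    right
    exact (Finset.eq_of_subset_of_card_le (by
      intro z hz
      simp only [Finset.mem_insert, Finset.mem_singleton] at hz
      rcases hz with rfl | rfl <;> assumption) (by rw [hs, Finset.card_pair hab])).symm
  have hmem : ∀ s : Finset α, s.card = 2 → m ∈ s → (∃ i, i ∈ ({a, b} : Finset α) ∧ i ∈ s) →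
      a ≠ m → b ≠ m → s = {m, a} ∨ s = {m, b} := by
    rintro s hs hms ⟨i, hi, his⟩ ha hb
    obtain ⟨x, rfl⟩ := Finset.eq_pair_of_mem hs hms
    simp only [Finset.mem_insert, Finset.mem_singleton] at hi his
    rcases hi with rfl | rfl <;> rcases his with rfl | rfl
    · exact absurd rfl ha
    · exact Or.inl rfl
    · exact absurd rfl hb
    · exact Or.inr rfl
  have hma := Finset.ne_of_card_pair c1
  have hmb := Finset.ne_of_card_pair c2
  refine ⟨m, h1, h2, ?_⟩
  rcases key s₃ c3 i13 i23 with h3 | rfl <;> rcases key s₄ c4 i14 i24 with h4 | rfl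
  · exact ⟨h3, h4⟩
  · exfalso
    rcases hmem s₃ c3 h3 (i34.imp fun _ => And.symm) hma.symm hmb.symm with e | e
    · exact h13 e.symm
    · exact h23 e.symm
  · exfalso
    rcases hmem s₄ c4 h4 i34 hma.symm hmb.symm with e | e
    · exact h14 e.symm
    · exact h24 e.symm
  · exact absurd rfl h34

/-- Four regions at a point share an index m, and all their other indices would be joined in τ m;
but of the chords between four corners two cross. -/
theorem FoldedPlot.atMostThree (h : FoldedPlot κ T τ c) : AtMostThree κ c := by
  intro p s₁ s₂ s₃ s₄ h1 h2 h3 h4 h12 h13 h23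
  by_contra hcon
  push Not at hcon
  obtain ⟨m, m1, m2, m3, m4⟩ := exists_common_of_pairwise h1.2.1 h2.2.1 h3.2.1 h4.2.1 h12 h13 h23
    hcon.1.symm hcon.2.1.symm hcon.2.2.symm (h.shares p _ _ h1 h2) (h.shares p _ _ h1 h3)
    (h.shares p _ _ h2 h3) (h.shares p _ _ h1 h4) (h.shares p _ _ h2 h4) (h.shares p _ _ h3 h4)
  obtain ⟨a, rfl⟩ := Finset.eq_pair_of_mem h1.2.1 m1
  obtain ⟨b, rfl⟩ := Finset.eq_pair_of_mem h2.2.1 m2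
  obtain ⟨d, rfl⟩ := Finset.eq_pair_of_mem h3.2.1 m3
  obtain ⟨x, rfl⟩ := Finset.eq_pair_of_mem h4.2.1 m4
  have hne : ∀ {u v : Fin n}, ({m, u} : Finset (Fin n)) ≠ {m, v} → u ≠ v := fun h e => h (by rw [e])
  have t12 := h.mem_of_adherent (hne h12) h1 h2
  have t13 := h.mem_of_adherent (hne h13) h1 h3
  have t23 := h.mem_of_adherent (hne h23) h2 h3
  have t41 := h.mem_of_adherent (hne hcon.1) h4 h1
  have t42 := h.mem_of_adherent (hne hcon.2.1) h4 h2
  have t43 := h.mem_of_adherent (hne hcon.2.2) h4 h3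
  rcases crosses_cases (hne h12) (hne h23) (hne h13) (hne hcon.1) (hne hcon.2.1) (hne hcon.2.2)
    with e | e | e
  · exact (h.resolution m).2.1 _ t41 _ t23 e
  · exact (h.resolution m).2.1 _ t42 _ (Finset.pair_comm a d ▸ t13) e
  · exact (h.resolution m).2.1 _ t43 _ t12 e

end Folds

/-! ### Realization of a given triangulation and resolution. -/

section Existence

variable {n : ℕ} {κ : Fin n → ℝ} {T : Set (Finset (Fin n))}

/-- The `2 × n` matrix with the columns `v`. -/
def columnMatrix (v : Fin n → ℝ × ℝ) : Matrix (Fin 2) (Fin n) ℝ :=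
  Matrix.of ![fun j => (v j).1, fun j => (v j).2]

theorem minor_columnMatrix (v : Fin n → ℝ × ℝ) {a b : Fin n} (hab : a < b)
    (h : ({a, b} : Finset (Fin n)).card = 2) :
    minor (columnMatrix v) ⟨{a, b}, h⟩ = symMinor v a b := by
  have hu : ![a, b] = ({a, b} : Finset (Fin n)).orderEmbOfFin h := by
    refine Finset.orderEmbOfFin_unique h (fun x => ?_) ?_
    · fin_cases x <;> simp
    · intro x y hxy
      fin_cases x <;> fin_cases y <;> simp_all
  unfold minor
  simp only
  rw [← hu, symMinor_of_lt v hab, Matrix.det_fin_two]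
  simp [columnMatrix]

theorem vandermonde_pair {a b : Fin n} (hab : a < b)
    (h : ({a, b} : Finset (Fin n)).card = 2) :
    vandermonde κ (⟨{a, b}, h⟩ : KSubset 2 n) = symMinor (fun x => (1, κ x)) a b := by
  unfold vandermonde
  rw [symMinor_of_lt _ hab]
  simp only [Finset.prod_pair hab.ne]
  have e1 : ({a, b} : Finset (Fin n)).filter (a < ·) = {b} := by
    ext x; simp only [Finset.mem_filter, Finset.mem_insert, Finset.mem_singleton]
    constructor
    · rintro ⟨rfl | rfl, hx⟩
      · exact absurd hx (lt_irrefl _)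
      · rfl
    · rintro rfl; exact ⟨Or.inr rfl, hab⟩
  have e2 : ({a, b} : Finset (Fin n)).filter (b < ·) = ∅ := by
    ext x; simp only [Finset.mem_filter, Finset.mem_insert, Finset.mem_singleton,
      Finset.notMem_empty, iff_false, not_and]
    rintro (rfl | rfl) hx
    · exact absurd hx hab.not_gt
    · exact absurd hx (lt_irrefl _)
  rw [e1, e2]
  simp

theorem constTerm_columnMatrix (v : Fin n → ℝ × ℝ) {a b : Fin n} (hab : a ≠ b) :
    constTerm κ (columnMatrix v) 0 {a, b} =
      Real.log (symMinor v a b * symMinor (fun x => (1, κ x)) a b) := by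
  have key : ∀ {a b : Fin n}, a < b → constTerm κ (columnMatrix v) 0 {a, b} =
      Real.log (symMinor v a b * symMinor (fun x => (1, κ x)) a b) := by
    intro a b hab
    unfold constTerm
    rw [dif_pos (Finset.card_pair hab.ne), minor_columnMatrix v hab, vandermonde_pair hab]
    simp
  rcases lt_or_gt_of_ne hab with h | h
  · exact key h
  · rw [Finset.pair_comm, symMinor_comm v, symMinor_comm _ a b]
    exact key h

theorem isTotallyPositive_columnMatrix {v : Fin n → ℝ × ℝ}
    (hv : ∀ a b, a ≠ b → 0 < symMinor v a b) : IsTotallyPositive (columnMatrix v) := by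
  rintro ⟨I, hI⟩
  obtain ⟨a, b, hab, rfl⟩ := Finset.card_eq_two.1 hI
  rcases lt_or_gt_of_ne hab with h | h
  · rw [minor_columnMatrix v h]; exact hv a b hab
  · simp only [Finset.pair_comm a b]
    rw [minor_columnMatrix v h]; exact hv b a hab.symm

theorem symMinor_vandermonde_pos (hκ : StrictMono κ) {a b : Fin n} (hab : a ≠ b) :
    0 < symMinor (fun x => (1, κ x)) a b := by
  rcases lt_or_gt_of_ne hab with h | h
  · rw [symMinor_of_lt _ h]; have := hκ h; simp only; linarith
  · rw [symMinor_comm, symMinor_of_lt _ h]; have := hκ h; simp only; linarith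

theorem Crosses.pairwise_ne {a b c e : Fin n} (h : Crosses ({a, c} : Finset (Fin n)) {b, e}) :
    a ≠ b ∧ c ≠ e ∧ b ≠ c ∧ a ≠ e ∧ a ≠ c ∧ b ≠ e := by
  rw [crosses_iff] at h
  simp only [Fin.sbtw_iff] at h
  omega

/-- The Plücker relation bounds the phases of two opposite sides of a quadrilateral by those of its
diagonals. -/
theorem constTerm_add_lt (hκ : StrictMono κ) {v : Fin n → ℝ × ℝ}
    (hv : ∀ a b, a ≠ b → 0 < symMinor v a b) {a b c e : Fin n}
    (hcr : Crosses ({a, c} : Finset (Fin n)) {b, e}) :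
    constTerm κ (columnMatrix v) 0 {a, b} + constTerm κ (columnMatrix v) 0 {c, e} <
      constTerm κ (columnMatrix v) 0 {a, c} + constTerm κ (columnMatrix v) 0 {b, e} := by
  obtain ⟨n1, n2, n3, n4, n5, n6⟩ := hcr.pairwise_ne
  have hk := fun {a b : Fin n} (h : a ≠ b) => symMinor_vandermonde_pos hκ h
  have hp := fun {a b : Fin n} (h : a ≠ b) => mul_pos (hv a b h) (hk h)
  rw [constTerm_columnMatrix v n1, constTerm_columnMatrix v n2, constTerm_columnMatrix v n5,
    constTerm_columnMatrix v n6, ← Real.log_mul (hp n1).ne' (hp n2).ne',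
    ← Real.log_mul (hp n5).ne' (hp n6).ne']
  refine Real.log_lt_log (mul_pos (hp n1) (hp n2)) ?_
  have e1 := symMinor_plucker v hcr
  have e2 := symMinor_plucker (fun x => (1, κ x)) hcr
  have l1 : symMinor v a b * symMinor v c e < symMinor v a c * symMinor v b e := by
    have := mul_pos (hv b c n3) (hv a e n4); linarith
  have l2 : symMinor (fun x => (1, κ x)) a b * symMinor (fun x => (1, κ x)) c e <
      symMinor (fun x => (1, κ x)) a c * symMinor (fun x => (1, κ x)) b e := by
    have := mul_pos (hk n3) (hk n4); linarith
  have := mul_lt_mul'' l1 l2 (mul_pos (hv a b n1) (hv c e n2)).le (mul_pos (hk n1) (hk n2)).le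
  linarith

/-- If the regions of a totally positive matrix are labelled by pairwise noncrossing pairs, there is
no phase shift. -/
theorem sharesLabel_columnMatrix (hκ : StrictMono κ) {v : Fin n → ℝ × ℝ}
    (hv : ∀ a b, a ≠ b → 0 < symMinor v a b) (hT : IsTriangulation Set.univ T)
    (hl : regionLabels κ (constTerm κ (columnMatrix v) 0) ⊆ T) :
    SharesLabel κ (constTerm κ (columnMatrix v) 0) := by
  intro p s s' hs hs'
  by_contra hcon
  push Not at hcon
  obtain ⟨a, b, hab, rfl⟩ := Finset.card_eq_two.1 hs.2.1
  obtain ⟨c, e, hce, rfl⟩ := Finset.card_eq_two.1 hs'.2.1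
  have h1 := hcon a (by simp)
  have h2 := hcon b (by simp)
  simp only [Finset.mem_insert, Finset.mem_singleton, not_or] at h1 h2
  -- Let {a,b} and {c,e} be opposite sides of a quadrangle, both maximal at p. The diagonals have
  -- the same total slope but a larger total constant term, so one of them would exceed the maximum.
  have key : ∀ c e, c ≠ e → Crosses ({a, c} : Finset (Fin n)) {b, e} →
      Adherent κ (constTerm κ (columnMatrix v) 0) p {c, e} → False := by
    intro c e hce hcr hs'
    obtain ⟨n1, n2, n3, n4, n5, n6⟩ := hcr.pairwise_ne
    have hlt := constTerm_add_lt hκ hv hcr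
    have e1 := hs.2.2 {a, c} (Finset.card_pair n5)
    have e2 := hs'.2.2 {b, e} (Finset.card_pair n6)
    unfold height at e1 e2
    rw [slope₂_eq_vertexSlope n1, slope₂_eq_vertexSlope n5] at e1
    rw [slope₂_eq_vertexSlope n2, slope₂_eq_vertexSlope n6] at e2
    have e3 := hs.height_eq hs'
    have e4 := hs.2.2 {b, e} (Finset.card_pair n6)
    unfold height at e3 e4
    rw [slope₂_eq_vertexSlope n1, slope₂_eq_vertexSlope n2] at e3
    rw [slope₂_eq_vertexSlope n1, slope₂_eq_vertexSlope n6] at e4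
    linarith
  rcases crosses_cases (x := a) (a := b) (b := c) (c := e) h2.1 hce h2.2 hab h1.1 h1.2
    with hx | hx | hx
  · exact hT.2.1 _ (hl hs.1) _ (hl hs'.1) hx
  · exact key c e hce (Finset.pair_comm e b ▸ hx) hs'
  · exact key e c hce.symm hx (Finset.pair_comm c e ▸ hs')

/-- For a long enough time scale only the edges of the coarse plot are visible. -/
theorem CoarsePlot.regionLabels_subset {D k : Fin n → Fin n → ℝ} (h : CoarsePlot κ T D k)
    {g C : Fin n → Fin n → ℝ} : ∀ᶠ M in atTop, ∀ c : Finset (Fin n) → ℝ,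
      (∀ a b, a ≠ b → {a, b} ∈ T → c {a, b} = M * D a b + g a b) →
      (∀ a b, a ≠ b → c {a, b} ≤ M * D a b + C a b) → regionLabels κ c ⊆ T := by
  classical
  obtain ⟨η, hη, hgap⟩ := h.exists_gap
  have hM : ∀ᶠ M in atTop, ∀ i j a b, C i j - g a b < M * η := by
    simp only [eventually_all]
    exact fun i j a b => (tendsto_id.atTop_mul_const hη).eventually_gt_atTop _
  filter_upwards [hM, eventually_gt_atTop 0] with M hM hM0 c hc hc'
  rintro s ⟨p, hs⟩
  obtain ⟨i, j, hij, rfl⟩ := Finset.card_eq_two.1 hs.1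
  by_contra hm
  have hne : (Finset.univ.filter fun x : Fin n × Fin n => x.1 ≠ x.2 ∧ {x.1, x.2} ∈ T).Nonempty := by
    obtain ⟨a, b, hab, -⟩ := exists_cyclic_neighbours h.three_le i
    have hne : i ≠ a := by simp only [Fin.sbtw_iff] at hab; omega
    obtain ⟨x, hx⟩ : ∃ x : Fin n, ∃ y, x ≠ y ∧ {x, y} ∈ T := by
      by_contra hcon
      push Not at hcon
      refine hcon i a hne (h.tri.2.2 _ (Finset.card_pair hne) (by simp) fun f hf => ?_)
      obtain ⟨u, v, huv, rfl⟩ := Finset.card_eq_two.1 (h.tri.1 f hf).1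
      exact absurd hf (hcon u v huv)
    obtain ⟨y, hxy⟩ := hx
    exact ⟨(x, y), by simpa using hxy⟩
  obtain ⟨⟨a, b⟩, hab, hmax⟩ := Finset.exists_max_image _
    (fun x : Fin n × Fin n => D x.1 x.2 + (vertexSlope κ x.1 p + vertexSlope κ x.2 p) / M) hne
  simp only [Finset.mem_filter, Finset.mem_univ, true_and] at hab hmax
  set F := D a b + (vertexSlope κ a p + vertexSlope κ b p) / M with hF
  -- This is the level of p after division by M: at the height F the best edge has zero gap.
  have hq : IsQuad κ fun x => F / 2 - 1 / M * vertexSlope κ x p :=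
    (isQuad_const _).sub ((isQuad_vertexSlope p).const_mul _)
  have hg : ∀ x y, gap D (fun x => F / 2 - 1 / M * vertexSlope κ x p) x y =
      F - (D x y + (vertexSlope κ x p + vertexSlope κ y p) / M) := by
    intro x y
    unfold gap
    ring
  have := hgap _ hq (fun x y hxy hm => by rw [hg]; linarith [hmax (x, y) ⟨hxy, hm⟩])
    ⟨a, b, hab.1, hab.2, by rw [hg, hF, sub_self]⟩ i j hij hm
  rw [hg, hF] at this
  have e1 := mul_le_mul_of_nonneg_left this hM0.le
  have e2 : M * (D a b + (vertexSlope κ a p + vertexSlope κ b p) / M -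
      (D i j + (vertexSlope κ i p + vertexSlope κ j p) / M)) = M * D a b +
      (vertexSlope κ a p + vertexSlope κ b p) - (M * D i j +
      (vertexSlope κ i p + vertexSlope κ j p)) := by
    field_simp
  rw [e2] at e1
  have e3 := hs.2 {a, b} (Finset.card_pair hab.1) (fun e => hm (e ▸ hab.2))
  unfold height at e3
  rw [hc a b hab.1 hab.2, slope₂_eq_vertexSlope hab.1, slope₂_eq_vertexSlope hij] at e3
  linarith [hc' i j hij, hM i j a b]

/-- Each triangulation with a resolution of its vertices is realized by a contour plot. -/
theorem exists_contourPlot (hn : 3 ≤ n) (hκ : IsGenericParameter 2 κ)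
    {τ : Fin n → Set (Finset (Fin n))} (hT : IsTriangulation Set.univ T) (hτ : IsResolution T τ) :
    ∃ A : Matrix (Fin 2) (Fin n) ℝ, IsTotallyPositive A ∧ IsGenericWithoutXCrossings κ A 0 ∧
      Nonempty (DiskGraph.Iso (solitonGraph κ A 0) (psiGraph T τ)) := by
  have hm := hκ.1
  obtain ⟨q, hq, hacute⟩ := hT.exists_acute (by omega) hm
  obtain ⟨r, hr⟩ := hT.exists_symmetrizing (by omega) hm fun a b => foldTerm κ (τ a) b
  set w : Fin n → Fin n → ℝ := fun a b => quadEval (q a) (κ b) with hw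
  set g : Fin n → Fin n → ℝ := fun a b => foldTerm κ (τ a) b + quadEval (r a) (κ b) with hg
  set K : Fin n → Fin n → ℝ := fun a b => symMinor (fun x => (1, κ x)) a b with hK
  have hKpos : ∀ {a b : Fin n}, a ≠ b → 0 < K a b := fun h => symMinor_vandermonde_pos hm h
  -- Division by the Vandermonde factor `K` makes the constant terms on the edges equal to M w + g.
  choose v hv using fun M : ℝ => hT.exists_columns (by omega)
    (fun a b => Real.exp (M * w a b + (g a b - Real.log (K a b)))) fun _ _ => Real.exp_pos _
  obtain ⟨d, hd, hdw, hgrow, hpl⟩ := hT.exists_growth hv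
  have hdw' : ∀ a b, a ≠ b → {a, b} ∈ T → d a b = w a b := by
    intro a b hab hm
    rcases lt_or_gt_of_ne hab with h | h
    · exact hdw a b h hm
    · rw [hd, hdw b a h (Finset.pair_comm a b ▸ hm)]
      exact (hq a b hm).symm
  -- Half of the value at m is subtracted so that the levels at m and x add up to the coarse term of
  -- the edge {m,x}.
  have hcoarse : CoarsePlot κ T d fun m x => quadEval (q m) (κ x) - quadEval (q m) (κ m) / 2 :=
    { three_le := hn
      tri := hT
      mono := hm
      symm := hd
      quad := fun m => IsQuad.sub ⟨q m, fun _ => rfl⟩ (isQuad_const _)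
      edge := fun a b hab hm => by
        unfold gap
        rw [hdw' a b hab hm, hw]
        ring
      acute := fun a b c hab hbc hac h1 h2 h3 => by
        have := hacute a b c hab hbc hac h1 h2 h3
        unfold gap
        rw [hdw' b c hbc h2, hw]
        linarith
      plucker := hpl }
  choose! C hC using hgrow
  obtain ⟨M, hlabels, hM⟩ := ((hcoarse.regionLabels_subset (g := g)
    (C := fun a b => C a b + Real.log (K a b))).and (eventually_ge_atTop 0)).exists
  have hpos : ∀ a b, a ≠ b → 0 < symMinor (v M) a b := fun a b hab =>
    (Real.exp_pos _).trans_le (hC a b hab M hM).1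
  have hedge : ∀ a b, a ≠ b → {a, b} ∈ T →
      constTerm κ (columnMatrix (v M)) 0 {a, b} = M * w a b + g a b := by
    have key : ∀ a b, a < b → {a, b} ∈ T →
        constTerm κ (columnMatrix (v M)) 0 {a, b} = M * w a b + g a b := by
      intro a b hab hm
      rw [constTerm_columnMatrix (v M) hab.ne, hv M a b hab hm,
        Real.log_mul (Real.exp_pos _).ne' (hKpos hab.ne).ne', Real.log_exp]
      ring
    intro a b hab hm
    rcases lt_or_gt_of_ne hab with h | h
    · exact key a b h hm
    · have e1 : w a b = w b a := hq a b hm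
      have e2 : g a b = g b a := hr a b hm
      rw [e1, e2, Finset.pair_comm]
      exact key b a h (Finset.pair_comm a b ▸ hm)
  have hl := hlabels (constTerm κ (columnMatrix (v M)) 0)
    (fun a b hab hm => by rw [hedge a b hab hm, hdw' a b hab hm])
    (fun a b hab => by
      rw [constTerm_columnMatrix (v M) hab, Real.log_mul (hpos a b hab).ne' (hKpos hab).ne']
      have := Real.log_le_log (hpos a b hab) (hC a b hab M hM).2
      rw [Real.log_exp] at this
      linarith)
  have hs := sharesLabel_columnMatrix hm hpos hT hl
  have hfold : FoldedPlot κ T τ (constTerm κ (columnMatrix (v M)) 0) :=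
    { mono := hm
      resolution := hτ
      labels := hl
      fold := fun m => ⟨fun x => M * quadEval (q m) (κ x) + quadEval (r m) (κ x),
        (IsQuad.const_mul ⟨q m, fun _ => rfl⟩ M).add ⟨r m, fun _ => rfl⟩, fun x hx hm => by
          rw [hedge m x hx hm, hw, hg]
          ring⟩
      shares := hs }
  have hgen := (isGenericWithoutXCrossings_iff (by omega) hκ.distinctSums).2
    ⟨hfold.atMostThree, hs⟩
  exact ⟨_, isTotallyPositive_columnMatrix hpos, hgen, nonempty_iso_of_subset hn hκ hT hτ hgen hl
    fun m a b ⟨hab, p, ha, hb⟩ => hfold.mem_of_adherent hab ha hb⟩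

end Existence


theorem mainTheorem10 (n : ℕ) (hn : 3 ≤ n) (κ : Fin n → ℝ) (hκ : IsGenericParameter 2 κ) :
    (∀ (T : Set (Finset (Fin n))) (τ : Fin n → Set (Finset (Fin n))),
      IsTriangulation Set.univ T → IsResolution T τ →
        ∃ (A : Matrix (Fin 2) (Fin n) ℝ) (t : ℝ),
          IsTotallyPositive A ∧ IsGenericWithoutXCrossings κ A t ∧
            Nonempty (DiskGraph.Iso (solitonGraph κ A t) (psiGraph T τ))) ∧
    (∀ (A : Matrix (Fin 2) (Fin n) ℝ) (t : ℝ),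
      IsTotallyPositive A → IsGenericWithoutXCrossings κ A t →
        ∃ (T : Set (Finset (Fin n))) (τ : Fin n → Set (Finset (Fin n))),
          IsTriangulation Set.univ T ∧ IsResolution T τ ∧
            Nonempty (DiskGraph.Iso (solitonGraph κ A t) (psiGraph T τ))) :=
  ⟨fun _ _ hT hτ =>
    have ⟨A, h1, h2, h3⟩ := exists_contourPlot hn hκ hT hτ
    ⟨A, 0, h1, h2, h3⟩,
  fun _ _ _ h => exists_psiGraph_of_isGenericWithoutXCrossings hn hκ h⟩
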